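/- **Theorem 5.4** (combinatorial CLT for general i.i.d. sequences). Let $\mathbb N=\{0,1,2,\dots\}$ and $q\ge 1$. Let $K$ be a (finite or infinite) symmetric set of $q$-tuples $(i_1,\dots,i_q)\in\mathbb N^q$ with pairwise distinct entries (symmetric: closed under permuting the entries), let $(b_k)_{k\ge 0}$ be a sequence of real numbers, let $\mu_b=\sum_{k\ge 0}b_k^2\,\delta_k$ on $\mathbb N$, so that $\mu_b^{\otimes q}(A)=\sum_{(i_1,\dots,i_q)\in A}b_{i_1}^2\cdots b_{i_q}^2$ for $A\subset\mathbb N^q$, and assume $0<\mu_b^{\otimes q}(K)<\infty$. Let $(X_k)_{k\ge 0}$ be i.i.d. real random variables with $E[X_1]=0$ and $0<E[X_1^2]<\infty$, and put $$S^{(b)}(K)=\frac{1}{\big(q!\,\mu_b^{\otimes q}(K)\,(E[X_1^2])^q\big)^{1/2}}\sum_{(i_1,\dots,i_q)\in K}b_{i_1}\cdots b_{i_q}X_{i_1}\cdots X_{i_q},$$ where the sum converges in $L^2$ (unconditionally, i.e. along the finite subsets of $K$). Let $K^*_j$ be the set of all tuples in $K$ having $j$ among their entries, and let $K^\#\subset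 K\times K$ be the set of all pairs $\big((i_1,\dots,i_q),(j_1,\dots,j_q)\big)$ of tuples of $K$ such that $\{i_1,\dots,i_q\}\cap\{j_1,\dots,j_q\}=\emptyset$ and there are $(k_1,\dots,k_q),(l_1,\dots,l_q)\in K$ with $\{k_1,\dots,k_q\}\cup\{l_1,\dots,l_q\}=\{i_1,\dots,i_q\}\cup\{j_1,\dots,j_q\}$, $\{k_1,\dots,k_q\}\ne\{i_1,\dots,i_q\}$ and $\{k_1,\dots,k_q\}\ne\{j_1,\dots,j_q\}$. Then there is a finite constant $C=C(q)$, depending only on $q$, such that $$d_W\big(S^{(b)}(K),\mathcal N\big)\le C\left(\frac{E[X_1^4]}{(E[X_1^2])^2}\right)^{q}\left[\frac{\big(\mu_b^{\otimes 2q}(K^\#)\big)^{1/2}}{\mu_b^{\otimes q}(K)}+\Big(\sup_{j\ge 0}\frac{\mu_b^{\otimes q}(K^*_j)}{\mu_b^{\otimes q}(K)}\Big)^{1/4}\right],$$ where $\mathcal N$ is the standard normal law and $d_W(X,Y)=\sup_h|E[h(X)]-E[h(Y)]|$, the supremum being over all $h:\mathbb R\to\mathbb R$ with Lipschitz constant at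 most $1$ (if $E[X_1^4]=\infty$ the right-hand side is $+\infty$). -/

import Mathlib

open MeasureTheory ProbabilityTheory Filter Topology
open scoped NNReal ENNReal

noncomputable section

namespace CombCLT

/-- The Wasserstein distance between two laws on the real line: the supremum of
`|∫ h dμ - ∫ h dν|` over all real functions `h` with Lipschitz constant at most `1`,
as an extended nonnegative number. (A Lipschitz function is integrable for every probability
measure with a finite first moment.) -/
def wassersteinDist (μ ν : Measure ℝ) : ℝ≥0∞ :=
  ⨆ (h : ℝ → ℝ) (_ : LipschitzWith 1 h), ENNReal.ofReal |(∫ x, h x ∂μ) - ∫ x, h x ∂ν|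

/-- The measure `μ_b = ∑ₖ bₖ² δₖ` on `ℕ`, written as a density for the counting measure. -/
def weightMeasure (b : ℕ → ℝ) : Measure ℕ :=
  Measure.count.withDensity fun k => ENNReal.ofReal (b k ^ 2)

instance weightMeasure_sigmaFinite (b : ℕ → ℝ) : SigmaFinite (weightMeasure b) :=
  SigmaFinite.withDensity_ofReal _

/-- The product measure `μ_b^{⊗q}` on `ℕ^q`. -/
def weightPow (b : ℕ → ℝ) (q : ℕ) : Measure (Fin q → ℕ) :=
  Measure.pi fun _ => weightMeasure b

/-- The product measure `μ_b^{⊗2q}`, on `ℕ^q × ℕ^q`. -/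
def weightPowPair (b : ℕ → ℝ) (q : ℕ) : Measure ((Fin q → ℕ) × (Fin q → ℕ)) :=
  (weightPow b q).prod (weightPow b q)

/-- `K` is a symmetric set of `q`-tuples with pairwise distinct entries. -/
structure IsSymmetricOffDiagonal {q : ℕ} (K : Set (Fin q → ℕ)) : Prop where
  injective : ∀ i ∈ K, Function.Injective i
  symmetric : ∀ i ∈ K, ∀ σ : Equiv.Perm (Fin q), i ∘ σ ∈ K

/-- `K*_j`: the tuples of `K` that have `j` among their entries. -/
def star {q : ℕ} (K : Set (Fin q → ℕ)) (j : ℕ) : Set (Fin q → ℕ) :=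
  {i | i ∈ K ∧ ∃ k, i k = j}

/-- `K^#`: the pairs `(i, j)` of tuples of `K` without common entries, for which there are
`k, l ∈ K` with `{k} ∪ {l} = {i} ∪ {j}` where `k` coincides neither with `i` nor with `j`,
as sets of entries (that is, up to the order of the entries). -/
def sharp {q : ℕ} (K : Set (Fin q → ℕ)) : Set ((Fin q → ℕ) × (Fin q → ℕ)) :=
  {p | p.1 ∈ K ∧ p.2 ∈ K ∧ Disjoint (Set.range p.1) (Set.range p.2) ∧
    ∃ k ∈ K, ∃ l ∈ K, Set.range k ∪ Set.range l = Set.range p.1 ∪ Set.range p.2 ∧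
      Set.range k ≠ Set.range p.1 ∧ Set.range k ≠ Set.range p.2}

variable {Ω : Type*} [MeasurableSpace Ω]

/-- The normalizing factor `(q! μ_b^{⊗q}(K) (E[X₁²])^q)^{-1/2}`. -/
def normFactor (P : Measure Ω) (X : ℕ → Ω → ℝ) (b : ℕ → ℝ) {q : ℕ} (K : Set (Fin q → ℕ)) : ℝ :=
  1 / Real.sqrt (q.factorial * (weightPow b q K).toReal * (∫ ω, X 1 ω ^ 2 ∂P) ^ q)

/-- `S` is the normalized homogeneous sum
`S^{(b)}(K) = (q! μ_b^{⊗q}(K) (E[X₁²])^q)^{-1/2} ∑_{i ∈ K} b_{i_1} ⋯ b_{i_q} X_{i_1} ⋯ X_{i_q}`,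
the (possibly infinite) sum being the limit in `L²(P)` of the finite partial sums, regardless of
the order of summation. For finite `K` this determines `S` as the finite sum almost surely. -/
def IsHomogeneousSum (P : Measure Ω) (X : ℕ → Ω → ℝ) (b : ℕ → ℝ) {q : ℕ}
    (K : Set (Fin q → ℕ)) (S : Ω → ℝ) : Prop :=
  MemLp S 2 P ∧
    Tendsto (fun F : Finset K => eLpNorm
      (fun ω => S ω - normFactor P X b K * ∑ i ∈ F, ∏ k, b (i.1 k) * X (i.1 k) ω) 2 P)
      atTop (𝓝 0)

end CombCLT

end

/-! Standardize the variables and group tuples by their sets of entries. A finite part of the sum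
becomes a homogeneous multilinear polynomial F = ∑_A c_A ∏_{k ∈ A} X_k over q-element sets A, where
c_A is a constant times ∏_{k ∈ A} b_k and ∑ c_A² ≤ 1. Stein's method is applied to F.

Let f solve f'(x) - x f(x) = h(x) - E h(N). For 1-Lipschitz h, both f and f' are bounded and f' is
Lipschitz (`abs_steinSol_le`, `abs_steinDeriv_le`, `abs_steinDeriv_sub_le`). Let D_j be the partial
derivative of F in X_j. Euler's identity ∑_j X_j D_j = qF splits q(E h(F) - E h(N)) into two parts.

(1) The local errors E[D_j² f'(F) - X_j D_j f(F)]. Since F = G + X_j D_j with G and D_j independent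
of X_j, a Taylor expansion around G leaves only O(E|D_j|³) (`stein_local`). Hypercontractivity
(`integral_mpoly_pow_four_le`) bounds E|D_j|³ by √τ times the influence of j, where τ bounds all
influences, and the influences add up to q ∑ c_A².

(2) The fluctuation E|∑_j D_j² - q|, controlled by a variance. Writing X_k² = 1 + (X_k² - 1) on
common indices expands ∑_j D_j² into centered monomials keyed by (A \ B, B \ A, T), and monomials
with different supports are orthogonal. Boundedly many keys share a support, so only pairs (A, B),
(A', B') with equal keys matter. For these A ∪ B' = A' ∪ B and, by the product form of the
coefficients, |c_A c_B c_{A'} c_{B'}| = c_A² c_{B'}² (`tupleCoeff_exchange`). If A and B' are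
disjoint, they form a sharp pair witnessed by A' and B, which yields the K^# term; if they meet, an
influence bound applies (`sum_same_key_le`, `sum_not_disjoint_le`).

Infinite K is reached by truncating to entries below n and letting n tend to infinity in L²
(`normal_approx_limit`). The argument gives the square root of the largest relative star weight;
this weight is at most 1, so the fourth root in the statement is weaker. If the fourth moment is
infinite, the right-hand side is infinite because the bracket is positive. -/

set_option linter.unusedSectionVars false

namespace CombCLT

/-! ### Stein's equation for Lipschitz test functions -/

/-- The standard normal density. -/
noncomputable abbrev stdPDF : ℝ → ℝ := gaussianPDFReal 0 1

lemma stdPDF_eq (x : ℝ) : stdPDF x = (√(2 * Real.pi))⁻¹ * Real.exp (-(1 / 2) * x ^ 2) := by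
  simp only [stdPDF, gaussianPDFReal]
  congr 2
  · simp
  · simp; ring

lemma stdPDF_pos (x : ℝ) : 0 < stdPDF x := gaussianPDFReal_pos 0 1 x one_ne_zero

lemma stdPDF_neg (x : ℝ) : stdPDF (-x) = stdPDF x := by
  simp [stdPDF_eq]

lemma hasDerivAt_stdPDF (x : ℝ) : HasDerivAt stdPDF (-(x * stdPDF x)) x := by
  have h : stdPDF = fun x => (√(2 * Real.pi))⁻¹ * Real.exp (-(1 / 2) * x ^ 2) :=
    funext stdPDF_eq
  rw [h]
  have := (((hasDerivAt_pow 2 x).const_mul (-(1 / 2) : ℝ)).exp).const_mul (√(2 * Real.pi))⁻¹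
  refine this.congr_deriv ?_
  push_cast
  ring

lemma continuous_stdPDF : Continuous stdPDF :=
  continuous_iff_continuousAt.2 fun x => (hasDerivAt_stdPDF x).continuousAt

lemma integrable_stdPDF : Integrable stdPDF := integrable_gaussianPDFReal 0 1

lemma integrable_pow_mul_stdPDF (n : ℕ) : Integrable fun x => x ^ n * stdPDF x := by
  have h := integrable_rpow_mul_exp_neg_mul_sq (b := 1 / 2) (by norm_num) (s := n)
    (by have : (0 : ℝ) ≤ n := n.cast_nonneg
        linarith)
  refine (h.const_mul (√(2 * Real.pi))⁻¹).congr (ae_of_all _ fun x => ?_)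
  simp only [stdPDF_eq, Real.rpow_natCast]
  ring

lemma integrable_id_mul_stdPDF : Integrable fun x => x * stdPDF x := by
  simpa using integrable_pow_mul_stdPDF 1

/-- The upper tail of the standard normal law. -/
noncomputable def stdTail (x : ℝ) : ℝ := ∫ t in Set.Ioi x, stdPDF t

lemma stdTail_nonneg (x : ℝ) : 0 ≤ stdTail x :=
  setIntegral_nonneg measurableSet_Ioi fun t _ => (stdPDF_pos t).le

lemma stdTail_le_one (x : ℝ) : stdTail x ≤ 1 := by
  rw [← integral_gaussianPDFReal_eq_one 0 (one_ne_zero (α := ℝ≥0))]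
  exact setIntegral_le_integral integrable_stdPDF (ae_of_all _ fun t => (stdPDF_pos t).le)

lemma integral_Ioi_id_mul_stdPDF (x : ℝ) : ∫ t in Set.Ioi x, t * stdPDF t = stdPDF x := by
  have hd : ∀ t, HasDerivAt (fun t => - stdPDF t) (t * stdPDF t) t := fun t =>
    (hasDerivAt_stdPDF t).neg.congr_deriv (neg_neg _)
  have h0 := tendsto_zero_of_hasDerivAt_of_integrableOn_Ioi (a := x) (fun t _ => hd t)
    integrable_id_mul_stdPDF.integrableOn integrable_stdPDF.neg.integrableOn
  rw [integral_Ioi_of_hasDerivAt_of_tendsto' (fun t _ => hd t)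
    integrable_id_mul_stdPDF.integrableOn h0]
  ring

lemma integral_Ioi_sq_mul_stdPDF (x : ℝ) :
    ∫ t in Set.Ioi x, t ^ 2 * stdPDF t = x * stdPDF x + stdTail x := by
  have hd : ∀ t, HasDerivAt (fun t => -(t * stdPDF t)) (t ^ 2 * stdPDF t - stdPDF t) t := fun t => by
    refine ((hasDerivAt_id' t).mul (hasDerivAt_stdPDF t)).neg.congr_deriv ?_
    ring
  have hi : Integrable fun t => t ^ 2 * stdPDF t - stdPDF t :=
    (integrable_pow_mul_stdPDF 2).sub integrable_stdPDF
  have h0 := tendsto_zero_of_hasDerivAt_of_integrableOn_Ioi (a := x) (fun t _ => hd t)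
    hi.integrableOn integrable_id_mul_stdPDF.neg.integrableOn
  have h1 := integral_Ioi_of_hasDerivAt_of_tendsto' (a := x) (fun t _ => hd t) hi.integrableOn h0
  rw [integral_sub (integrable_pow_mul_stdPDF 2).integrableOn integrable_stdPDF.integrableOn] at h1
  rw [stdTail]
  linarith

lemma mul_stdTail_le (x : ℝ) : x * stdTail x ≤ stdPDF x := by
  rw [← integral_Ioi_id_mul_stdPDF, stdTail, ← integral_const_mul]
  refine setIntegral_mono_on (integrable_stdPDF.const_mul x).integrableOn
    integrable_id_mul_stdPDF.integrableOn measurableSet_Ioi fun t ht => ?_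
  exact mul_le_mul_of_nonneg_right (le_of_lt ht) (stdPDF_pos t).le

/-- Expand ∫_x^∞ (t - x)² φ(t) dt ≥ 0 using the first and second truncated moments. This lower bound
on the tail makes the Mills defect decay like 1/(1 + x²). -/
lemma mul_stdPDF_le (x : ℝ) : x * stdPDF x ≤ (1 + x ^ 2) * stdTail x := by
  have h : 0 ≤ ∫ t in Set.Ioi x, (t - x) ^ 2 * stdPDF t :=
    setIntegral_nonneg measurableSet_Ioi fun t _ => by have := stdPDF_pos t; positivity
  have e : ∀ t, (t - x) ^ 2 * stdPDF t
      = t ^ 2 * stdPDF t - 2 * x * (t * stdPDF t) + x ^ 2 * stdPDF t := fun t => by ring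
  simp only [e] at h
  have i1 := (integrable_pow_mul_stdPDF 2).integrableOn (s := Set.Ioi x)
  have i2 := (integrable_id_mul_stdPDF.const_mul (2 * x)).integrableOn (s := Set.Ioi x)
  have i3 := (integrable_stdPDF.const_mul (x ^ 2)).integrableOn (s := Set.Ioi x)
  have i12 : IntegrableOn (fun t => t ^ 2 * stdPDF t - 2 * x * (t * stdPDF t)) (Set.Ioi x) :=
    i1.sub i2
  rw [integral_add i12 i3, integral_sub i1 i2, integral_const_mul, integral_const_mul,
    integral_Ioi_sq_mul_stdPDF, integral_Ioi_id_mul_stdPDF, ← stdTail] at h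
  linarith

/-- The Mills ratio defect `1 - x * (1 - Φ(x)) / φ(x)`. -/
noncomputable def millsDefect (x : ℝ) : ℝ := 1 - x * (stdTail x / stdPDF x)

lemma millsDefect_nonneg (x : ℝ) : 0 ≤ millsDefect x := by
  have h := mul_stdTail_le x
  have hp := stdPDF_pos x
  rw [millsDefect, mul_div_assoc', sub_nonneg, div_le_one hp]
  exact h

lemma millsDefect_mul_le (x : ℝ) (hx : 0 ≤ x) : (1 + x ^ 2) * millsDefect x ≤ 1 := by
  have h := mul_stdPDF_le x
  have hp := stdPDF_pos x
  have : x ≤ (1 + x ^ 2) * (stdTail x / stdPDF x) := by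
    rw [mul_div_assoc', le_div_iff₀ hp]; exact h
  rw [millsDefect]
  nlinarith

/-- For x ≥ 1 nonnegativity of the defect gives a ratio of at most 1/x; for x ≤ 1 the tail is at
most 1 and the density at least φ(1). -/
lemma mills_le (x : ℝ) (hx : 0 ≤ x) : stdTail x / stdPDF x ≤ 1 + (stdPDF 1)⁻¹ := by
  have hp := stdPDF_pos x
  have hp1 := inv_pos.2 (stdPDF_pos 1)
  rcases le_total 1 x with h | h
  · have h1 := millsDefect_nonneg x
    rw [millsDefect] at h1
    have : 0 ≤ stdTail x / stdPDF x := div_nonneg (stdTail_nonneg x) hp.le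
    nlinarith
  · have : stdPDF 1 ≤ stdPDF x := by
      simp only [stdPDF_eq]
      gcongr _ * Real.exp ?_
      nlinarith
    calc stdTail x / stdPDF x ≤ 1 / stdPDF 1 := by
          gcongr
          · exact stdPDF_pos 1
          · exact stdTail_le_one x
      _ ≤ 1 + (stdPDF 1)⁻¹ := by rw [one_div]; linarith

/-! ### Lipschitz test functions and the solution of Stein's equation. -/

variable {h : ℝ → ℝ}

lemma abs_sub_le_of_lipschitz (hh : LipschitzWith 1 h) (x y : ℝ) : |h x - h y| ≤ |x - y| := by
  simpa [Real.dist_eq] using hh.dist_le_mul x y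

lemma integrable_lipschitz_of_integrable_id {Ω : Type*} [MeasurableSpace Ω] {P : Measure Ω}
    [IsFiniteMeasure P] {F : Ω → ℝ} (hh : LipschitzWith 1 h) (hF : Integrable F P) :
    Integrable (fun ω => h (F ω)) P := by
  refine ((hF.norm.add (integrable_const |h 0|)).mono'
    (hh.continuous.comp_aestronglyMeasurable hF.aestronglyMeasurable) (ae_of_all _ fun ω => ?_))
  have := abs_sub_le_of_lipschitz hh (F ω) 0
  have h2 : |h (F ω)| ≤ |h (F ω) - h 0| + |h 0| := by simpa using abs_add_le (h (F ω) - h 0) (h 0)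
  simp only [Real.norm_eq_abs, Pi.add_apply]
  simp only [sub_zero] at this
  linarith

lemma integrable_id_stdGaussian : Integrable (fun x : ℝ => x) (gaussianReal 0 1) :=
  (memLp_id_gaussianReal (μ := 0) (v := 1) 1).integrable (by simp)

lemma integral_stdGaussian (g : ℝ → ℝ) :
    ∫ x, g x ∂gaussianReal 0 1 = ∫ x, g x * stdPDF x := by
  rw [integral_gaussianReal_eq_integral_smul one_ne_zero]
  simp [mul_comm]

lemma integral_sq_stdGaussian : ∫ x, x ^ 2 ∂gaussianReal 0 1 = 1 := by
  have h := variance_id_gaussianReal (μ := 0) (v := 1)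
  rw [variance_eq_sub (memLp_id_gaussianReal 2)] at h
  simpa using h

lemma integral_abs_stdGaussian_le : ∫ x, |x| ∂gaussianReal 0 1 ≤ 1 := by
  have hi : Integrable (fun x : ℝ => x ^ 2) (gaussianReal 0 1) :=
    (memLp_id_gaussianReal (μ := 0) (v := 1) 2).integrable_sq
  calc ∫ x, |x| ∂gaussianReal 0 1 ≤ ∫ x, (1 / 2 + 1 / 2 * x ^ 2) ∂gaussianReal 0 1 := by
        refine integral_mono integrable_id_stdGaussian.abs
          ((integrable_const _).add (hi.const_mul _)) fun x => ?_
        have := sq_nonneg (|x| - 1)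
        have h2 := sq_abs x
        simp only
        nlinarith
    _ = 1 := by
        rw [integral_add (integrable_const _) (hi.const_mul _), integral_const_mul,
          integral_sq_stdGaussian]
        norm_num

lemma abs_sub_integral_stdGaussian_le (hh : LipschitzWith 1 h) (x : ℝ) :
    |h x - ∫ y, h y ∂gaussianReal 0 1| ≤ |x| + 1 := by
  have hi := integrable_lipschitz_of_integrable_id hh integrable_id_stdGaussian
  have e : h x - ∫ y, h y ∂gaussianReal 0 1 = ∫ y, (h x - h y) ∂gaussianReal 0 1 := by
    rw [integral_sub (integrable_const _) hi]; simp
  rw [e]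
  calc |∫ y, (h x - h y) ∂gaussianReal 0 1| ≤ ∫ y, |h x - h y| ∂gaussianReal 0 1 :=
        abs_integral_le_integral_abs
    _ ≤ ∫ y, (|x| + |y|) ∂gaussianReal 0 1 := by
        refine integral_mono ((integrable_const _).sub hi).abs
          ((integrable_const _).add integrable_id_stdGaussian.abs) fun y => ?_
        exact (abs_sub_le_of_lipschitz hh x y).trans (abs_sub x y)
    _ ≤ |x| + 1 := by
        rw [integral_add (integrable_const _) integrable_id_stdGaussian.abs]
        have := integral_abs_stdGaussian_le
        simpa using this

/-- The test function centered under the standard normal law, times the normal density. -/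
noncomputable def steinIntegrand (h : ℝ → ℝ) (t : ℝ) : ℝ :=
  (h t - ∫ y, h y ∂gaussianReal 0 1) * stdPDF t

/-- The solution of Stein's equation `f' x - x f x = h x - 𝔼 h(N)`. -/
noncomputable def steinSol (h : ℝ → ℝ) (x : ℝ) : ℝ :=
  -((∫ t in Set.Ioi x, steinIntegrand h t) / stdPDF x)

/-- The derivative of the solution of Stein's equation. -/
noncomputable def steinDeriv (h : ℝ → ℝ) (x : ℝ) : ℝ :=
  x * steinSol h x + (h x - ∫ y, h y ∂gaussianReal 0 1)

lemma continuous_steinIntegrand (hh : LipschitzWith 1 h) : Continuous (steinIntegrand h) :=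
  (hh.continuous.sub continuous_const).mul continuous_stdPDF

lemma abs_steinIntegrand_le (hh : LipschitzWith 1 h) (t : ℝ) :
    |steinIntegrand h t| ≤ (|t| + 1) * stdPDF t := by
  rw [steinIntegrand, abs_mul, abs_of_pos (stdPDF_pos t)]
  exact mul_le_mul_of_nonneg_right (abs_sub_integral_stdGaussian_le hh t) (stdPDF_pos t).le

lemma integrable_steinIntegrand (hh : LipschitzWith 1 h) : Integrable (steinIntegrand h) := by
  have : Integrable fun t => |t * stdPDF t| + stdPDF t :=
    integrable_id_mul_stdPDF.abs.add integrable_stdPDF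
  refine this.mono' (continuous_steinIntegrand hh).aestronglyMeasurable (ae_of_all _ fun t => ?_)
  rw [Real.norm_eq_abs, abs_mul, abs_of_pos (stdPDF_pos t)]
  linarith [abs_steinIntegrand_le hh t]

lemma integral_steinIntegrand (hh : LipschitzWith 1 h) : ∫ t, steinIntegrand h t = 0 := by
  have hi := integrable_lipschitz_of_integrable_id hh integrable_id_stdGaussian
  have := integral_stdGaussian (fun t => h t - ∫ y, h y ∂gaussianReal 0 1)
  rw [integral_sub hi (integrable_const _)] at this
  simp only [steinIntegrand]
  rw [← this]; simp

lemma hasDerivAt_steinSol (hh : LipschitzWith 1 h) (x : ℝ) :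
    HasDerivAt (steinSol h) (steinDeriv h x) x := by
  have hc := continuous_steinIntegrand hh
  have hi := integrable_steinIntegrand hh
  -- The variable endpoint is moved to a finite interval integral so that the fundamental theorem of
  -- calculus applies.
  have e : (fun x => ∫ t in Set.Ioi x, steinIntegrand h t)
      = fun x => (∫ t in Set.Ioi 0, steinIntegrand h t) - ∫ t in (0 : ℝ)..x, steinIntegrand h t := by
    funext x
    rw [← intervalIntegral.integral_Ioi_sub_Ioi' hi.integrableOn hi.integrableOn]
    ring
  have hd : HasDerivAt (fun x => ∫ t in Set.Ioi x, steinIntegrand h t) (-steinIntegrand h x) x := by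
    rw [e]
    exact (intervalIntegral.integral_hasDerivAt_right (hc.intervalIntegrable _ _)
      (hc.stronglyMeasurableAtFilter _ _) hc.continuousAt).const_sub _
  refine (hd.div (hasDerivAt_stdPDF x) (stdPDF_pos x).ne').neg.congr_deriv ?_
  have hp := (stdPDF_pos x).ne'
  rw [steinDeriv, steinSol, steinIntegrand]
  field_simp
  ring

lemma abs_steinSol_le_of_nonneg (hh : LipschitzWith 1 h) {x : ℝ} (hx : 0 ≤ x) :
    |steinSol h x| ≤ 2 + (stdPDF 1)⁻¹ := by
  have hp := stdPDF_pos x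
  have : |∫ t in Set.Ioi x, steinIntegrand h t| ≤ stdPDF x + stdTail x := by
    calc |∫ t in Set.Ioi x, steinIntegrand h t| ≤ ∫ t in Set.Ioi x, |steinIntegrand h t| :=
          abs_integral_le_integral_abs
      _ ≤ ∫ t in Set.Ioi x, (t * stdPDF t + stdPDF t) := by
          refine setIntegral_mono_on (integrable_steinIntegrand hh).abs.integrableOn
            (integrable_id_mul_stdPDF.add integrable_stdPDF).integrableOn measurableSet_Ioi
            fun t ht => ?_
          have := abs_steinIntegrand_le hh t
          rw [abs_of_pos (lt_of_le_of_lt hx ht)] at this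
          linarith
      _ = stdPDF x + stdTail x := by
          rw [integral_add integrable_id_mul_stdPDF.integrableOn integrable_stdPDF.integrableOn,
            integral_Ioi_id_mul_stdPDF, stdTail]
  rw [steinSol, abs_neg, abs_div, abs_of_pos hp]
  calc _ ≤ (stdPDF x + stdTail x) / stdPDF x := by gcongr
    _ = 1 + stdTail x / stdPDF x := by rw [add_div, div_self hp.ne']
    _ ≤ _ := by linarith [mills_le x hx]

/-- Replacing h(t) - m by (h(t) - h(x)) + (h(x) - m) in the integral exhibits f'(x) as a combination
in which both terms carry the Mills defect, with coefficients at most x and x + 1. The decay of the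
defect absorbs one factor 1 + x more than boundedness of f' needs; this extra factor is what later
makes f' Lipschitz. -/
lemma abs_steinDeriv_le_of_nonneg (hh : LipschitzWith 1 h) {x : ℝ} (hx : 0 ≤ x) :
    (1 + x) * |steinDeriv h x| ≤ 6 := by
  set m := ∫ y, h y ∂gaussianReal 0 1 with hm
  have hp := stdPDF_pos x
  set I := ∫ t in Set.Ioi x, (h t - h x) * stdPDF t with hI
  have i1 : Integrable fun t => (h t - h x) * stdPDF t := by
    have : (fun t => (h t - h x) * stdPDF t)
        = fun t => steinIntegrand h t + (m - h x) * stdPDF t := by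
      funext t; rw [steinIntegrand]; ring
    rw [this]
    exact (integrable_steinIntegrand hh).add (integrable_stdPDF.const_mul _)
  have hIb : |I| ≤ stdPDF x - x * stdTail x := by
    calc |I| ≤ ∫ t in Set.Ioi x, |(h t - h x) * stdPDF t| := abs_integral_le_integral_abs
      _ ≤ ∫ t in Set.Ioi x, (t * stdPDF t - x * stdPDF t) := by
          refine setIntegral_mono_on i1.abs.integrableOn
            (integrable_id_mul_stdPDF.sub (integrable_stdPDF.const_mul x)).integrableOn
            measurableSet_Ioi fun t ht => ?_
          have h1 := abs_sub_le_of_lipschitz hh t x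
          rw [abs_of_pos (sub_pos.2 (Set.mem_Ioi.1 ht))] at h1
          rw [abs_mul, abs_of_pos (stdPDF_pos t), ← sub_mul]
          exact mul_le_mul_of_nonneg_right h1 (stdPDF_pos t).le
      _ = _ := by
          rw [integral_sub integrable_id_mul_stdPDF.integrableOn
            (integrable_stdPDF.const_mul x).integrableOn, integral_Ioi_id_mul_stdPDF,
            integral_const_mul, stdTail]
  -- The part of the integrand constant in t yields the tail, which cancels against the term h(x) -
  -- m of `steinDeriv` up to the Mills defect.
  have hs : ∫ t in Set.Ioi x, steinIntegrand h t = I + (h x - m) * stdTail x := by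
    rw [stdTail, ← integral_const_mul, hI, ← integral_add i1.integrableOn
      (integrable_stdPDF.const_mul _).integrableOn]
    congr 1; funext t; rw [steinIntegrand]; ring
  have hd : steinDeriv h x = -(x * (I / stdPDF x)) + (h x - m) * millsDefect x := by
    rw [steinDeriv, steinSol, hs, millsDefect, ← hm]
    field_simp
    ring
  have hR : |I / stdPDF x| ≤ millsDefect x := by
    rw [abs_div, abs_of_pos hp, div_le_iff₀ hp, millsDefect]
    calc _ ≤ _ := hIb
      _ = _ := by field_simp
  have hm1 := abs_sub_integral_stdGaussian_le hh x
  rw [← hm, abs_of_nonneg hx] at hm1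
  have h0 := millsDefect_nonneg x
  have h1 := millsDefect_mul_le x hx
  have hb : |steinDeriv h x| ≤ x * millsDefect x + (x + 1) * millsDefect x := by
    rw [hd]
    refine (abs_add_le _ _).trans (add_le_add ?_ ?_)
    · rw [abs_neg, abs_mul, abs_of_nonneg hx]
      exact mul_le_mul_of_nonneg_left hR hx
    · rw [abs_mul, abs_of_nonneg h0]
      exact mul_le_mul_of_nonneg_right hm1 h0
  calc (1 + x) * |steinDeriv h x|
      ≤ (1 + x) * (x * millsDefect x + (x + 1) * millsDefect x) := by gcongr
    _ = ((1 + x) * (2 * x + 1)) * millsDefect x := by ring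
    _ ≤ (6 * (1 + x ^ 2)) * millsDefect x := by
        refine mul_le_mul_of_nonneg_right ?_ h0
        nlinarith [sq_nonneg (x - 1)]
    _ ≤ 6 := by linarith

/-! ### Reflection x ↦ -x, carrying the bounds over to negative arguments. -/

lemma lipschitz_comp_neg (hh : LipschitzWith 1 h) : LipschitzWith 1 fun x => h (-x) := by
  refine LipschitzWith.of_dist_le_mul fun x y => ?_
  have := hh.dist_le_mul (-x) (-y)
  rwa [dist_neg_neg] at this

lemma integral_comp_neg_stdGaussian (h : ℝ → ℝ) :
    ∫ y, h (-y) ∂gaussianReal 0 1 = ∫ y, h y ∂gaussianReal 0 1 := by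
  rw [integral_stdGaussian, integral_stdGaussian, ← integral_neg_eq_self]
  simp [stdPDF_neg]

/-- The centered integrand has total integral 0, so its integral over the left half-line is minus
the one over the right half-line. -/
lemma steinSol_comp_neg (hh : LipschitzWith 1 h) (x : ℝ) :
    steinSol (fun x => h (-x)) (-x) = -steinSol h x := by
  have e : ∀ t, steinIntegrand (fun x => h (-x)) t = steinIntegrand h (-t) := fun t => by
    simp only [steinIntegrand, integral_comp_neg_stdGaussian, stdPDF_neg]
  have hi := integrable_steinIntegrand hh
  have h0 := integral_steinIntegrand hh
  rw [← intervalIntegral.integral_Iic_add_Ioi (b := x) hi.integrableOn hi.integrableOn] at h0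
  simp only [steinSol, e, stdPDF_neg]
  rw [integral_comp_neg_Ioi, neg_neg, eq_neg_of_add_eq_zero_left h0, neg_div]

lemma steinDeriv_comp_neg (hh : LipschitzWith 1 h) (x : ℝ) :
    steinDeriv (fun x => h (-x)) (-x) = steinDeriv h x := by
  simp only [steinDeriv, steinSol_comp_neg hh, integral_comp_neg_stdGaussian]
  ring_nf

/-- A bound for the solution of Stein's equation. -/
noncomputable def steinConst : ℝ := 2 + (stdPDF 1)⁻¹

lemma steinConst_nonneg : 0 ≤ steinConst := by
  have := inv_pos.2 (stdPDF_pos 1)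
  rw [steinConst]; linarith

lemma abs_steinSol_le (hh : LipschitzWith 1 h) (x : ℝ) : |steinSol h x| ≤ steinConst := by
  rcases le_total 0 x with hx | hx
  · exact abs_steinSol_le_of_nonneg hh hx
  · have := abs_steinSol_le_of_nonneg (lipschitz_comp_neg hh) (neg_nonneg.2 hx)
    rwa [steinSol_comp_neg hh, abs_neg] at this

lemma one_add_abs_mul_abs_steinDeriv_le (hh : LipschitzWith 1 h) (x : ℝ) :
    (1 + |x|) * |steinDeriv h x| ≤ 6 := by
  rcases le_total 0 x with hx | hx
  · rw [abs_of_nonneg hx]; exact abs_steinDeriv_le_of_nonneg hh hx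
  · have := abs_steinDeriv_le_of_nonneg (lipschitz_comp_neg hh) (neg_nonneg.2 hx)
    rwa [steinDeriv_comp_neg hh, ← abs_of_nonpos hx] at this

lemma abs_steinDeriv_le (hh : LipschitzWith 1 h) (x : ℝ) : |steinDeriv h x| ≤ 6 := by
  have := one_add_abs_mul_abs_steinDeriv_le hh x
  nlinarith [abs_nonneg x, abs_nonneg (steinDeriv h x)]

/-- A Lipschitz constant for the derivative of the solution of Stein's equation. -/
noncomputable def steinLip : ℝ := steinConst + 7

lemma steinLip_nonneg : 0 ≤ steinLip := by
  have := steinConst_nonneg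
  rw [steinLip]; linarith

/-- Here h need not be differentiable, so f'' is avoided: f'(x) = x f(x) + h(x) - m, where x f(x)
has derivative f + x f', bounded by `steinConst` + 6, and h contributes 1 more to the Lipschitz
constant. -/
lemma abs_steinDeriv_sub_le (hh : LipschitzWith 1 h) (x y : ℝ) :
    |steinDeriv h x - steinDeriv h y| ≤ steinLip * |x - y| := by
  have hd : ∀ t, HasDerivAt (fun t => t * steinSol h t) (steinSol h t + t * steinDeriv h t) t :=
    fun t => ((hasDerivAt_id' t).mul (hasDerivAt_steinSol hh t)).congr_deriv (by ring)
  have hb : ∀ t, ‖steinSol h t + t * steinDeriv h t‖ ≤ steinConst + 6 := fun t => by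
    refine (norm_add_le _ _).trans (add_le_add (abs_steinSol_le hh t) ?_)
    rw [Real.norm_eq_abs, abs_mul]
    have := one_add_abs_mul_abs_steinDeriv_le hh t
    nlinarith [abs_nonneg (steinDeriv h t)]
  have := Convex.norm_image_sub_le_of_norm_hasDerivWithin_le (s := Set.univ)
    (fun t _ => (hd t).hasDerivWithinAt) (fun t _ => hb t) convex_univ (Set.mem_univ y)
    (Set.mem_univ x)
  simp only [Real.norm_eq_abs] at this
  have h2 := abs_sub_le_of_lipschitz hh x y
  have e : steinDeriv h x - steinDeriv h y
      = (x * steinSol h x - y * steinSol h y) + (h x - h y) := by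
    rw [steinDeriv, steinDeriv]; ring
  rw [e]
  refine (abs_add_le _ _).trans ?_
  rw [steinLip]
  linarith

end CombCLT

namespace CombCLT

variable {Ω : Type*} [MeasurableSpace Ω]

/-! ### Multilinear polynomials in independent standardized variables -/

/-- A sequence of measurable independent random variables. -/
structure IsIndepSeq (P : Measure Ω) (X : ℕ → Ω → ℝ) : Prop where
  meas : ∀ k, Measurable (X k)
  indep : iIndepFun X P

/-- Independent random variables with mean `0`, variance `1` and fourth moments at most `M`. -/
structure IsStdIndep (P : Measure Ω) (X : ℕ → Ω → ℝ) (M : ℝ) : Prop extends IsIndepSeq P X where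
  int4 : ∀ k, Integrable (fun ω => X k ω ^ 4) P
  mean : ∀ k, ∫ ω, X k ω ∂P = 0
  var : ∀ k, ∫ ω, X k ω ^ 2 ∂P = 1
  fourth : ∀ k, ∫ ω, X k ω ^ 4 ∂P ≤ M

/-- The σ-algebra generated by all variables but the `k`-th. -/
abbrev sigmaExcept (X : ℕ → Ω → ℝ) (k : ℕ) : MeasurableSpace Ω :=
  ⨆ i ∈ ({k}ᶜ : Set ℕ), MeasurableSpace.comap (X i) inferInstance

lemma measurable_sigmaExcept (X : ℕ → Ω → ℝ) {i k : ℕ} (h : i ≠ k) :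
    Measurable[sigmaExcept X k] (X i) := by
  refine measurable_iff_comap_le.2 ?_
  exact le_iSup₂_of_le (f := fun i (_ : i ∈ ({k}ᶜ : Set ℕ)) =>
    MeasurableSpace.comap (X i) inferInstance) i h le_rfl

/-- The multilinear polynomial `∑_{A ⊆ U} c_A ∏_{k ∈ A} X_k`. -/
noncomputable def mpoly (X : ℕ → Ω → ℝ) (U : Finset ℕ) (c : Finset ℕ → ℝ) (ω : Ω) : ℝ :=
  ∑ A ∈ U.powerset, c A * ∏ k ∈ A, X k ω

lemma mpoly_insert (X : ℕ → Ω → ℝ) {U : Finset ℕ} {j : ℕ} (hj : j ∉ U) (c : Finset ℕ → ℝ) (ω : Ω) :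
    mpoly X (insert j U) c ω
      = mpoly X U c ω + X j ω * mpoly X U (fun A => c (insert j A)) ω := by
  rw [mpoly, Finset.sum_powerset_insert hj, mpoly, mpoly, Finset.mul_sum]
  congr 1
  refine Finset.sum_congr rfl fun A hA => ?_
  rw [Finset.prod_insert fun h => hj (Finset.mem_powerset.1 hA h)]
  ring

lemma measurable_mpoly_sigmaExcept (X : ℕ → Ω → ℝ) {U : Finset ℕ} {k : ℕ} (hk : k ∉ U)
    (c : Finset ℕ → ℝ) : Measurable[sigmaExcept X k] (mpoly X U c) := by
  unfold mpoly
  refine Finset.measurable_fun_sum _ fun A hA => ?_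
  refine Measurable.mul (@measurable_const _ _ _ (sigmaExcept X k) _) ?_
  refine Finset.measurable_fun_prod _ fun i hi => measurable_sigmaExcept X ?_
  rintro rfl
  exact hk (Finset.mem_powerset.1 hA hi)

lemma integrable_of_abs_le {P : Measure Ω} {f g : Ω → ℝ} (hg : Integrable g P) (hf : Measurable f)
    (h : ∀ ω, |f ω| ≤ g ω) : Integrable f P :=
  hg.mono' hf.aestronglyMeasurable (ae_of_all _ h)

lemma abs_pow_le_one_add_pow_four (x : ℝ) {n : ℕ} (hn : n ≤ 4) : |x ^ n| ≤ 1 + x ^ 4 := by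
  have h4 : x ^ 4 = |x| ^ 4 := (Even.pow_abs (by decide) x).symm
  rw [abs_pow, h4]
  rcases le_total |x| 1 with h | h
  · have := pow_le_one₀ (n := n) (abs_nonneg x) h
    have : 0 ≤ |x| ^ 4 := by positivity
    linarith
  · have := pow_le_pow_right₀ h hn
    linarith

lemma integrable_pow_of_pow_four {P : Measure Ω} [IsFiniteMeasure P] {f : Ω → ℝ} (hf : Measurable f)
    (h : Integrable (fun ω => f ω ^ 4) P) {n : ℕ} (hn : n ≤ 4) : Integrable (fun ω => f ω ^ n) P :=
  integrable_of_abs_le ((integrable_const 1).add h) (hf.pow_const n)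
    fun ω => abs_pow_le_one_add_pow_four (f ω) hn

lemma abs_mul_pow_le_pow_four (x y : ℝ) {m n : ℕ} (h : m + n ≤ 4) :
    |x ^ m * y ^ n| ≤ 1 + x ^ 4 + y ^ 4 := by
  have h4 : ∀ z : ℝ, z ^ 4 = |z| ^ 4 := fun z => (Even.pow_abs (by decide) z).symm
  rw [abs_mul, abs_pow, abs_pow, h4 x, h4 y]
  have hb : ∀ z : ℝ, |z| ≤ max |x| |y| → ∀ k : ℕ, |z| ^ k ≤ (max |x| |y|) ^ k :=
    fun z hz k => pow_le_pow_left₀ (abs_nonneg z) hz k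
  calc |x| ^ m * |y| ^ n ≤ (max |x| |y|) ^ m * (max |x| |y|) ^ n :=
        mul_le_mul (hb x (le_max_left _ _) m) (hb y (le_max_right _ _) n) (by positivity)
          (by positivity)
    _ = |(max |x| |y|) ^ (m + n)| := by
        have h0 : 0 ≤ max |x| |y| := (abs_nonneg x).trans (le_max_left _ _)
        rw [← pow_add, abs_of_nonneg (pow_nonneg h0 _)]
    _ ≤ 1 + (max |x| |y|) ^ 4 := abs_pow_le_one_add_pow_four _ h
    _ ≤ 1 + |x| ^ 4 + |y| ^ 4 := by
        rcases max_choice |x| |y| with e | e <;> rw [e]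
        · have : 0 ≤ |y| ^ 4 := by positivity
          linarith
        · have : 0 ≤ |x| ^ 4 := by positivity
          linarith

lemma integrable_pow_mul_pow {P : Measure Ω} [IsFiniteMeasure P] {f g : Ω → ℝ} (hf : Measurable f)
    (hg : Measurable g) (hf4 : Integrable (fun ω => f ω ^ 4) P)
    (hg4 : Integrable (fun ω => g ω ^ 4) P) {m n : ℕ} (h : m + n ≤ 4) :
    Integrable (fun ω => f ω ^ m * g ω ^ n) P :=
  integrable_of_abs_le (((integrable_const 1).add hf4).add hg4) ((hf.pow_const m).mul (hg.pow_const n))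
    fun ω => abs_mul_pow_le_pow_four (f ω) (g ω) h

/-- The Cauchy–Schwarz inequality for integrals of real functions. -/
lemma sq_integral_mul_le {P : Measure Ω} {f g : Ω → ℝ} (hf : Integrable (fun ω => f ω ^ 2) P)
    (hg : Integrable (fun ω => g ω ^ 2) P) (hfg : Integrable (fun ω => f ω * g ω) P) :
    (∫ ω, f ω * g ω ∂P) ^ 2 ≤ (∫ ω, f ω ^ 2 ∂P) * ∫ ω, g ω ^ 2 ∂P := by
  -- This quadratic in t is the integral of (t f + g)², so its discriminant is nonpositive.
  have key : ∀ t : ℝ, 0 ≤ (∫ ω, f ω ^ 2 ∂P) * (t * t) + (2 * ∫ ω, f ω * g ω ∂P) * t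
      + ∫ ω, g ω ^ 2 ∂P := fun t => by
    have h : 0 ≤ ∫ ω, (t * f ω + g ω) ^ 2 ∂P := integral_nonneg fun ω => sq_nonneg _
    have e : ∀ ω, (t * f ω + g ω) ^ 2 = t ^ 2 * f ω ^ 2 + 2 * t * (f ω * g ω) + g ω ^ 2 :=
      fun ω => by ring
    have i1 : Integrable (fun ω => t ^ 2 * f ω ^ 2 + 2 * t * (f ω * g ω)) P :=
      (hf.const_mul _).add (hfg.const_mul _)
    simp only [e] at h
    rw [integral_add i1 hg, integral_add (hf.const_mul _) (hfg.const_mul _), integral_const_mul,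
      integral_const_mul] at h
    linarith
  have := discrim_le_zero key
  rw [discrim] at this
  nlinarith

/-! ### Independence of one variable from functions of the others. -/

namespace IsIndepSeq

variable {P : Measure Ω} [IsProbabilityMeasure P] {X : ℕ → Ω → ℝ}

lemma sigmaExcept_le (hX : IsIndepSeq P X) (k : ℕ) :
    sigmaExcept X k ≤ (inferInstance : MeasurableSpace Ω) :=
  iSup₂_le fun i _ => (hX.meas i).comap_le

lemma indep_sigmaExcept (hX : IsIndepSeq P X) (k : ℕ) :
    Indep (MeasurableSpace.comap (X k) inferInstance) (sigmaExcept X k) P := by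
  have h := indep_iSup_of_disjoint (fun i => (hX.meas i).comap_le)
    ((iIndepFun_iff_iIndep _ _ _).1 hX.indep) (S := {k}) (T := {k}ᶜ) disjoint_compl_right
  simpa [sigmaExcept] using h

lemma indepFun (hX : IsIndepSeq P X) {k : ℕ} {G : Ω → ℝ}
    (hG : Measurable[sigmaExcept X k] G) {g : ℝ → ℝ} (hg : Measurable g) :
    IndepFun (fun ω => g (X k ω)) G P := by
  have h1 : IndepFun (X k) G P := by
    rw [IndepFun_iff_Indep]
    exact indep_of_indep_of_le_right (hX.indep_sigmaExcept k) (measurable_iff_comap_le.1 hG)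
  exact h1.comp hg measurable_id

lemma integrable_mul (hX : IsIndepSeq P X) {k : ℕ} {G : Ω → ℝ}
    (hG : Measurable[sigmaExcept X k] G) {g : ℝ → ℝ} (hg : Measurable g)
    (hi : Integrable (fun ω => g (X k ω)) P) (hGi : Integrable G P) :
    Integrable (fun ω => g (X k ω) * G ω) P :=
  (hX.indepFun hG hg).integrable_mul hi hGi

lemma integral_mul (hX : IsIndepSeq P X) {k : ℕ} {G : Ω → ℝ}
    (hG : Measurable[sigmaExcept X k] G) {g : ℝ → ℝ} (hg : Measurable g) :
    ∫ ω, g (X k ω) * G ω ∂P = (∫ ω, g (X k ω) ∂P) * ∫ ω, G ω ∂P :=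
  (hX.indepFun hG hg).integral_fun_mul_eq_mul_integral
    (hg.comp (hX.meas k)).aestronglyMeasurable
    (hG.mono (hX.sigmaExcept_le k) le_rfl).aestronglyMeasurable

lemma integrable_prod_comp (hX : IsIndepSeq P X) (U : Finset ℕ) {g : ℕ → ℝ → ℝ}
    (hg : ∀ k, Measurable (g k)) (hi : ∀ k, Integrable (fun ω => g k (X k ω)) P) :
    Integrable (fun ω => ∏ k ∈ U, g k (X k ω)) P ∧
      ∫ ω, ∏ k ∈ U, g k (X k ω) ∂P = ∏ k ∈ U, ∫ ω, g k (X k ω) ∂P := by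
  induction U using Finset.induction_on with
  | empty => simp
  | insert j U hj ih =>
    have hs : Measurable[sigmaExcept X j] fun ω => ∏ k ∈ U, g k (X k ω) :=
      Finset.measurable_fun_prod _ fun k hk =>
        (hg k).comp (measurable_sigmaExcept X fun h => hj (h ▸ hk))
    simp only [Finset.prod_insert hj]
    exact ⟨hX.integrable_mul hs (hg j) (hi j) ih.1,
      (hX.integral_mul hs (hg j)).trans (by rw [ih.2])⟩

end IsIndepSeq

/-! ### Second and fourth moments of multilinear polynomials. -/

namespace IsStdIndep

variable {P : Measure Ω} [IsProbabilityMeasure P] {X : ℕ → Ω → ℝ} {M : ℝ}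

lemma integrable_pow (hX : IsStdIndep P X M) (k : ℕ) {n : ℕ} (hn : n ≤ 4) :
    Integrable (fun ω => X k ω ^ n) P :=
  integrable_pow_of_pow_four (hX.meas k) (hX.int4 k) hn

/-- From E(X² - 1)² = E X⁴ - 1 ≥ 0. -/
lemma one_le (hX : IsStdIndep P X M) : 1 ≤ M := by
  have h : 0 ≤ ∫ ω, (X 0 ω ^ 2 - 1) ^ 2 ∂P := integral_nonneg fun ω => sq_nonneg _
  have e : ∀ ω, (X 0 ω ^ 2 - 1) ^ 2 = X 0 ω ^ 4 - 2 * X 0 ω ^ 2 + 1 := fun ω => by ring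
  have i1 : Integrable (fun ω => X 0 ω ^ 4 - 2 * X 0 ω ^ 2) P :=
    (hX.int4 0).sub ((hX.integrable_pow 0 (by norm_num)).const_mul 2)
  simp only [e] at h
  rw [integral_add i1 (integrable_const _), integral_sub (hX.int4 0)
    ((hX.integrable_pow 0 (by norm_num)).const_mul 2), integral_const_mul, hX.var] at h
  simp at h
  linarith [hX.fourth 0]

lemma measurable_mpoly (hX : IsStdIndep P X M) (U : Finset ℕ) (c : Finset ℕ → ℝ) :
    Measurable (mpoly X U c) := by
  unfold mpoly
  exact Finset.measurable_fun_sum _ fun A _ => measurable_const.mul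
    (Finset.measurable_fun_prod _ fun i _ => hX.meas i)

lemma integrable_mpoly_pow_four (hX : IsStdIndep P X M) (U : Finset ℕ) (c : Finset ℕ → ℝ) :
    Integrable (fun ω => mpoly X U c ω ^ 4) P := by
  induction U using Finset.induction_on generalizing c with
  | empty => simp [mpoly]
  | insert j U hj ih =>
    have h2 : Integrable (fun ω => X j ω ^ 4 * mpoly X U (fun A => c (insert j A)) ω ^ 4) P :=
      hX.integrable_mul (g := fun x => x ^ 4) ((measurable_mpoly_sigmaExcept X hj _).pow_const 4)
        (measurable_id.pow_const 4) (hX.int4 j) (ih _)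
    refine integrable_of_abs_le (((ih c).const_mul 8).add (h2.const_mul 8))
      ((hX.measurable_mpoly _ _).pow_const 4) fun ω => ?_
    rw [mpoly_insert X hj]
    simp only [Pi.add_apply]
    set a := mpoly X U c ω
    set b := mpoly X U (fun A => c (insert j A)) ω
    rw [abs_of_nonneg (by positivity), ← mul_pow]
    nlinarith [sq_nonneg (a - X j ω * b), sq_nonneg (a + X j ω * b),
      sq_nonneg (a ^ 2 - (X j ω * b) ^ 2), sq_nonneg ((a - X j ω * b) ^ 2)]

lemma integrable_mpoly_pow (hX : IsStdIndep P X M) (U : Finset ℕ) (c : Finset ℕ → ℝ) {n : ℕ}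
    (hn : n ≤ 4) : Integrable (fun ω => mpoly X U c ω ^ n) P :=
  integrable_pow_of_pow_four (hX.measurable_mpoly U c) (hX.integrable_mpoly_pow_four U c) hn

lemma integrable_mpoly (hX : IsStdIndep P X M) (U : Finset ℕ) (c : Finset ℕ → ℝ) :
    Integrable (mpoly X U c) P := by
  simpa using hX.integrable_mpoly_pow U c (n := 1) (by norm_num)

/-- The square-free monomials are orthonormal. By induction on the variables: in (G + X_j H)² the
cross term has mean 0 and X_j² has mean 1, independently of G and H. -/
lemma integral_mpoly_sq (hX : IsStdIndep P X M) (U : Finset ℕ) (c : Finset ℕ → ℝ) :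
    ∫ ω, mpoly X U c ω ^ 2 ∂P = ∑ A ∈ U.powerset, c A ^ 2 := by
  induction U using Finset.induction_on generalizing c with
  | empty => simp [mpoly]
  | insert j U hj ih =>
    set G := mpoly X U c
    set H := mpoly X U (fun A => c (insert j A))
    have mG := hX.measurable_mpoly U c
    have mH := hX.measurable_mpoly U (fun A => c (insert j A))
    have sG := measurable_mpoly_sigmaExcept X hj c
    have sH := measurable_mpoly_sigmaExcept X hj (fun A => c (insert j A))
    have iG := hX.integrable_mpoly_pow_four U c
    have iH := hX.integrable_mpoly_pow_four U (fun A => c (insert j A))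
    have iGH : Integrable (fun ω => G ω * H ω) P := by
      simpa using integrable_pow_mul_pow mG mH iG iH (m := 1) (n := 1) (by norm_num)
    have iX : Integrable (X j) P := by simpa using hX.integrable_pow j (n := 1) (by norm_num)
    have i1 : Integrable (fun ω => X j ω * (G ω * H ω)) P :=
      hX.integrable_mul (g := id) (sG.mul sH) measurable_id iX iGH
    have i2 : Integrable (fun ω => X j ω ^ 2 * H ω ^ 2) P :=
      hX.integrable_mul (g := fun x => x ^ 2) (sH.pow_const 2) (measurable_id.pow_const 2)
        (hX.integrable_pow j (by norm_num)) (hX.integrable_mpoly_pow _ _ (by norm_num))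
    have e1 : ∫ ω, X j ω * (G ω * H ω) ∂P = 0 := by
      have := hX.integral_mul (g := id) (sG.mul sH) measurable_id
      simpa [hX.mean] using this
    have e2 : ∫ ω, X j ω ^ 2 * H ω ^ 2 ∂P = ∫ ω, H ω ^ 2 ∂P := by
      have := hX.integral_mul (g := fun x => x ^ 2) (sH.pow_const 2) (measurable_id.pow_const 2)
      rw [this, hX.var, one_mul]
    have e : ∀ ω, mpoly X (insert j U) c ω ^ 2
        = G ω ^ 2 + 2 * (X j ω * (G ω * H ω)) + X j ω ^ 2 * H ω ^ 2 := fun ω => by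
      rw [mpoly_insert X hj]; ring
    have i3 : Integrable (fun ω => G ω ^ 2) P := hX.integrable_mpoly_pow _ _ (by norm_num)
    have i4 : Integrable (fun ω => G ω ^ 2 + 2 * (X j ω * (G ω * H ω))) P :=
      i3.add (i1.const_mul 2)
    simp only [e]
    rw [integral_add i4 i2, integral_add i3 (i1.const_mul 2), integral_const_mul, e1, e2, ih, ih,
      Finset.sum_powerset_insert hj]
    ring

/-- Hypercontractivity: the fourth moment of a multilinear polynomial of degree at most `d`
is bounded by a multiple of the squared second moment. -/
lemma integral_mpoly_pow_four_le (hX : IsStdIndep P X M) (U : Finset ℕ) (c : Finset ℕ → ℝ) (d : ℕ)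
    (hc : ∀ A ⊆ U, c A ≠ 0 → A.card ≤ d) :
    ∫ ω, mpoly X U c ω ^ 4 ∂P ≤ (16 * M) ^ d * (∑ A ∈ U.powerset, c A ^ 2) ^ 2 := by
  have hM := hX.one_le
  induction U using Finset.induction_on generalizing c d with
  | empty =>
    simp only [mpoly, Finset.powerset_empty, Finset.sum_singleton, Finset.prod_empty, mul_one,
      integral_const, probReal_univ, one_smul, ← pow_mul]
    exact le_mul_of_one_le_left (by positivity) (one_le_pow₀ (by linarith))
  | insert j U hj ih =>
    have hG : ∀ A ⊆ U, c A ≠ 0 → A.card ≤ d :=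
      fun A hA => hc A (hA.trans (Finset.subset_insert j U))
    have hcard : ∀ A ⊆ U, c (insert j A) ≠ 0 → A.card + 1 ≤ d := fun A hA h => by
      have := hc (insert j A) (Finset.insert_subset_insert j hA) h
      rwa [Finset.card_insert_of_notMem fun h => hj (hA h)] at this
    set G := mpoly X U c
    set H := mpoly X U (fun A => c (insert j A))
    rw [Finset.sum_powerset_insert hj]
    set g := ∑ A ∈ U.powerset, c A ^ 2 with hg
    set h := ∑ A ∈ U.powerset, c (insert j A) ^ 2 with hh
    have g0 : 0 ≤ g := Finset.sum_nonneg fun A _ => sq_nonneg _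
    have h0 : 0 ≤ h := Finset.sum_nonneg fun A _ => sq_nonneg _
    rcases d with _ | d
    -- In degree 0 no set containing j carries a coefficient, so the new variable does not occur.
    · have hz : ∀ A ∈ U.powerset, c (insert j A) = 0 := fun A hA => by
        by_contra hne
        have := hcard A (Finset.mem_powerset.1 hA) hne
        omega
      have e : ∀ ω, mpoly X (insert j U) c ω = G ω := fun ω => by
        rw [mpoly_insert X hj]
        have : mpoly X U (fun A => c (insert j A)) ω = 0 :=
          Finset.sum_eq_zero fun A hA => by simp only [hz A hA, zero_mul]
        rw [this, mul_zero, add_zero]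
      have hh0 : h = 0 := Finset.sum_eq_zero fun A hA => by rw [hz A hA]; norm_num
      simp only [e]
      rw [hh0, add_zero]
      exact ih c 0 hG
    · have bG := ih c (d + 1) hG
      have bH := ih (fun A => c (insert j A)) d
        fun A hA hne => Nat.le_of_succ_le_succ (hcard A hA hne)
      rw [← hg] at bG
      rw [← hh] at bH
      have mG := hX.measurable_mpoly U c
      have mH := hX.measurable_mpoly U (fun A => c (insert j A))
      have sG := measurable_mpoly_sigmaExcept X hj c
      have sH := measurable_mpoly_sigmaExcept X hj (fun A => c (insert j A))
      have iG := hX.integrable_mpoly_pow_four U c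
      have iH := hX.integrable_mpoly_pow_four U (fun A => c (insert j A))
      have iX : Integrable (X j) P := by simpa using hX.integrable_pow j (n := 1) (by norm_num)
      have iGH1 : Integrable (fun ω => G ω ^ 3 * H ω ^ 1) P :=
        integrable_pow_mul_pow mG mH iG iH (by norm_num)
      have iGH2 : Integrable (fun ω => G ω ^ 2 * H ω ^ 2) P :=
        integrable_pow_mul_pow mG mH iG iH (by norm_num)
      have i1 : Integrable (fun ω => X j ω * (G ω ^ 3 * H ω ^ 1)) P :=
        hX.integrable_mul (g := id) ((sG.pow_const 3).mul (sH.pow_const 1)) measurable_id iX iGH1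
      have i2 : Integrable (fun ω => X j ω ^ 2 * (G ω ^ 2 * H ω ^ 2)) P :=
        hX.integrable_mul (g := fun x => x ^ 2) ((sG.pow_const 2).mul (sH.pow_const 2))
          (measurable_id.pow_const 2) (hX.integrable_pow j (by norm_num)) iGH2
      have i4 : Integrable (fun ω => X j ω ^ 4 * H ω ^ 4) P :=
        hX.integrable_mul (g := fun x => x ^ 4) (sH.pow_const 4) (measurable_id.pow_const 4)
          (hX.int4 j) iH
      have e1 : ∫ ω, X j ω * (G ω ^ 3 * H ω ^ 1) ∂P = 0 := by
        have := hX.integral_mul (g := id) ((sG.pow_const 3).mul (sH.pow_const 1)) measurable_id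
        simpa [hX.mean] using this
      have e2 : ∫ ω, X j ω ^ 2 * (G ω ^ 2 * H ω ^ 2) ∂P = ∫ ω, G ω ^ 2 * H ω ^ 2 ∂P := by
        have := hX.integral_mul (g := fun x => x ^ 2) ((sG.pow_const 2).mul (sH.pow_const 2))
          (measurable_id.pow_const 2)
        simp only [hX.var, one_mul, Pi.mul_apply] at this
        exact this
      have e4 : ∫ ω, X j ω ^ 4 * H ω ^ 4 ∂P ≤ M * ∫ ω, H ω ^ 4 ∂P := by
        have := hX.integral_mul (g := fun x => x ^ 4) (sH.pow_const 4) (measurable_id.pow_const 4)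
        rw [this]
        exact mul_le_mul_of_nonneg_right (hX.fourth j)
          (integral_nonneg fun ω => by positivity)
      have j1 : Integrable (fun ω => G ω ^ 4 + 4 * (X j ω * (G ω ^ 3 * H ω ^ 1))) P :=
        iG.add (i1.const_mul 4)
      have j2 : Integrable (fun ω => G ω ^ 4 + 4 * (X j ω * (G ω ^ 3 * H ω ^ 1))
          + 8 * (X j ω ^ 2 * (G ω ^ 2 * H ω ^ 2))) P := j1.add (i2.const_mul 8)
      -- Expand (G + X H)⁴. The term 4 G³ X H has mean 0, and 4 G (X H)³ ≤ 2 G² (X H)² + 2 (X H)⁴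
      -- turns the coefficients 6 and 1 into 8 and 3, without any need for the third moment of X.
      have step : ∫ ω, mpoly X (insert j U) c ω ^ 4 ∂P
          ≤ ∫ ω, G ω ^ 4 ∂P + 8 * ∫ ω, G ω ^ 2 * H ω ^ 2 ∂P + 3 * (M * ∫ ω, H ω ^ 4 ∂P) := by
        calc ∫ ω, mpoly X (insert j U) c ω ^ 4 ∂P
            ≤ ∫ ω, (G ω ^ 4 + 4 * (X j ω * (G ω ^ 3 * H ω ^ 1))
              + 8 * (X j ω ^ 2 * (G ω ^ 2 * H ω ^ 2)) + 3 * (X j ω ^ 4 * H ω ^ 4)) ∂P := by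
              refine integral_mono (hX.integrable_mpoly_pow_four _ _) (j2.add (i4.const_mul 3))
                fun ω => ?_
              simp only [mpoly_insert X hj]
              change (G ω + X j ω * H ω) ^ 4 ≤ _
              nlinarith [sq_nonneg (X j ω * H ω * G ω - X j ω ^ 2 * H ω ^ 2)]
          _ ≤ _ := by
              rw [integral_add j2 (i4.const_mul 3), integral_add j1 (i2.const_mul 8),
                integral_add iG (i1.const_mul 4), integral_const_mul, integral_const_mul,
                integral_const_mul, e1, e2]
              linarith
      set κ := 16 * M with hκ
      have κ0 : 0 ≤ κ := by linarith
      have hH4 : 0 ≤ ∫ ω, H ω ^ 4 ∂P := integral_nonneg fun ω => by positivity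
      -- Cauchy–Schwarz combines the bounds for G (degree at most d + 1) and H (degree at most d).
      -- The product falls short of a perfect square by one factor κ, which pays for 4² = 16; this
      -- is the source of the 16 in 16 M.
      have cs : 4 * ∫ ω, G ω ^ 2 * H ω ^ 2 ∂P ≤ κ ^ (d + 1) * (g * h) := by
        refine (le_abs_self _).trans (abs_le_of_sq_le_sq (b := κ ^ (d + 1) * (g * h)) ?_ (by positivity))
        have := sq_integral_mul_le (P := P) (f := fun ω => G ω ^ 2) (g := fun ω => H ω ^ 2)
          (by simpa only [← pow_mul] using iG) (by simpa only [← pow_mul] using iH) iGH2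
        simp only [← pow_mul] at this
        calc (4 * ∫ ω, G ω ^ 2 * H ω ^ 2 ∂P) ^ 2 = 16 * (∫ ω, G ω ^ 2 * H ω ^ 2 ∂P) ^ 2 := by ring
          _ ≤ 16 * ((κ ^ (d + 1) * g ^ 2) * (κ ^ d * h ^ 2)) := by
              refine mul_le_mul_of_nonneg_left (this.trans ?_) (by norm_num)
              exact mul_le_mul bG bH hH4
                (mul_nonneg (pow_nonneg κ0 _) (sq_nonneg g))
          _ ≤ κ * ((κ ^ (d + 1) * g ^ 2) * (κ ^ d * h ^ 2)) := by
              refine mul_le_mul_of_nonneg_right (by linarith) (by positivity)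
          _ = (κ ^ (d + 1) * (g * h)) ^ 2 := by ring
      have last : 3 * (M * ∫ ω, H ω ^ 4 ∂P) ≤ κ ^ (d + 1) * h ^ 2 := by
        calc 3 * (M * ∫ ω, H ω ^ 4 ∂P) ≤ 3 * (M * (κ ^ d * h ^ 2)) := by gcongr
          _ = (3 * M) * (κ ^ d * h ^ 2) := by ring
          _ ≤ κ * (κ ^ d * h ^ 2) := mul_le_mul_of_nonneg_right (by linarith) (by positivity)
          _ = κ ^ (d + 1) * h ^ 2 := by ring
      calc _ ≤ _ := step
        _ ≤ κ ^ (d + 1) * g ^ 2 + 2 * (κ ^ (d + 1) * (g * h)) + κ ^ (d + 1) * h ^ 2 := by linarith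
        _ = κ ^ (d + 1) * (g + h) ^ 2 := by ring

end IsStdIndep

end CombCLT

namespace CombCLT

variable {Ω : Type*} [MeasurableSpace Ω]

/-! ### Stein's method for homogeneous multilinear polynomials -/

lemma sum_powerset_erase_insert {β : Type*} [AddCommMonoid β] {U : Finset ℕ} {j : ℕ} (hj : j ∈ U)
    (g : Finset ℕ → β) :
    ∑ A ∈ (U.erase j).powerset, g (insert j A) = ∑ A ∈ U.powerset with j ∈ A, g A := by
  refine Finset.sum_nbij' (insert j) (fun A => A.erase j) ?_ ?_ ?_ ?_ fun _ _ => rfl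
  · intro A hA
    simp only [Finset.mem_filter, Finset.mem_powerset] at hA ⊢
    exact ⟨Finset.insert_subset hj (hA.trans (Finset.erase_subset j U)),
      Finset.mem_insert_self j A⟩
  · intro A hA
    simp only [Finset.mem_filter, Finset.mem_powerset] at hA ⊢
    exact Finset.erase_subset_erase j hA.1
  · intro A hA
    exact Finset.erase_insert fun h => Finset.notMem_erase j U (Finset.mem_powerset.1 hA h)
  · intro A hA
    exact Finset.insert_erase (Finset.mem_filter.1 hA).2

lemma sum_sum_mem_powerset {β : Type*} [AddCommMonoid β] (U : Finset ℕ)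
    (g : ℕ → Finset ℕ → β) :
    ∑ j ∈ U, ∑ A ∈ U.powerset with j ∈ A, g j A = ∑ A ∈ U.powerset, ∑ j ∈ A, g j A := by
  refine Finset.sum_comm' fun j A => ?_
  simp only [Finset.mem_filter, Finset.mem_powerset]
  exact ⟨fun h => ⟨h.2.2, h.2.1⟩, fun h => ⟨h.2 h.1, h.2, h.1⟩⟩

/-- The partial derivative of `mpoly X U c` with respect to the `j`-th variable. -/
noncomputable def mderiv (X : ℕ → Ω → ℝ) (U : Finset ℕ) (c : Finset ℕ → ℝ) (j : ℕ) : Ω → ℝ :=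
  mpoly X (U.erase j) fun A => c (insert j A)

/-- The influence of the `j`-th variable on `mpoly X U c`. -/
def influence (U : Finset ℕ) (c : Finset ℕ → ℝ) (j : ℕ) : ℝ :=
  ∑ A ∈ U.powerset with j ∈ A, c A ^ 2

lemma influence_nonneg (U : Finset ℕ) (c : Finset ℕ → ℝ) (j : ℕ) : 0 ≤ influence U c j :=
  Finset.sum_nonneg fun _ _ => sq_nonneg _

lemma sum_influence {U : Finset ℕ} {c : Finset ℕ → ℝ} {q : ℕ}
    (hc : ∀ A ⊆ U, c A ≠ 0 → A.card = q) :
    ∑ j ∈ U, influence U c j = q * ∑ A ∈ U.powerset, c A ^ 2 := by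
  simp only [influence]
  rw [sum_sum_mem_powerset U fun _ A => c A ^ 2, Finset.mul_sum]
  refine Finset.sum_congr rfl fun A hA => ?_
  rw [Finset.sum_const, nsmul_eq_mul]
  by_cases h : c A = 0
  · simp [h]
  · rw [hc A (Finset.mem_powerset.1 hA) h]

lemma mpoly_eq_add (X : ℕ → Ω → ℝ) {U : Finset ℕ} {j : ℕ} (hj : j ∈ U) (c : Finset ℕ → ℝ) (ω : Ω) :
    mpoly X U c ω = mpoly X (U.erase j) c ω + X j ω * mderiv X U c j ω := by
  conv_lhs => rw [← Finset.insert_erase hj]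
  rw [mpoly_insert X (Finset.notMem_erase j U), mderiv]

/-- Euler's identity for homogeneous multilinear polynomials. -/
lemma sum_mul_mderiv (X : ℕ → Ω → ℝ) {U : Finset ℕ} {c : Finset ℕ → ℝ} {q : ℕ}
    (hc : ∀ A ⊆ U, c A ≠ 0 → A.card = q) (ω : Ω) :
    ∑ j ∈ U, X j ω * mderiv X U c j ω = q * mpoly X U c ω := by
  have e : ∀ j ∈ U, X j ω * mderiv X U c j ω
      = ∑ A ∈ U.powerset with j ∈ A, c A * ∏ k ∈ A, X k ω := fun j hj => by
    rw [← sum_powerset_erase_insert hj fun A => c A * ∏ k ∈ A, X k ω, mderiv, mpoly,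
      Finset.mul_sum]
    refine Finset.sum_congr rfl fun A hA => ?_
    rw [Finset.prod_insert fun h => Finset.notMem_erase j U (Finset.mem_powerset.1 hA h)]
    ring
  rw [Finset.sum_congr rfl e, sum_sum_mem_powerset U fun _ A => c A * ∏ k ∈ A, X k ω, mpoly,
    Finset.mul_sum]
  refine Finset.sum_congr rfl fun A hA => ?_
  rw [Finset.sum_const, nsmul_eq_mul]
  by_cases h : c A = 0
  · simp [h]
  · rw [hc A (Finset.mem_powerset.1 hA) h]

/-! ### Regularity of the Stein solution as used in the expansion. -/

variable {h : ℝ → ℝ}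

lemma continuous_steinSol (hh : LipschitzWith 1 h) : Continuous (steinSol h) :=
  continuous_iff_continuousAt.2 fun x => (hasDerivAt_steinSol hh x).continuousAt

lemma continuous_steinDeriv (hh : LipschitzWith 1 h) : Continuous (steinDeriv h) :=
  (continuous_id.mul (continuous_steinSol hh)).add (hh.continuous.sub continuous_const)

/-- The mean value inequality for f(t) - t f'(x), whose derivative between x and y is at most
`steinLip` * |y - x|. The factor 1/2 of the sharp Taylor bound is not needed. -/
lemma abs_steinSol_taylor_le (hh : LipschitzWith 1 h) (x y : ℝ) :
    |steinSol h y - steinSol h x - (y - x) * steinDeriv h x| ≤ steinLip * |y - x| ^ 2 := by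
  have hd : ∀ t, HasDerivAt (fun t => steinSol h t - t * steinDeriv h x)
      (steinDeriv h t - steinDeriv h x) t := fun t =>
    ((hasDerivAt_steinSol hh t).sub ((hasDerivAt_id' t).mul_const _)).congr_deriv (by ring)
  have hb : ∀ t ∈ Set.uIcc x y, ‖steinDeriv h t - steinDeriv h x‖ ≤ steinLip * |y - x| :=
    fun t ht => by
      refine (abs_steinDeriv_sub_le hh t x).trans ?_
      exact mul_le_mul_of_nonneg_left (Set.abs_sub_left_of_mem_uIcc ht) steinLip_nonneg
  have := Convex.norm_image_sub_le_of_norm_hasDerivWithin_le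
    (fun t _ => (hd t).hasDerivWithinAt) hb (convex_uIcc x y) Set.left_mem_uIcc Set.right_mem_uIcc
  simp only [Real.norm_eq_abs] at this
  calc _ = |steinSol h y - y * steinDeriv h x - (steinSol h x - x * steinDeriv h x)| := by
        congr 1; ring
    _ ≤ _ := this
    _ = _ := by ring

namespace IsStdIndep

variable {P : Measure Ω} [IsProbabilityMeasure P] {X : ℕ → Ω → ℝ} {M : ℝ}

lemma integral_abs_le (hX : IsStdIndep P X M) (k : ℕ) : ∫ ω, |X k ω| ∂P ≤ M := by
  have i2 := hX.integrable_pow k (n := 2) (by norm_num)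
  have i : Integrable (X k) P := by simpa using hX.integrable_pow k (n := 1) (by norm_num)
  calc ∫ ω, |X k ω| ∂P ≤ ∫ ω, (1 / 2 + 1 / 2 * (X k ω ^ 2)) ∂P := by
        refine integral_mono i.abs ((integrable_const _).add (i2.const_mul _)) fun ω => ?_
        simp only [← sq_abs (X k ω)]
        nlinarith [sq_nonneg (|X k ω| - 1)]
    _ ≤ M := by
        rw [integral_add (integrable_const _) (i2.const_mul _), integral_const_mul, hX.var]
        have := hX.one_le
        simp
        linarith

lemma integrable_abs_cube (hX : IsStdIndep P X M) (k : ℕ) :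
    Integrable (fun ω => |X k ω| ^ 3) P := by
  simpa [abs_pow] using (hX.integrable_pow k (n := 3) (by norm_num)).abs

lemma integral_abs_cube_le (hX : IsStdIndep P X M) (k : ℕ) : ∫ ω, |X k ω| ^ 3 ∂P ≤ M := by
  have i2 := hX.integrable_pow k (n := 2) (by norm_num)
  calc ∫ ω, |X k ω| ^ 3 ∂P ≤ ∫ ω, (1 / 2 * (X k ω ^ 2) + 1 / 2 * (X k ω ^ 4)) ∂P := by
        refine integral_mono (hX.integrable_abs_cube k)
          ((i2.const_mul _).add ((hX.int4 k).const_mul _)) fun ω => ?_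
        have h4 : X k ω ^ 4 = |X k ω| ^ 4 := (Even.pow_abs (by decide) _).symm
        simp only [h4, ← sq_abs (X k ω)]
        nlinarith [sq_nonneg (|X k ω| - |X k ω| ^ 2)]
    _ ≤ M := by
        rw [integral_add (i2.const_mul _) ((hX.int4 k).const_mul _), integral_const_mul,
          integral_const_mul, hX.var]
        have := hX.one_le
        have := hX.fourth k
        linarith

lemma measurable_mderiv (hX : IsStdIndep P X M) (U : Finset ℕ) (c : Finset ℕ → ℝ) (j : ℕ) :
    Measurable (mderiv X U c j) :=
  hX.measurable_mpoly _ _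

lemma integrable_mderiv_pow (hX : IsStdIndep P X M) (U : Finset ℕ) (c : Finset ℕ → ℝ) (j : ℕ)
    {n : ℕ} (hn : n ≤ 4) : Integrable (fun ω => mderiv X U c j ω ^ n) P :=
  hX.integrable_mpoly_pow _ _ hn

lemma measurable_mderiv_sigmaExcept (U : Finset ℕ) (c : Finset ℕ → ℝ) (j : ℕ) :
    Measurable[sigmaExcept X j] (mderiv X U c j) :=
  measurable_mpoly_sigmaExcept X (Finset.notMem_erase j U) _

lemma integral_mderiv_sq (hX : IsStdIndep P X M) {U : Finset ℕ} (c : Finset ℕ → ℝ) {j : ℕ}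
    (hj : j ∈ U) : ∫ ω, mderiv X U c j ω ^ 2 ∂P = influence U c j := by
  rw [mderiv, hX.integral_mpoly_sq, influence, sum_powerset_erase_insert hj fun A => c A ^ 2]

lemma integral_mderiv_pow_four_le (hX : IsStdIndep P X M) {U : Finset ℕ} {c : Finset ℕ → ℝ} {j : ℕ}
    (hj : j ∈ U) {q : ℕ} (hc : ∀ A ⊆ U, c A ≠ 0 → A.card = q) :
    ∫ ω, mderiv X U c j ω ^ 4 ∂P ≤ (16 * M) ^ (q - 1) * influence U c j ^ 2 := by
  rw [influence, ← sum_powerset_erase_insert hj fun A => c A ^ 2]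
  refine hX.integral_mpoly_pow_four_le _ _ _ fun A hA h => ?_
  have := hc (insert j A) (Finset.insert_subset hj (hA.trans (Finset.erase_subset j U))) h
  rw [Finset.card_insert_of_notMem fun h => Finset.notMem_erase j U (hA h)] at this
  omega

/-- Interpolate |D|³ ≤ (√τ/2) D² + (1/(2√τ)) D⁴. Hypercontractivity gives E D⁴ ≤ κ · influence² ≤ κ
τ · influence, so the weight √τ balances the two terms; D has degree q - 1, hence the exponent. -/
lemma integral_abs_mderiv_cube_le (hX : IsStdIndep P X M) {U : Finset ℕ} {c : Finset ℕ → ℝ} {j : ℕ}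
    (hj : j ∈ U) {q : ℕ} (hc : ∀ A ⊆ U, c A ≠ 0 → A.card = q) {τ : ℝ} (hτ : 0 < τ)
    (h : influence U c j ≤ τ) :
    ∫ ω, |mderiv X U c j ω| ^ 3 ∂P ≤ √τ * (16 * M) ^ (q - 1) * influence U c j := by
  set D := mderiv X U c j
  have i2 : Integrable (fun ω => D ω ^ 2) P := hX.integrable_mderiv_pow U c j (by norm_num)
  have i4 : Integrable (fun ω => D ω ^ 4) P := hX.integrable_mderiv_pow U c j (by norm_num)
  have i3 : Integrable (fun ω => |D ω| ^ 3) P := by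
    simpa [abs_pow] using (hX.integrable_mderiv_pow U c j (n := 3) (by norm_num)).abs
  have hs : 0 < √τ := Real.sqrt_pos.2 hτ
  have hκ : 1 ≤ (16 * M) ^ (q - 1) := one_le_pow₀ (by linarith [hX.one_le])
  set κ := (16 * M) ^ (q - 1)
  have b4 : ∫ ω, D ω ^ 4 ∂P ≤ κ * influence U c j ^ 2 := hX.integral_mderiv_pow_four_le hj hc
  have h0 := influence_nonneg U c j
  calc ∫ ω, |D ω| ^ 3 ∂P ≤ ∫ ω, (√τ / 2 * D ω ^ 2 + (2 * √τ)⁻¹ * D ω ^ 4) ∂P := by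
        refine integral_mono i3 ((i2.const_mul _).add (i4.const_mul _)) fun ω => ?_
        have h4 : D ω ^ 4 = |D ω| ^ 4 := (Even.pow_abs (by decide) _).symm
        simp only [h4, ← sq_abs (D ω)]
        have : √τ / 2 * |D ω| ^ 2 + (2 * √τ)⁻¹ * |D ω| ^ 4 - |D ω| ^ 3
            = (2 * √τ)⁻¹ * (|D ω| ^ 2 * (√τ - |D ω|) ^ 2) := by
          field_simp
          ring
        have h1 : 0 ≤ (2 * √τ)⁻¹ * (|D ω| ^ 2 * (√τ - |D ω|) ^ 2) := by positivity
        linarith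
    _ = √τ / 2 * influence U c j + (2 * √τ)⁻¹ * ∫ ω, D ω ^ 4 ∂P := by
        rw [integral_add (i2.const_mul _) (i4.const_mul _), integral_const_mul,
          integral_const_mul, hX.integral_mderiv_sq c hj]
    _ ≤ √τ / 2 * (κ * influence U c j) + (2 * √τ)⁻¹ * (κ * (τ * influence U c j)) := by
        have hb : influence U c j ^ 2 ≤ τ * influence U c j := by
          rw [sq]; exact mul_le_mul_of_nonneg_right h h0
        gcongr
        · exact le_mul_of_one_le_left h0 hκ
        · exact b4.trans (by gcongr)
    _ = √τ * κ * influence U c j := by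
        nth_rewrite 3 [← Real.mul_self_sqrt hτ.le]
        field_simp
        ring

/-- Write F = G + X_j D with G and D independent of X_j, and expand around G. The term X_j D f(G)
has mean 0, and X_j² D² f'(G) has the same mean as D² f'(G). What remains is controlled by the
Lipschitz constant of f' times (|X_j| + |X_j|³) |D|³, and both absolute moments of X_j are at most
M. -/
lemma stein_local (hX : IsStdIndep P X M) (hh : LipschitzWith 1 h) {U : Finset ℕ}
    (c : Finset ℕ → ℝ) {j : ℕ} (hj : j ∈ U) :
    |∫ ω, (mderiv X U c j ω ^ 2 * steinDeriv h (mpoly X U c ω)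
        - X j ω * mderiv X U c j ω * steinSol h (mpoly X U c ω)) ∂P|
      ≤ 2 * steinLip * M * ∫ ω, |mderiv X U c j ω| ^ 3 ∂P := by
  set F := mpoly X U c
  set G := mpoly X (U.erase j) c
  set D := mderiv X U c j
  have hF : ∀ ω, F ω = G ω + X j ω * D ω := mpoly_eq_add X hj c
  have mF : Measurable F := hX.measurable_mpoly _ _
  have mG : Measurable G := hX.measurable_mpoly _ _
  have mD : Measurable D := hX.measurable_mderiv _ _ _
  have sG : Measurable[sigmaExcept X j] G :=
    measurable_mpoly_sigmaExcept X (Finset.notMem_erase j U) _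
  have sD : Measurable[sigmaExcept X j] D := measurable_mderiv_sigmaExcept U c j
  have mf := (continuous_steinSol hh).measurable
  have mf' := (continuous_steinDeriv hh).measurable
  have i1 : Integrable D P := by simpa using hX.integrable_mderiv_pow U c j (n := 1) (by norm_num)
  have i2 : Integrable (fun ω => D ω ^ 2) P := hX.integrable_mderiv_pow U c j (by norm_num)
  have i3 : Integrable (fun ω => |D ω| ^ 3) P := by
    simpa [abs_pow] using (hX.integrable_mderiv_pow U c j (n := 3) (by norm_num)).abs
  have iX : Integrable (X j) P := by simpa using hX.integrable_pow j (n := 1) (by norm_num)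
  have iX2 := hX.integrable_pow j (n := 2) (by norm_num)
  have iX3 := hX.integrable_abs_cube j
  -- products with bounded functions
  have iDf : Integrable (fun ω => D ω * steinSol h (G ω)) P :=
    integrable_of_abs_le (i1.abs.mul_const steinConst) (mD.mul (mf.comp mG)) fun ω => by
      rw [abs_mul]
      exact mul_le_mul_of_nonneg_left (abs_steinSol_le hh _) (abs_nonneg _)
  have sDf : Measurable[sigmaExcept X j] (fun ω => D ω * steinSol h (G ω)) :=
    sD.mul (mf.comp sG)
  have iD2f : Integrable (fun ω => D ω ^ 2 * steinDeriv h (G ω)) P :=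
    integrable_of_abs_le (i2.mul_const 6) ((mD.pow_const 2).mul (mf'.comp mG)) fun ω => by
      rw [abs_mul, abs_of_nonneg (sq_nonneg (D ω))]
      exact mul_le_mul_of_nonneg_left (abs_steinDeriv_le hh _) (sq_nonneg _)
  have sD2f : Measurable[sigmaExcept X j] (fun ω => D ω ^ 2 * steinDeriv h (G ω)) :=
    (sD.pow_const 2).mul (mf'.comp sG)
  have a1 : Integrable (fun ω => X j ω * (D ω * steinSol h (G ω))) P :=
    hX.integrable_mul (g := id) sDf measurable_id iX iDf
  have a2 : Integrable (fun ω => X j ω ^ 2 * (D ω ^ 2 * steinDeriv h (G ω))) P :=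
    hX.integrable_mul (g := fun x => x ^ 2) sD2f (measurable_id.pow_const 2) iX2 iD2f
  have e1 : ∫ ω, X j ω * (D ω * steinSol h (G ω)) ∂P = 0 := by
    have := hX.integral_mul (g := id) sDf measurable_id
    simpa [hX.mean] using this
  have e2 : ∫ ω, X j ω ^ 2 * (D ω ^ 2 * steinDeriv h (G ω)) ∂P
      = ∫ ω, D ω ^ 2 * steinDeriv h (G ω) ∂P := by
    have := hX.integral_mul (g := fun x => x ^ 2) sD2f (measurable_id.pow_const 2)
    rw [this, hX.var, one_mul]
  -- the remainder
  set R : Ω → ℝ := fun ω => D ω ^ 2 * (steinDeriv h (F ω) - steinDeriv h (G ω))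
    - X j ω * D ω * (steinSol h (F ω) - steinSol h (G ω) - (F ω - G ω) * steinDeriv h (G ω)) with hR
  have mR : Measurable R :=
    ((mD.pow_const 2).mul ((mf'.comp mF).sub (mf'.comp mG))).sub
      (((hX.meas j).mul mD).mul (((mf.comp mF).sub (mf.comp mG)).sub
        ((mF.sub mG).mul (mf'.comp mG))))
  have sD3 : Measurable[sigmaExcept X j] (fun ω => |D ω| ^ 3) :=
    (measurable_id.abs.pow_const 3 : Measurable fun x : ℝ => |x| ^ 3).comp sD
  have b1 : Integrable (fun ω => |X j ω| * |D ω| ^ 3) P :=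
    hX.integrable_mul (g := fun x => |x|) sD3 measurable_id.abs iX.abs i3
  have b3 : Integrable (fun ω => |X j ω| ^ 3 * |D ω| ^ 3) P :=
    hX.integrable_mul (g := fun x => |x| ^ 3) sD3 (measurable_id.abs.pow_const 3) iX3 i3
  have bR : ∀ ω, |R ω| ≤ steinLip * (|X j ω| * |D ω| ^ 3) + steinLip * (|X j ω| ^ 3 * |D ω| ^ 3) :=
    fun ω => by
      have hFG : F ω - G ω = X j ω * D ω := by rw [hF]; ring
      have t1 := abs_steinDeriv_sub_le hh (F ω) (G ω)
      have t2 := abs_steinSol_taylor_le hh (G ω) (F ω)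
      refine (abs_sub _ _).trans (add_le_add ?_ ?_)
      · rw [abs_mul, abs_pow]
        calc _ ≤ |D ω| ^ 2 * (steinLip * |F ω - G ω|) :=
              mul_le_mul_of_nonneg_left t1 (by positivity)
          _ = _ := by rw [hFG, abs_mul]; ring
      · rw [abs_mul, abs_mul]
        calc _ ≤ |X j ω| * |D ω| * (steinLip * |F ω - G ω| ^ 2) :=
              mul_le_mul_of_nonneg_left t2 (by positivity)
          _ = _ := by rw [hFG, abs_mul]; ring
  have bRi : Integrable (fun ω => steinLip * (|X j ω| * |D ω| ^ 3)
      + steinLip * (|X j ω| ^ 3 * |D ω| ^ 3)) P := (b1.const_mul _).add (b3.const_mul _)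
  have iR : Integrable R P := integrable_of_abs_le bRi mR bR
  have key : ∫ ω, (D ω ^ 2 * steinDeriv h (F ω) - X j ω * D ω * steinSol h (F ω)) ∂P
      = ∫ ω, R ω ∂P := by
    have e : ∀ ω, D ω ^ 2 * steinDeriv h (F ω) - X j ω * D ω * steinSol h (F ω)
        = R ω + (D ω ^ 2 * steinDeriv h (G ω) - X j ω ^ 2 * (D ω ^ 2 * steinDeriv h (G ω)))
          - X j ω * (D ω * steinSol h (G ω)) := fun ω => by
      have hFG : F ω - G ω = X j ω * D ω := by rw [hF]; ring
      rw [hR]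
      simp only [hFG]
      ring
    have i5 : Integrable (fun ω => D ω ^ 2 * steinDeriv h (G ω)
        - X j ω ^ 2 * (D ω ^ 2 * steinDeriv h (G ω))) P := iD2f.sub a2
    have i6 : Integrable (fun ω => R ω + (D ω ^ 2 * steinDeriv h (G ω)
        - X j ω ^ 2 * (D ω ^ 2 * steinDeriv h (G ω)))) P := iR.add i5
    simp only [e]
    rw [integral_sub i6 a1, integral_add iR i5, integral_sub iD2f a2, e1, e2]
    ring
  rw [key]
  have h3 : 0 ≤ ∫ ω, |D ω| ^ 3 ∂P := integral_nonneg fun ω => by positivity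
  calc |∫ ω, R ω ∂P| ≤ ∫ ω, |R ω| ∂P := abs_integral_le_integral_abs
    _ ≤ ∫ ω, (steinLip * (|X j ω| * |D ω| ^ 3) + steinLip * (|X j ω| ^ 3 * |D ω| ^ 3)) ∂P :=
        integral_mono iR.abs bRi bR
    _ = steinLip * ((∫ ω, |X j ω| ∂P) * ∫ ω, |D ω| ^ 3 ∂P)
        + steinLip * ((∫ ω, |X j ω| ^ 3 ∂P) * ∫ ω, |D ω| ^ 3 ∂P) := by
        rw [integral_add (b1.const_mul _) (b3.const_mul _), integral_const_mul,
          integral_const_mul, hX.integral_mul (g := fun x => |x|) sD3 measurable_id.abs,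
          hX.integral_mul (g := fun x => |x| ^ 3) sD3 (measurable_id.abs.pow_const 3)]
    _ ≤ steinLip * (M * ∫ ω, |D ω| ^ 3 ∂P) + steinLip * (M * ∫ ω, |D ω| ^ 3 ∂P) := by
        have hL := steinLip_nonneg
        have := hX.integral_abs_le j
        have := hX.integral_abs_cube_le j
        gcongr
    _ = 2 * steinLip * M * ∫ ω, |D ω| ^ 3 ∂P := by ring

/-- Stein's bound for a homogeneous multilinear polynomial of degree `q`. -/
lemma stein_bound (hX : IsStdIndep P X M) (hh : LipschitzWith 1 h) {U : Finset ℕ}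
    {c : Finset ℕ → ℝ} {q : ℕ} (hq : 1 ≤ q) (hc : ∀ A ⊆ U, c A ≠ 0 → A.card = q)
    {τ : ℝ} (hτ : 0 < τ) (hinf : ∀ j ∈ U, influence U c j ≤ τ) :
    |∫ ω, h (mpoly X U c ω) ∂P - ∫ x, h x ∂gaussianReal 0 1|
      ≤ 6 * ∫ ω, |∑ j ∈ U, mderiv X U c j ω ^ 2 - q| ∂P
        + 2 * steinLip * M * (16 * M) ^ (q - 1) * √τ * ∑ A ∈ U.powerset, c A ^ 2 := by
  set F := mpoly X U c
  set D := mderiv X U c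
  set m := ∫ x, h x ∂gaussianReal 0 1
  have hM := hX.one_le
  have hL := steinLip_nonneg
  have hq1 : (1 : ℝ) ≤ q := by exact_mod_cast hq
  have mF : Measurable F := hX.measurable_mpoly _ _
  have mD : ∀ j, Measurable (D j) := fun j => hX.measurable_mderiv _ _ _
  have mf := (continuous_steinSol hh).measurable
  have mf' := (continuous_steinDeriv hh).measurable
  have iD2 : ∀ j, Integrable (fun ω => D j ω ^ 2) P :=
    fun j => hX.integrable_mderiv_pow U c j (by norm_num)
  have iF : Integrable F P := hX.integrable_mpoly U c
  have iV : Integrable (fun ω => ∑ j ∈ U, D j ω ^ 2 - q) P :=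
    (integrable_finsetSum _ fun j _ => iD2 j).sub (integrable_const _)
  have mV : Measurable (fun ω => ∑ j ∈ U, D j ω ^ 2 - q) :=
    (Finset.measurable_fun_sum _ fun j _ => (mD j).pow_const 2).sub measurable_const
  have iVf : Integrable (fun ω => (∑ j ∈ U, D j ω ^ 2 - q) * steinDeriv h (F ω)) P :=
    integrable_of_abs_le (iV.abs.mul_const 6) (mV.mul (mf'.comp mF)) fun ω => by
      rw [abs_mul]
      exact mul_le_mul_of_nonneg_left (abs_steinDeriv_le hh _) (abs_nonneg _)
  have iXD : ∀ j, Integrable (fun ω => X j ω * D j ω) P := fun j => by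
    have iX : Integrable (X j) P := by simpa using hX.integrable_pow j (n := 1) (by norm_num)
    have iD : Integrable (D j) P := by
      simpa using hX.integrable_mderiv_pow U c j (n := 1) (by norm_num)
    exact hX.integrable_mul (g := id) (measurable_mderiv_sigmaExcept U c j) measurable_id iX iD
  have iloc : ∀ j, Integrable (fun ω => D j ω ^ 2 * steinDeriv h (F ω)
      - X j ω * D j ω * steinSol h (F ω)) P := fun j =>
    integrable_of_abs_le (((iD2 j).mul_const 6).add ((iXD j).abs.mul_const steinConst))
      (((mD j).pow_const 2).mul (mf'.comp mF) |>.sub (((hX.meas j).mul (mD j)).mul (mf.comp mF)))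
      fun ω => by
        refine (abs_sub _ _).trans (add_le_add ?_ ?_)
        · rw [abs_mul, abs_of_nonneg (sq_nonneg (D j ω))]
          exact mul_le_mul_of_nonneg_left (abs_steinDeriv_le hh _) (sq_nonneg _)
        · rw [abs_mul]
          exact mul_le_mul_of_nonneg_left (abs_steinSol_le hh _) (abs_nonneg _)
  -- Stein's equation at F, with q F replaced by ∑ X_j D_j through Euler's identity, and with ∑ D_j²
  -- f'(F) added and subtracted.
  have e : ∀ ω, q * (h (F ω) - m) = ∑ j ∈ U, (D j ω ^ 2 * steinDeriv h (F ω)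
      - X j ω * D j ω * steinSol h (F ω))
      - (∑ j ∈ U, D j ω ^ 2 - q) * steinDeriv h (F ω) := fun ω => by
    have he : h (F ω) - m = steinDeriv h (F ω) - F ω * steinSol h (F ω) := by
      rw [steinDeriv]; ring
    rw [Finset.sum_sub_distrib, ← Finset.sum_mul, ← Finset.sum_mul, sum_mul_mderiv X hc, he]
    ring
  have ih : Integrable (fun ω => h (F ω)) P := integrable_lipschitz_of_integrable_id hh iF
  have e' : q * (∫ ω, h (F ω) ∂P - m) = ∑ j ∈ U, ∫ ω, (D j ω ^ 2 * steinDeriv h (F ω)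
      - X j ω * D j ω * steinSol h (F ω)) ∂P
      - ∫ ω, (∑ j ∈ U, D j ω ^ 2 - q) * steinDeriv h (F ω) ∂P := by
    rw [← integral_finsetSum _ fun j _ => iloc j,
      ← integral_sub (integrable_finsetSum _ fun j _ => iloc j) iVf]
    simp only [← e]
    rw [integral_const_mul, integral_sub ih (integrable_const _)]
    simp
  have b1 : |∫ ω, (∑ j ∈ U, D j ω ^ 2 - q) * steinDeriv h (F ω) ∂P|
      ≤ 6 * ∫ ω, |∑ j ∈ U, D j ω ^ 2 - q| ∂P := by
    rw [← integral_const_mul]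
    refine abs_integral_le_integral_abs.trans (integral_mono iVf.abs (iV.abs.const_mul 6) fun ω => ?_)
    simp only
    rw [abs_mul, mul_comm]
    exact mul_le_mul_of_nonneg_right (abs_steinDeriv_le hh _) (abs_nonneg _)
  have b2 : |∑ j ∈ U, ∫ ω, (D j ω ^ 2 * steinDeriv h (F ω)
      - X j ω * D j ω * steinSol h (F ω)) ∂P|
      ≤ q * (2 * steinLip * M * (16 * M) ^ (q - 1) * √τ * ∑ A ∈ U.powerset, c A ^ 2) := by
    calc _ ≤ ∑ j ∈ U, |∫ ω, (D j ω ^ 2 * steinDeriv h (F ω)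
          - X j ω * D j ω * steinSol h (F ω)) ∂P| := Finset.abs_sum_le_sum_abs _ _
      _ ≤ ∑ j ∈ U, 2 * steinLip * M * (√τ * (16 * M) ^ (q - 1) * influence U c j) := by
          refine Finset.sum_le_sum fun j hj => (hX.stein_local hh c hj).trans ?_
          exact mul_le_mul_of_nonneg_left
            (hX.integral_abs_mderiv_cube_le hj hc hτ (hinf j hj)) (by positivity)
      _ = _ := by
          rw [← Finset.mul_sum, ← Finset.mul_sum, sum_influence hc]
          ring
  have hI : 0 ≤ ∫ ω, |∑ j ∈ U, D j ω ^ 2 - q| ∂P := integral_nonneg fun ω => abs_nonneg _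
  have hq0 : (0 : ℝ) < q := by linarith
  -- The local errors carry a factor q from the total influence, which cancels; the fluctuation term
  -- carries none and is simply enlarged by q ≥ 1.
  refine le_of_mul_le_mul_left ?_ hq0
  calc q * |∫ ω, h (F ω) ∂P - m| = |q * (∫ ω, h (F ω) ∂P - m)| := by
        rw [abs_mul, abs_of_pos hq0]
    _ ≤ _ + _ := by rw [e']; exact abs_sub _ _
    _ ≤ _ := add_le_add b2 b1
    _ ≤ _ := by
        rw [mul_add, add_comm]
        refine add_le_add ?_ le_rfl
        exact le_mul_of_one_le_left (mul_nonneg (by norm_num) hI) hq1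

end IsStdIndep

end CombCLT

namespace CombCLT

/-! ### Combinatorics of pairs of index sets -/

lemma sum_mul_comp_eq_sum_image {ι κ : Type*} [DecidableEq κ] (I : Finset ι) (key : ι → κ)
    (a : ι → ℝ) (f : κ → ℝ) :
    ∑ i ∈ I, a i * f (key i) = ∑ x ∈ I.image key, (∑ i ∈ I with key i = x, a i) * f x := by
  rw [← Finset.sum_fiberwise_of_maps_to (g := key) (t := I.image key)
    fun i hi => Finset.mem_image_of_mem key hi]
  refine Finset.sum_congr rfl fun x _ => ?_
  rw [Finset.sum_mul]
  exact Finset.sum_congr rfl fun i hi => by rw [(Finset.mem_filter.1 hi).2]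

/-- If every class of a partition of the keys has at most `N` elements, then the sum over pairs with
keys in the same class is at most `N` times the sum over pairs with the same key. -/
lemma sum_same_class_le {ι κ β : Type*} [DecidableEq κ] [DecidableEq β] (I : Finset ι)
    (key : ι → κ) (W : κ → β) (a : ι → ℝ) (N : ℕ)
    (hN : ∀ x ∈ I.image key, ((I.image key).filter fun y => W x = W y).card ≤ N) :
    ∑ i ∈ I, ∑ i' ∈ I, (a i * a i') * (if W (key i) = W (key i') then 1 else 0)
      ≤ N * ∑ i ∈ I, ∑ i' ∈ I, (a i * a i') * (if key i = key i' then 1 else 0) := by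
  set J := I.image key
  set s : κ → ℝ := fun x => ∑ i ∈ I with key i = x, a i
  -- Grouping by key turns both sides into quadratic forms in the sums of a over the fibres, with no
  -- sign condition on a.
  have reduce : ∀ r : κ → κ → ℝ, ∑ i ∈ I, ∑ i' ∈ I, (a i * a i') * r (key i) (key i')
      = ∑ x ∈ J, ∑ y ∈ J, (s x * s y) * r x y := fun r => by
    have e1 : ∀ i ∈ I, ∑ i' ∈ I, (a i * a i') * r (key i) (key i')
        = a i * ∑ y ∈ J, s y * r (key i) y := fun i _ => by
      rw [← sum_mul_comp_eq_sum_image I key a fun y => r (key i) y, Finset.mul_sum]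
      exact Finset.sum_congr rfl fun _ _ => mul_assoc _ _ _
    rw [Finset.sum_congr rfl e1,
      sum_mul_comp_eq_sum_image I key a fun x => ∑ y ∈ J, s y * r x y]
    refine Finset.sum_congr rfl fun x _ => ?_
    rw [Finset.mul_sum]
    exact Finset.sum_congr rfl fun _ _ => (mul_assoc _ _ _).symm
  rw [reduce fun x y => if W x = W y then 1 else 0, reduce fun x y => if x = y then 1 else 0]
  have hdiag : ∑ x ∈ J, ∑ y ∈ J, (s x * s y) * (if x = y then 1 else 0) = ∑ x ∈ J, s x ^ 2 := by
    refine Finset.sum_congr rfl fun x hx => ?_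
    simp only [mul_ite, mul_one, mul_zero]
    rw [Finset.sum_ite_eq, if_pos hx, sq]
  rw [hdiag]
  have hcount : ∀ x ∈ J, ∑ y ∈ J, s x ^ 2 * (if W x = W y then 1 else 0) ≤ N * s x ^ 2 :=
    fun x hx => by
      rw [← Finset.mul_sum, Finset.sum_boole, mul_comm]
      exact mul_le_mul_of_nonneg_right (by exact_mod_cast hN x hx) (sq_nonneg _)
  have hcount' : ∑ x ∈ J, ∑ y ∈ J, s y ^ 2 * (if W x = W y then (1 : ℝ) else 0)
      = ∑ x ∈ J, ∑ y ∈ J, s x ^ 2 * (if W x = W y then 1 else 0) := by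
    rw [Finset.sum_comm]
    simp only [eq_comm]
  -- Schur's test: bound s_x s_y by (s_x² + s_y²)/2 and count the keys in each class.
  calc ∑ x ∈ J, ∑ y ∈ J, (s x * s y) * (if W x = W y then 1 else 0)
      ≤ ∑ x ∈ J, ∑ y ∈ J, (1 / 2 * (s x ^ 2 * (if W x = W y then 1 else 0))
          + 1 / 2 * (s y ^ 2 * (if W x = W y then 1 else 0))) := by
        refine Finset.sum_le_sum fun x _ => Finset.sum_le_sum fun y _ => ?_
        split_ifs
        · nlinarith [sq_nonneg (s x - s y)]
        · simp
    _ = ∑ x ∈ J, ∑ y ∈ J, s x ^ 2 * (if W x = W y then 1 else 0) := by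
        have h2 : ∀ r : κ → κ → ℝ, ∑ x ∈ J, ∑ y ∈ J, 1 / 2 * r x y
            = 1 / 2 * ∑ x ∈ J, ∑ y ∈ J, r x y := fun r => by simp only [Finset.mul_sum]
        simp only [Finset.sum_add_distrib]
        rw [h2 fun x y => s x ^ 2 * (if W x = W y then 1 else 0),
          h2 fun x y => s y ^ 2 * (if W x = W y then 1 else 0), hcount']
        ring
    _ ≤ ∑ x ∈ J, N * s x ^ 2 := Finset.sum_le_sum hcount
    _ = N * ∑ x ∈ J, s x ^ 2 := by rw [Finset.mul_sum]

/-- The indices `(j, A, B, T)` of the expansion of the sum of the squares of the partial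
derivatives: `j` is common to `A` and `B`, and `T` consists of other common elements. -/
def pairIndex (U : Finset ℕ) (𝒦 : Finset (Finset ℕ)) :
    Finset (ℕ × Finset ℕ × Finset ℕ × Finset ℕ) :=
  (U ×ˢ 𝒦 ×ˢ 𝒦 ×ˢ U.powerset).filter fun i =>
    i.1 ∈ i.2.1 ∧ i.1 ∈ i.2.2.1 ∧ i.2.2.2 ⊆ (i.2.1 ∩ i.2.2.1).erase i.1

/-- The key `(A \ B, B \ A, T)` of an index. -/
def pairKey (i : ℕ × Finset ℕ × Finset ℕ × Finset ℕ) : Finset ℕ × Finset ℕ × Finset ℕ :=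
  (i.2.1 \ i.2.2.1, i.2.2.1 \ i.2.1, i.2.2.2)

/-- The union of the three sets of a key. -/
def keySupport (x : Finset ℕ × Finset ℕ × Finset ℕ) : Finset ℕ := x.1 ∪ x.2.1 ∪ x.2.2

/-- The indices whose key is not empty. -/
def properIndex (U : Finset ℕ) (𝒦 : Finset (Finset ℕ)) :
    Finset (ℕ × Finset ℕ × Finset ℕ × Finset ℕ) :=
  (pairIndex U 𝒦).filter fun i => pairKey i ≠ (∅, ∅, ∅)

lemma mem_pairIndex {U : Finset ℕ} {𝒦 : Finset (Finset ℕ)} (h𝒦 : ∀ A ∈ 𝒦, A ⊆ U)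
    {j : ℕ} {A B T : Finset ℕ} :
    (j, A, B, T) ∈ pairIndex U 𝒦 ↔
      A ∈ 𝒦 ∧ B ∈ 𝒦 ∧ j ∈ A ∧ j ∈ B ∧ T ⊆ (A ∩ B).erase j := by
  simp only [pairIndex, Finset.mem_filter, Finset.mem_product, Finset.mem_powerset]
  constructor
  · rintro ⟨⟨-, hA, hB, -⟩, h⟩
    exact ⟨hA, hB, h⟩
  · rintro ⟨hA, hB, h1, h2, h3⟩
    refine ⟨⟨h𝒦 A hA h1, hA, hB, fun k hk => h𝒦 A hA ?_⟩, h1, h2, h3⟩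
    exact (Finset.mem_inter.1 (Finset.mem_of_mem_erase (h3 hk))).1

/-- Pairs of disjoint members of `𝒦` whose union is also that of another pair of members. -/
def IsSharpPair (𝒦 : Finset (Finset ℕ)) (p : Finset ℕ × Finset ℕ) : Prop :=
  Disjoint p.1 p.2 ∧ ∃ C ∈ 𝒦, ∃ D ∈ 𝒦, C ∪ D = p.1 ∪ p.2 ∧ C ≠ p.1 ∧ C ≠ p.2

open Classical in
/-- The sum of `c_A² c_B²` over the sharp pairs. -/
noncomputable def sharpSum (𝒦 : Finset (Finset ℕ)) (c : Finset ℕ → ℝ) : ℝ :=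
  ∑ p ∈ 𝒦 ×ˢ 𝒦 with IsSharpPair 𝒦 p, c p.1 ^ 2 * c p.2 ^ 2

lemma keySupport_subset {U : Finset ℕ} {𝒦 : Finset (Finset ℕ)} (h𝒦 : ∀ A ∈ 𝒦, A ⊆ U)
    {j : ℕ} {A B T : Finset ℕ} (h : (j, A, B, T) ∈ pairIndex U 𝒦) :
    keySupport (pairKey (j, A, B, T)) ⊆ A ∪ B := by
  obtain ⟨-, -, -, -, hT⟩ := (mem_pairIndex h𝒦).1 h
  intro k hk
  simp only [keySupport, pairKey, Finset.mem_union, Finset.mem_sdiff] at hk ⊢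
  rcases hk with (hk | hk) | hk
  · exact Or.inl hk.1
  · exact Or.inr hk.1
  · exact Or.inl (Finset.mem_inter.1 (Finset.mem_of_mem_erase (hT hk))).1

lemma card_keySupport_le {U : Finset ℕ} {𝒦 : Finset (Finset ℕ)} (h𝒦 : ∀ A ∈ 𝒦, A ⊆ U) {q : ℕ}
    (hq : ∀ A ∈ 𝒦, A.card = q) {x : Finset ℕ × Finset ℕ × Finset ℕ}
    (hx : x ∈ (properIndex U 𝒦).image pairKey) : (keySupport x).card ≤ 2 * q := by
  obtain ⟨⟨j, A, B, T⟩, hi, rfl⟩ := Finset.mem_image.1 hx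
  have hi' := (Finset.mem_filter.1 hi).1
  obtain ⟨hA, hB, -⟩ := (mem_pairIndex h𝒦).1 hi'
  calc _ ≤ (A ∪ B).card := Finset.card_le_card (keySupport_subset h𝒦 hi')
    _ ≤ A.card + B.card := Finset.card_union_le _ _
    _ = 2 * q := by rw [hq A hA, hq B hB]; ring

/-- A key with support W is a triple of subsets of W, and there are at most (2^{2q})³ = 64^q of
these. -/
lemma card_same_support_le (J : Finset (Finset ℕ × Finset ℕ × Finset ℕ))
    {x : Finset ℕ × Finset ℕ × Finset ℕ} {q : ℕ} (hx : (keySupport x).card ≤ 2 * q) :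
    (J.filter fun y => keySupport x = keySupport y).card ≤ 64 ^ q := by
  set W := keySupport x
  have hsub : (J.filter fun y => W = keySupport y)
      ⊆ W.powerset ×ˢ W.powerset ×ˢ W.powerset := by
    intro y hy
    have hy := (Finset.mem_filter.1 hy).2
    simp only [Finset.mem_product, Finset.mem_powerset]
    rw [hy, keySupport]
    exact ⟨Finset.subset_union_left.trans Finset.subset_union_left,
      Finset.subset_union_right.trans Finset.subset_union_left, Finset.subset_union_right⟩
  refine (Finset.card_le_card hsub).trans ?_
  simp only [Finset.card_product, Finset.card_powerset]
  calc 2 ^ W.card * (2 ^ W.card * 2 ^ W.card) = (2 ^ W.card) ^ 3 := by ring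
    _ ≤ (2 ^ (2 * q)) ^ 3 := by gcongr; norm_num
    _ = 64 ^ q := by rw [← pow_mul, mul_assoc, mul_comm q 3, ← mul_assoc, pow_mul]; norm_num

lemma eq_of_sdiff_eq {A B C : Finset ℕ} (h1 : A \ C = B \ C) (h2 : C \ A = C \ B) : A = B := by
  ext k
  have h1 := Finset.ext_iff.1 h1 k
  have h2 := Finset.ext_iff.1 h2 k
  simp only [Finset.mem_sdiff] at h1 h2
  tauto

/-- The data `((A, B'), (j, j', A \ B, B \ A, T))` of a pair of indices. -/
def pairCode (p : (ℕ × Finset ℕ × Finset ℕ × Finset ℕ) × (ℕ × Finset ℕ × Finset ℕ × Finset ℕ)) :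
    ℕ × ℕ × Finset ℕ × Finset ℕ × Finset ℕ :=
  (p.1.1, p.2.1, p.1.2.1 \ p.1.2.2.1, p.1.2.2.1 \ p.1.2.1, p.1.2.2.2)

-- A pair of indices (j, A, B, T), (j', A', B', T') with equal keys is charged to the pair (A, B'),
-- whose squared coefficients are the product of the four coefficients by `hprod`. Equal keys force
-- A ∪ B' = A' ∪ B, so a disjoint (A, B') is sharp with witnesses A' and B. Each (A, B') is charged
-- a bounded number of times.
open Classical in
lemma sum_same_key_le {U : Finset ℕ} {𝒦 : Finset (Finset ℕ)} (h𝒦 : ∀ A ∈ 𝒦, A ⊆ U) {q : ℕ}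
    (hq : ∀ A ∈ 𝒦, A.card = q) {c : Finset ℕ → ℝ}
    (hprod : ∀ A ∈ 𝒦, ∀ B ∈ 𝒦, ∀ A' ∈ 𝒦, ∀ B' ∈ 𝒦, A \ B = A' \ B' → B \ A = B' \ A' →
      |c A * c B| * |c A' * c B'| = c A ^ 2 * c B' ^ 2) :
    ∑ i ∈ properIndex U 𝒦, ∑ i' ∈ properIndex U 𝒦,
      (|c i.2.1 * c i.2.2.1| * |c i'.2.1 * c i'.2.2.1|) * (if pairKey i = pairKey i' then 1 else 0)
      ≤ (q ^ 2 * 8 ^ q) * (sharpSum 𝒦 c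
        + ∑ p ∈ 𝒦 ×ˢ 𝒦 with ¬ Disjoint p.1 p.2, c p.1 ^ 2 * c p.2 ^ 2) := by
  set I := properIndex U 𝒦
  set Q := (I ×ˢ I).filter fun p => pairKey p.1 = pairKey p.2
  set good := (𝒦 ×ˢ 𝒦).filter fun p => IsSharpPair 𝒦 p ∨ ¬ Disjoint p.1 p.2
  have hmaps : ∀ p ∈ Q, (p.1.2.1, p.2.2.2.1) ∈ good := by
    rintro ⟨⟨j, A, B, T⟩, ⟨j', A', B', T'⟩⟩ hp
    simp only [Q, Finset.mem_filter, Finset.mem_product] at hp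
    obtain ⟨⟨hi, hi'⟩, hkey⟩ := hp
    obtain ⟨hi, hne⟩ := Finset.mem_filter.1 hi
    obtain ⟨hi', -⟩ := Finset.mem_filter.1 hi'
    obtain ⟨hA, hB, hjA, hjB, hT⟩ := (mem_pairIndex h𝒦).1 hi
    obtain ⟨hA', hB', hjA', hjB', hT'⟩ := (mem_pairIndex h𝒦).1 hi'
    simp only [pairKey, Prod.mk.injEq] at hkey
    obtain ⟨h1, h2, rfl⟩ := hkey
    have h1 := Finset.ext_iff.1 h1
    have h2 := Finset.ext_iff.1 h2
    simp only [Finset.mem_sdiff] at h1 h2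
    simp only [good, Finset.mem_filter, Finset.mem_product]
    refine ⟨⟨hA, hB'⟩, ?_⟩
    by_cases hd : Disjoint A B'
    · refine Or.inl ⟨hd, A', hA', B, hB, ?_, ?_, ?_⟩
      · ext k
        simp only [Finset.mem_union]
        have := h1 k
        have := h2 k
        tauto
      -- If A' = A, then j, lying in both A and B, is outside A \ B = A \ B' and hence lies in B',
      -- against disjointness.
      · rintro rfl
        have := h1 j
        have hj' : j ∈ B' := by tauto
        exact Finset.disjoint_left.1 hd hjA hj'
      -- If A' = B', both differences are empty, and T, being contained in A and in B', is empty
      -- too; the empty key has been excluded.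
      · rintro rfl
        apply hne
        simp only [pairKey, Prod.mk.injEq]
        refine ⟨?_, ?_, ?_⟩
        · ext k
          have := h1 k
          simp only [Finset.mem_sdiff, Finset.notMem_empty]
          tauto
        · ext k
          have := h2 k
          simp only [Finset.mem_sdiff, Finset.notMem_empty]
          tauto
        · refine Finset.eq_empty_of_forall_notMem fun k hk => ?_
          have a1 := (Finset.mem_inter.1 (Finset.mem_of_mem_erase (hT hk))).1
          have a2 := (Finset.mem_inter.1 (Finset.mem_of_mem_erase (hT' hk))).2
          exact Finset.disjoint_left.1 hd a1 a2
    · exact Or.inr hd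
  have hfiber : ∀ x ∈ good,
      (Q.filter fun p => (p.1.2.1, p.2.2.2.1) = x).card ≤ q ^ 2 * 8 ^ q := by
    rintro ⟨A, B'⟩ hx
    obtain ⟨hA, hB'⟩ := Finset.mem_product.1 (Finset.mem_filter.1 hx).1
    -- Given A and B', the code (j, j', A \ B, B \ A, T) determines everything: B is recovered from
    -- A, and A' from B', through the two differences. Its entries range over A, B', and subsets of
    -- A, B' and A; the inclusion B \ A ⊆ B' comes from B \ A = B' \ A'.
    have hcard : (A ×ˢ B' ×ˢ A.powerset ×ˢ B'.powerset ×ˢ A.powerset).card = q ^ 2 * 8 ^ q := by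
      simp only [Finset.card_product, Finset.card_powerset, hq A hA, hq B' hB']
      rw [show (8 : ℕ) = 2 ^ 3 by norm_num, ← pow_mul]
      ring
    rw [← hcard]
    refine Finset.card_le_card_of_injOn pairCode ?_ ?_
    · rintro ⟨⟨j, A, B, T⟩, ⟨j', A', B', T'⟩⟩ hp
      simp only [Q, Finset.coe_filter, Finset.mem_filter, Finset.mem_product, Set.mem_ofPred_eq,
        Prod.mk.injEq] at hp
      obtain ⟨⟨⟨hi, hi'⟩, hkey⟩, rfl, rfl⟩ := hp
      obtain ⟨-, -, hjA, -, hT⟩ := (mem_pairIndex h𝒦).1 (Finset.mem_filter.1 hi).1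
      obtain ⟨-, -, -, hjB', -⟩ := (mem_pairIndex h𝒦).1 (Finset.mem_filter.1 hi').1
      simp only [pairKey, Prod.mk.injEq] at hkey
      simp only [pairCode, Finset.coe_product, Set.mem_prod, Finset.mem_coe, Finset.mem_powerset]
      refine ⟨hjA, hjB', Finset.sdiff_subset, ?_, fun k hk => ?_⟩
      · rw [hkey.2.1]; exact Finset.sdiff_subset
      · exact (Finset.mem_inter.1 (Finset.mem_of_mem_erase (hT hk))).1
    · rintro ⟨⟨j, A₁, B₁, T⟩, ⟨j', A₁', B₁', T'⟩⟩ hp ⟨⟨l, A₂, B₂, R⟩, ⟨l', A₂', B₂', R'⟩⟩ hp₂ heq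
      simp only [Q, Finset.coe_filter, Finset.mem_filter, Finset.mem_product, Set.mem_ofPred_eq,
        Prod.mk.injEq, pairKey] at hp hp₂
      obtain ⟨⟨-, a1, a2, a3⟩, rfl, rfl⟩ := hp
      obtain ⟨⟨-, b1, b2, b3⟩, rfl, rfl⟩ := hp₂
      simp only [pairCode, Prod.mk.injEq] at heq
      obtain ⟨rfl, rfl, c1, c2, rfl⟩ := heq
      obtain rfl := eq_of_sdiff_eq c2 c1
      obtain rfl := eq_of_sdiff_eq (a1.symm.trans b1) (a2.symm.trans b2)
      rw [a3] at b3
      rw [b3]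
  have hnn : ∀ x : Finset ℕ × Finset ℕ, 0 ≤ c x.1 ^ 2 * c x.2 ^ 2 := fun x => by positivity
  calc _ = ∑ p ∈ Q, |c p.1.2.1 * c p.1.2.2.1| * |c p.2.2.1 * c p.2.2.2.1| := by
        rw [← Finset.sum_product', Finset.sum_filter]
        exact Finset.sum_congr rfl fun p _ => by rw [mul_ite, mul_one, mul_zero]
    _ = ∑ p ∈ Q, c p.1.2.1 ^ 2 * c p.2.2.2.1 ^ 2 := by
        refine Finset.sum_congr rfl ?_
        rintro ⟨⟨j, A, B, T⟩, ⟨j', A', B', T'⟩⟩ hp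
        simp only [Q, Finset.mem_filter, Finset.mem_product] at hp
        obtain ⟨⟨hi, hi'⟩, hkey⟩ := hp
        obtain ⟨hA, hB, -⟩ := (mem_pairIndex h𝒦).1 (Finset.mem_filter.1 hi).1
        obtain ⟨hA', hB', -⟩ := (mem_pairIndex h𝒦).1 (Finset.mem_filter.1 hi').1
        simp only [pairKey, Prod.mk.injEq] at hkey
        exact hprod A hA B hB A' hA' B' hB' hkey.1 hkey.2.1
    _ = ∑ x ∈ good, ∑ p ∈ Q with (p.1.2.1, p.2.2.2.1) = x, c p.1.2.1 ^ 2 * c p.2.2.2.1 ^ 2 :=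
        (Finset.sum_fiberwise_of_maps_to hmaps _).symm
    _ ≤ ∑ x ∈ good, (q ^ 2 * 8 ^ q) * (c x.1 ^ 2 * c x.2 ^ 2) := by
        refine Finset.sum_le_sum fun x hx => ?_
        have e : ∀ p ∈ Q.filter (fun p => (p.1.2.1, p.2.2.2.1) = x),
            c p.1.2.1 ^ 2 * c p.2.2.2.1 ^ 2 = c x.1 ^ 2 * c x.2 ^ 2 := fun p hp => by
          rw [← (Finset.mem_filter.1 hp).2]
        rw [Finset.sum_congr rfl e, Finset.sum_const, nsmul_eq_mul]
        exact mul_le_mul_of_nonneg_right (by exact_mod_cast hfiber x hx) (hnn x)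
    _ ≤ _ := by
        rw [← Finset.mul_sum]
        refine mul_le_mul_of_nonneg_left ?_ (by positivity)
        rw [sharpSum]
        simp only [good, Finset.filter_or]
        refine (Finset.sum_union_inter (f := fun x : Finset ℕ × Finset ℕ =>
          c x.1 ^ 2 * c x.2 ^ 2)).symm ▸ ?_
        exact le_add_of_nonneg_right (Finset.sum_nonneg fun x _ => hnn x)

/-- Union bound over the common element: for fixed A, the sets B meeting A are covered by those
containing one of the q elements j of A, and each j contributes at most its influence. -/
lemma sum_not_disjoint_le {U : Finset ℕ} {𝒦 : Finset (Finset ℕ)} (h𝒦 : ∀ A ∈ 𝒦, A ⊆ U) {q : ℕ}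
    (hq : ∀ A ∈ 𝒦, A.card = q) {c : Finset ℕ → ℝ} {τ : ℝ}
    (hinf : ∀ j ∈ U, influence U c j ≤ τ) :
    ∑ p ∈ 𝒦 ×ˢ 𝒦 with ¬ Disjoint p.1 p.2, c p.1 ^ 2 * c p.2 ^ 2
      ≤ q * τ * ∑ A ∈ 𝒦, c A ^ 2 := by
  rw [Finset.sum_filter, Finset.sum_product, Finset.mul_sum]
  refine Finset.sum_le_sum fun A hA => ?_
  simp only
  calc ∑ B ∈ 𝒦, (if ¬ Disjoint A B then c A ^ 2 * c B ^ 2 else 0)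
      ≤ ∑ B ∈ 𝒦, ∑ j ∈ A, (if j ∈ B then c A ^ 2 * c B ^ 2 else 0) := by
        refine Finset.sum_le_sum fun B _ => ?_
        have hn : ∀ j ∈ A, 0 ≤ (if j ∈ B then c A ^ 2 * c B ^ 2 else 0) := fun j _ => by
          split_ifs <;> positivity
        split_ifs with hd
        · exact Finset.sum_nonneg hn
        · obtain ⟨j, hjA, hjB⟩ := Finset.not_disjoint_iff.1 hd
          have := Finset.single_le_sum hn hjA
          rwa [if_pos hjB] at this
    _ = ∑ j ∈ A, c A ^ 2 * ∑ B ∈ 𝒦 with j ∈ B, c B ^ 2 := by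
        rw [Finset.sum_comm]
        refine Finset.sum_congr rfl fun j _ => ?_
        rw [Finset.mul_sum, Finset.sum_filter]
    _ ≤ ∑ j ∈ A, c A ^ 2 * τ := by
        refine Finset.sum_le_sum fun j hj => mul_le_mul_of_nonneg_left ?_ (sq_nonneg _)
        refine le_trans ?_ (hinf j (h𝒦 A hA hj))
        refine Finset.sum_le_sum_of_subset_of_nonneg (fun B hB => ?_) fun _ _ _ => sq_nonneg _
        obtain ⟨hB, hjB⟩ := Finset.mem_filter.1 hB
        exact Finset.mem_filter.2 ⟨Finset.mem_powerset.2 (h𝒦 B hB), hjB⟩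
    _ = q * τ * c A ^ 2 := by
        rw [Finset.sum_const, nsmul_eq_mul, hq A hA]; ring

end CombCLT

namespace CombCLT

variable {Ω : Type*} [MeasurableSpace Ω]

/-! ### The variance of the sum of the squares of the partial derivatives -/

/-- The centered monomial attached to a key. -/
noncomputable def keyMonomial (X : ℕ → Ω → ℝ) (x : Finset ℕ × Finset ℕ × Finset ℕ) (ω : Ω) : ℝ :=
  (∏ k ∈ x.1, X k ω) * (∏ k ∈ x.2.1, X k ω) * ∏ k ∈ x.2.2, (X k ω ^ 2 - 1)

/-- The factor of `keyMonomial` in the `k`-th variable. -/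
def keyFactor (x : Finset ℕ × Finset ℕ × Finset ℕ) (k : ℕ) (t : ℝ) : ℝ :=
  (if k ∈ x.1 then t else 1) * (if k ∈ x.2.1 then t else 1) * (if k ∈ x.2.2 then t ^ 2 - 1 else 1)

/-- The three sets of the key are pairwise disjoint. -/
structure IsDisjointKey (x : Finset ℕ × Finset ℕ × Finset ℕ) : Prop where
  disj₁₂ : Disjoint x.1 x.2.1
  disj₁₃ : Disjoint x.1 x.2.2
  disj₂₃ : Disjoint x.2.1 x.2.2

lemma keyMonomial_eq_prod (X : ℕ → Ω → ℝ) {x : Finset ℕ × Finset ℕ × Finset ℕ} {U : Finset ℕ}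
    (hx : keySupport x ⊆ U) (ω : Ω) :
    keyMonomial X x ω = ∏ k ∈ U, keyFactor x k (X k ω) := by
  have h1 : x.1 ⊆ U := (Finset.subset_union_left.trans Finset.subset_union_left).trans hx
  have h2 : x.2.1 ⊆ U := (Finset.subset_union_right.trans Finset.subset_union_left).trans hx
  have h3 : x.2.2 ⊆ U := Finset.subset_union_right.trans hx
  simp only [keyFactor, Finset.prod_mul_distrib, Finset.prod_ite_mem,
    Finset.inter_eq_right.2 h1, Finset.inter_eq_right.2 h2, Finset.inter_eq_right.2 h3,
    keyMonomial]

lemma measurable_keyFactor (x : Finset ℕ × Finset ℕ × Finset ℕ) (k : ℕ) :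
    Measurable (keyFactor x k) := by
  unfold keyFactor
  split_ifs <;> fun_prop

lemma IsDisjointKey.keyFactor_cases {x : Finset ℕ × Finset ℕ × Finset ℕ} (hx : IsDisjointKey x)
    (k : ℕ) :
    (k ∉ keySupport x ∧ keyFactor x k = fun _ => 1) ∨
      (k ∈ keySupport x ∧ keyFactor x k = fun t => t) ∨
      (k ∈ keySupport x ∧ keyFactor x k = fun t => t ^ 2 - 1) := by
  have h12 : k ∈ x.1 → k ∉ x.2.1 := fun h => Finset.disjoint_left.1 hx.disj₁₂ h
  have h13 : k ∈ x.1 → k ∉ x.2.2 := fun h => Finset.disjoint_left.1 hx.disj₁₃ h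
  have h23 : k ∈ x.2.1 → k ∉ x.2.2 := fun h => Finset.disjoint_left.1 hx.disj₂₃ h
  simp only [keySupport, Finset.mem_union]
  by_cases a1 : k ∈ x.1
  · have a2 := h12 a1
    have a3 := h13 a1
    right; left
    refine ⟨by tauto, ?_⟩
    funext t
    simp [keyFactor, a1, a2, a3]
  · by_cases a2 : k ∈ x.2.1
    · have a3 := h23 a2
      right; left
      refine ⟨by tauto, ?_⟩
      funext t
      simp [keyFactor, a1, a2, a3]
    · by_cases a3 : k ∈ x.2.2
      · right; right
        refine ⟨by tauto, ?_⟩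
        funext t
        simp [keyFactor, a1, a2, a3]
      · left
        refine ⟨by tauto, ?_⟩
        funext t
        simp [keyFactor, a1, a2, a3]

lemma isDisjointKey_pairKey {U : Finset ℕ} {𝒦 : Finset (Finset ℕ)} (h𝒦 : ∀ A ∈ 𝒦, A ⊆ U)
    {i : ℕ × Finset ℕ × Finset ℕ × Finset ℕ} (hi : i ∈ pairIndex U 𝒦) :
    IsDisjointKey (pairKey i) := by
  obtain ⟨j, A, B, T⟩ := i
  obtain ⟨-, -, -, -, hT⟩ := (mem_pairIndex h𝒦).1 hi
  have hT' : T ⊆ A ∩ B := hT.trans (Finset.erase_subset _ _)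
  refine ⟨?_, ?_, ?_⟩
  · exact Finset.disjoint_left.2 fun k h h' =>
      (Finset.mem_sdiff.1 h).2 (Finset.mem_sdiff.1 h').1
  · exact Finset.disjoint_left.2 fun k h h' =>
      (Finset.mem_sdiff.1 h).2 (Finset.mem_inter.1 (hT' h')).2
  · exact Finset.disjoint_left.2 fun k h h' =>
      (Finset.mem_sdiff.1 h).2 (Finset.mem_inter.1 (hT' h')).1

lemma sum_pairIndex {U : Finset ℕ} {𝒦 : Finset (Finset ℕ)} (h𝒦 : ∀ A ∈ 𝒦, A ⊆ U)
    (f : ℕ × Finset ℕ × Finset ℕ × Finset ℕ → ℝ) :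
    ∑ i ∈ pairIndex U 𝒦, f i = ∑ j ∈ U, ∑ A ∈ 𝒦 with j ∈ A, ∑ B ∈ 𝒦 with j ∈ B,
      ∑ T ∈ ((A ∩ B).erase j).powerset, f (j, A, B, T) := by
  rw [pairIndex, Finset.sum_filter, Finset.sum_product]
  refine Finset.sum_congr rfl fun j _ => ?_
  rw [Finset.sum_product, Finset.sum_filter]
  refine Finset.sum_congr rfl fun A hA => ?_
  rw [Finset.sum_product]
  by_cases hjA : j ∈ A
  · rw [if_pos hjA, Finset.sum_filter]
    refine Finset.sum_congr rfl fun B hB => ?_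
    by_cases hjB : j ∈ B
    · rw [if_pos hjB, ← Finset.sum_filter]
      refine Finset.sum_congr ?_ fun _ _ => rfl
      ext T
      simp only [Finset.mem_filter, Finset.mem_powerset, hjA, hjB, true_and, and_iff_right_iff_imp]
      exact fun hT => hT.trans ((Finset.erase_subset _ _).trans
        (Finset.inter_subset_left.trans (h𝒦 A hA)))
    · simp [hjB]
  · simp [hjA]

/-- Variables in the symmetric difference occur once; each common variable other than j occurs
squared, as 1 + (X_k² - 1). Multiplying out, T records where the centered summand is chosen. -/
lemma prod_erase_mul_prod_erase (X : ℕ → Ω → ℝ) {A B : Finset ℕ} {j : ℕ} (hA : j ∈ A) (hB : j ∈ B)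
    (ω : Ω) :
    (∏ k ∈ A.erase j, X k ω) * ∏ k ∈ B.erase j, X k ω
      = ∑ T ∈ ((A ∩ B).erase j).powerset, keyMonomial X (A \ B, B \ A, T) ω := by
  have split : ∀ A B : Finset ℕ, j ∈ A → j ∈ B → ∏ k ∈ A.erase j, X k ω
      = (∏ k ∈ A \ B, X k ω) * ∏ k ∈ (A ∩ B).erase j, X k ω := fun A B _ hB => by
    rw [← Finset.prod_union]
    · congr 1
      ext k
      simp only [Finset.mem_erase, Finset.mem_union, Finset.mem_sdiff, Finset.mem_inter]
      by_cases hk : k = j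
      · subst hk; tauto
      · tauto
    · refine Finset.disjoint_left.2 fun k h h' => (Finset.mem_sdiff.1 h).2 ?_
      exact (Finset.mem_inter.1 (Finset.mem_of_mem_erase h')).2
  rw [split A B hA hB, split B A hB hA, Finset.inter_comm B A]
  simp only [keyMonomial]
  rw [← Finset.mul_sum, ← Finset.prod_one_add]
  have : ∀ k, 1 + (X k ω ^ 2 - 1) = X k ω * X k ω := fun k => by ring
  simp only [this, Finset.prod_mul_distrib]
  ring

/-- The index sets with nonzero coefficients. -/
noncomputable def coeffSupport (U : Finset ℕ) (c : Finset ℕ → ℝ) : Finset (Finset ℕ) :=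
  U.powerset.filter fun A => c A ≠ 0

lemma subset_of_mem_coeffSupport {U : Finset ℕ} {c : Finset ℕ → ℝ} :
    ∀ A ∈ coeffSupport U c, A ⊆ U :=
  fun _ hA => Finset.mem_powerset.1 (Finset.mem_filter.1 hA).1

lemma mderiv_eq_sum_coeffSupport (X : ℕ → Ω → ℝ) {U : Finset ℕ} (c : Finset ℕ → ℝ) {j : ℕ}
    (hj : j ∈ U) (ω : Ω) :
    mderiv X U c j ω
      = ∑ A ∈ coeffSupport U c with j ∈ A, c A * ∏ k ∈ A.erase j, X k ω := by
  have h1 : mderiv X U c j ω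
      = ∑ A ∈ U.powerset with j ∈ A, c A * ∏ k ∈ A.erase j, X k ω := by
    rw [← sum_powerset_erase_insert hj fun A => c A * ∏ k ∈ A.erase j, X k ω, mderiv, mpoly]
    refine Finset.sum_congr rfl fun A hA => ?_
    rw [Finset.erase_insert fun h => Finset.notMem_erase j U (Finset.mem_powerset.1 hA h)]
  rw [h1, coeffSupport, Finset.filter_filter]
  symm
  refine Finset.sum_subset (fun A hA => ?_) fun A hA hA' => ?_
  · simp only [Finset.mem_filter] at hA ⊢
    exact ⟨hA.1, hA.2.2⟩
  · simp only [Finset.mem_filter, not_and] at hA hA'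
    by_cases h : c A = 0
    · rw [h, zero_mul]
    · exact absurd hA.2 (hA' hA.1 h)

lemma sum_mderiv_sq_eq (X : ℕ → Ω → ℝ) (U : Finset ℕ) (c : Finset ℕ → ℝ) (ω : Ω) :
    ∑ j ∈ U, mderiv X U c j ω ^ 2
      = ∑ i ∈ pairIndex U (coeffSupport U c), c i.2.1 * c i.2.2.1 * keyMonomial X (pairKey i) ω := by
  rw [sum_pairIndex subset_of_mem_coeffSupport]
  refine Finset.sum_congr rfl fun j hj => ?_
  rw [mderiv_eq_sum_coeffSupport X c hj, sq, Finset.sum_mul_sum]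
  refine Finset.sum_congr rfl fun A hA => Finset.sum_congr rfl fun B hB => ?_
  simp only [pairKey]
  rw [← Finset.mul_sum, ← prod_erase_mul_prod_erase X (Finset.mem_filter.1 hA).2
    (Finset.mem_filter.1 hB).2]
  ring

/-! ### Orthogonality of the centered monomials and the variance bound. -/

namespace IsStdIndep

variable {P : Measure Ω} [IsProbabilityMeasure P] {X : ℕ → Ω → ℝ} {M : ℝ}

/-- Each nontrivial factor, X_k or X_k² - 1, is centered, so a variable seen by one key only
contributes 0. If both keys see it, the moment is E X² = 1, E X³ or E X⁴ - 1, all at most M in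
absolute value. -/
lemma integral_keyFactor_mul (hX : IsStdIndep P X M) {x y : Finset ℕ × Finset ℕ × Finset ℕ}
    (hx : IsDisjointKey x) (hy : IsDisjointKey y) (k : ℕ) :
    Integrable (fun ω => keyFactor x k (X k ω) * keyFactor y k (X k ω)) P ∧
    |∫ ω, keyFactor x k (X k ω) * keyFactor y k (X k ω) ∂P|
      ≤ if k ∈ keySupport x then (if k ∈ keySupport y then M else 0)
        else (if k ∈ keySupport y then 0 else 1) := by
  have hM := hX.one_le
  have iX : Integrable (X k) P := by simpa using hX.integrable_pow k (n := 1) (by norm_num)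
  have iX2 := hX.integrable_pow k (n := 2) (by norm_num)
  have iX3 := hX.integrable_pow k (n := 3) (by norm_num)
  have iX4 := hX.int4 k
  have iY : Integrable (fun ω => X k ω ^ 2 - 1) P := iX2.sub (integrable_const 1)
  have eY : ∫ ω, (X k ω ^ 2 - 1) ∂P = 0 := by
    rw [integral_sub iX2 (integrable_const 1), hX.var]; simp
  have iXY : Integrable (fun ω => X k ω ^ 3 - X k ω) P := iX3.sub iX
  have eXY : |∫ ω, (X k ω ^ 3 - X k ω) ∂P| ≤ M := by
    rw [integral_sub iX3 iX, hX.mean, sub_zero]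
    refine abs_integral_le_integral_abs.trans ?_
    simpa only [abs_pow] using hX.integral_abs_cube_le k
  have iYY' : Integrable (fun ω => X k ω ^ 4 - 2 * X k ω ^ 2) P := iX4.sub (iX2.const_mul 2)
  have iYY : Integrable (fun ω => X k ω ^ 4 - 2 * X k ω ^ 2 + 1) P := iYY'.add (integrable_const 1)
  have eYY : |∫ ω, (X k ω ^ 4 - 2 * X k ω ^ 2 + 1) ∂P| ≤ M := by
    have h0 : 0 ≤ ∫ ω, (X k ω ^ 4 - 2 * X k ω ^ 2 + 1) ∂P := integral_nonneg fun ω => by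
      have : X k ω ^ 4 - 2 * X k ω ^ 2 + 1 = (X k ω ^ 2 - 1) ^ 2 := by ring
      simp only [this]
      positivity
    rw [abs_of_nonneg h0, integral_add iYY' (integrable_const 1), integral_sub iX4 (iX2.const_mul 2),
      integral_const_mul, hX.var]
    have := hX.fourth k
    simp
    linarith
  have r1 : ∀ t : ℝ, t * (t ^ 2 - 1) = t ^ 3 - t := fun t => by ring
  have r2 : ∀ t : ℝ, (t ^ 2 - 1) * t = t ^ 3 - t := fun t => by ring
  have r3 : ∀ t : ℝ, (t ^ 2 - 1) ^ 2 = t ^ 4 - 2 * t ^ 2 + 1 := fun t => by ring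
  rcases hx.keyFactor_cases k with ⟨h1, e1⟩ | ⟨h1, e1⟩ | ⟨h1, e1⟩ <;>
  rcases hy.keyFactor_cases k with ⟨h2, e2⟩ | ⟨h2, e2⟩ | ⟨h2, e2⟩ <;>
  simp only [e1, e2, h1, h2, if_true, if_false, one_mul, mul_one, r1, r2, ← sq, hX.mean,
    hX.var, eY, abs_zero, le_refl, and_true]
  · simp
  · exact iX
  · exact iY
  · exact iX
  · exact ⟨iX2, by simpa using hM⟩
  · exact ⟨iXY, eXY⟩
  · exact iY
  · exact ⟨iXY, eXY⟩
  · simp only [r3]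
    exact ⟨iYY, eYY⟩

lemma integral_keyMonomial_mul (hX : IsStdIndep P X M) {x y : Finset ℕ × Finset ℕ × Finset ℕ}
    (hx : IsDisjointKey x) (hy : IsDisjointKey y) :
    Integrable (fun ω => keyMonomial X x ω * keyMonomial X y ω) P ∧
    |∫ ω, keyMonomial X x ω * keyMonomial X y ω ∂P|
      ≤ M ^ (keySupport x).card * (if keySupport x = keySupport y then 1 else 0) := by
  set U := keySupport x ∪ keySupport y
  have e : ∀ ω, keyMonomial X x ω * keyMonomial X y ω
      = ∏ k ∈ U, (keyFactor x k (X k ω) * keyFactor y k (X k ω)) := fun ω => by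
    rw [keyMonomial_eq_prod X Finset.subset_union_left,
      keyMonomial_eq_prod X Finset.subset_union_right, Finset.prod_mul_distrib]
  simp only [e]
  have h := hX.integrable_prod_comp U (g := fun k t => keyFactor x k t * keyFactor y k t)
    (fun k => (measurable_keyFactor x k).mul (measurable_keyFactor y k))
    fun k => (hX.integral_keyFactor_mul hx hy k).1
  refine ⟨h.1, ?_⟩
  rw [h.2, Finset.abs_prod]
  have hb := fun k => (hX.integral_keyFactor_mul hx hy k).2
  split_ifs with hW
  · rw [mul_one, ← Finset.prod_const]
    have hU : U = keySupport x := by simp only [U, ← hW, Finset.union_self]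
    rw [hU]
    refine Finset.prod_le_prod (fun k _ => abs_nonneg _) fun k hk => (hb k).trans ?_
    rw [if_pos hk, if_pos (hW ▸ hk)]
  · rw [mul_zero]
    have : ∃ k ∈ U, ¬ (k ∈ keySupport x ↔ k ∈ keySupport y) := by
      by_contra hcon
      push Not at hcon
      refine hW (Finset.ext fun k => ?_)
      by_cases hk : k ∈ U
      · exact hcon k hk
      · simp only [U, Finset.mem_union, not_or] at hk
        tauto
    obtain ⟨k, hk, hne⟩ := this
    refine (Finset.prod_eq_zero hk ?_).le
    refine le_antisymm ((hb k).trans ?_) (abs_nonneg _)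
    by_cases h1 : k ∈ keySupport x <;> by_cases h2 : k ∈ keySupport y <;>
      simp only [h1, h2, if_true, if_false, le_refl, iff_self, not_true_eq_false] at hne ⊢

/-- The indices with empty key contribute a constant. It is identified without counting, by
computing the expectation of ∑ D_j² twice: monomials with nonempty key have mean 0, and E D_j² is
the influence of j, with total q ∑ c_A². -/
lemma sum_mderiv_sq_sub_eq (hX : IsStdIndep P X M) {U : Finset ℕ} {c : Finset ℕ → ℝ} {q : ℕ}
    (hc : ∀ A ⊆ U, c A ≠ 0 → A.card = q) (ω : Ω) :
    ∑ j ∈ U, mderiv X U c j ω ^ 2 - q * ∑ A ∈ U.powerset, c A ^ 2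
      = ∑ i ∈ properIndex U (coeffSupport U c),
        c i.2.1 * c i.2.2.1 * keyMonomial X (pairKey i) ω := by
  classical
  set 𝒦 := coeffSupport U c
  set C₀ := ∑ i ∈ pairIndex U 𝒦 with ¬ pairKey i ≠ (∅, ∅, ∅), c i.2.1 * c i.2.2.1
  have hempty : IsDisjointKey ((∅, ∅, ∅) : Finset ℕ × Finset ℕ × Finset ℕ) := by
    constructor <;> simp
  have h1 : ∀ ω, keyMonomial X (∅, ∅, ∅) ω = 1 := fun ω => by simp [keyMonomial]
  have hsplit : ∀ ω, ∑ j ∈ U, mderiv X U c j ω ^ 2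
      = ∑ i ∈ properIndex U 𝒦, c i.2.1 * c i.2.2.1 * keyMonomial X (pairKey i) ω + C₀ := fun ω => by
    rw [sum_mderiv_sq_eq, ← Finset.sum_filter_add_sum_filter_not _
      (fun i => pairKey i ≠ (∅, ∅, ∅))]
    refine congrArg₂ (· + ·) rfl (Finset.sum_congr rfl fun i hi => ?_)
    rw [not_not.1 (Finset.mem_filter.1 hi).2, h1, mul_one]
  have hz : ∀ i ∈ properIndex U 𝒦, Integrable (fun ω => keyMonomial X (pairKey i) ω) P ∧
      ∫ ω, keyMonomial X (pairKey i) ω ∂P = 0 := fun i hi => by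
    obtain ⟨hi, hne⟩ := Finset.mem_filter.1 hi
    have := hX.integral_keyMonomial_mul (isDisjointKey_pairKey subset_of_mem_coeffSupport hi) hempty
    simp only [h1, mul_one] at this
    refine ⟨this.1, abs_eq_zero.1 (le_antisymm (this.2.trans ?_) (abs_nonneg _))⟩
    rw [if_neg, mul_zero]
    intro h
    apply hne
    simp only [keySupport, Finset.union_empty, Finset.union_eq_empty] at h
    exact Prod.ext h.1.1 (Prod.ext h.1.2 h.2)
  have hint : ∫ ω, ∑ j ∈ U, mderiv X U c j ω ^ 2 ∂P = C₀ := by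
    simp only [hsplit]
    rw [integral_add (integrable_finsetSum _ fun i hi => (hz i hi).1.const_mul _)
      (integrable_const _), integral_finsetSum _ fun i hi => (hz i hi).1.const_mul _]
    rw [Finset.sum_eq_zero fun i hi => by rw [integral_const_mul, (hz i hi).2, mul_zero]]
    simp
  have hint' : ∫ ω, ∑ j ∈ U, mderiv X U c j ω ^ 2 ∂P = q * ∑ A ∈ U.powerset, c A ^ 2 := by
    rw [integral_finsetSum _ fun j _ => hX.integrable_mderiv_pow U c j (by norm_num),
      ← sum_influence hc]
    exact Finset.sum_congr rfl fun j hj => hX.integral_mderiv_sq c hj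
  rw [hsplit, ← hint', hint]
  ring

/-- Squaring the centered expansion leaves pairs of indices with equal support, each with moment at
most M^{2q}. Passing from equal support to equal key costs 64^q, and from equal keys to pairs of
sets q² 8^q, whence q² 512^q. -/
lemma integral_sum_mderiv_sq_sub_sq_le (hX : IsStdIndep P X M) {U : Finset ℕ} {c : Finset ℕ → ℝ}
    {q : ℕ} (hc : ∀ A ⊆ U, c A ≠ 0 → A.card = q)
    (hprod : ∀ A B A' B', c A ≠ 0 → c B ≠ 0 → c A' ≠ 0 → c B' ≠ 0 →
      A \ B = A' \ B' → B \ A = B' \ A' → |c A * c B| * |c A' * c B'| = c A ^ 2 * c B' ^ 2)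
    {τ : ℝ} (hinf : ∀ j ∈ U, influence U c j ≤ τ) :
    Integrable (fun ω =>
      (∑ j ∈ U, mderiv X U c j ω ^ 2 - q * ∑ A ∈ U.powerset, c A ^ 2) ^ 2) P ∧
    ∫ ω, (∑ j ∈ U, mderiv X U c j ω ^ 2 - q * ∑ A ∈ U.powerset, c A ^ 2) ^ 2 ∂P
      ≤ M ^ (2 * q) * (q ^ 2 * 512 ^ q * (sharpSum (coeffSupport U c) c
        + q * τ * ∑ A ∈ U.powerset, c A ^ 2)) := by
  set 𝒦 := coeffSupport U c with h𝒦def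
  have hM := hX.one_le
  have h𝒦 : ∀ A ∈ 𝒦, A ⊆ U := subset_of_mem_coeffSupport
  have hne : ∀ A ∈ 𝒦, c A ≠ 0 := fun A hA => (Finset.mem_filter.1 hA).2
  have hq : ∀ A ∈ 𝒦, A.card = q := fun A hA => hc A (h𝒦 A hA) (hne A hA)
  set I := properIndex U 𝒦
  have hI : ∀ i ∈ I, IsDisjointKey (pairKey i) := fun i hi =>
    isDisjointKey_pairKey h𝒦 (Finset.mem_filter.1 hi).1
  have e : ∀ ω, (∑ j ∈ U, mderiv X U c j ω ^ 2 - q * ∑ A ∈ U.powerset, c A ^ 2) ^ 2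
      = ∑ i ∈ I, ∑ i' ∈ I, (c i.2.1 * c i.2.2.1) * (c i'.2.1 * c i'.2.2.1)
        * (keyMonomial X (pairKey i) ω * keyMonomial X (pairKey i') ω) := fun ω => by
    rw [hX.sum_mderiv_sq_sub_eq hc, sq, Finset.sum_mul_sum]
    refine Finset.sum_congr rfl fun i _ => Finset.sum_congr rfl fun i' _ => ?_
    ring
  have hint : ∀ i ∈ I, ∀ i' ∈ I, Integrable (fun ω => (c i.2.1 * c i.2.2.1) *
      (c i'.2.1 * c i'.2.2.1) * (keyMonomial X (pairKey i) ω * keyMonomial X (pairKey i') ω)) P :=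
    fun i hi i' hi' => (hX.integral_keyMonomial_mul (hI i hi) (hI i' hi')).1.const_mul _
  simp only [e]
  refine ⟨integrable_finsetSum _ fun i hi => integrable_finsetSum _ fun i' hi' =>
    hint i hi i' hi', ?_⟩
  rw [integral_finsetSum _ fun i hi => integrable_finsetSum _ fun i' hi' => hint i hi i' hi']
  have hcardI : ∀ i ∈ I, (keySupport (pairKey i)).card ≤ 2 * q := fun i hi =>
    card_keySupport_le h𝒦 hq (Finset.mem_image_of_mem _ hi)
  calc _ ≤ ∑ i ∈ I, ∑ i' ∈ I, M ^ (2 * q) * ((|c i.2.1 * c i.2.2.1| * |c i'.2.1 * c i'.2.2.1|)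
        * (if keySupport (pairKey i) = keySupport (pairKey i') then 1 else 0)) := by
        refine Finset.sum_le_sum fun i hi => ?_
        rw [integral_finsetSum _ fun i' hi' => hint i hi i' hi']
        refine Finset.sum_le_sum fun i' hi' => ?_
        rw [integral_const_mul]
        refine (le_abs_self _).trans ?_
        rw [abs_mul, abs_mul]
        calc _ ≤ |c i.2.1 * c i.2.2.1| * |c i'.2.1 * c i'.2.2.1| *
              (M ^ (2 * q) * (if keySupport (pairKey i) = keySupport (pairKey i') then 1 else 0)) := by
              refine mul_le_mul_of_nonneg_left ?_ (by positivity)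
              refine (hX.integral_keyMonomial_mul (hI i hi) (hI i' hi')).2.trans ?_
              refine mul_le_mul_of_nonneg_right (pow_le_pow_right₀ hM (hcardI i hi)) ?_
              split_ifs <;> norm_num
          _ = _ := by ring
    _ = M ^ (2 * q) * ∑ i ∈ I, ∑ i' ∈ I, (|c i.2.1 * c i.2.2.1| * |c i'.2.1 * c i'.2.2.1|)
        * (if keySupport (pairKey i) = keySupport (pairKey i') then 1 else 0) := by
        simp only [Finset.mul_sum]
    _ ≤ M ^ (2 * q) * ((64 ^ q : ℕ) * ((q ^ 2 * 8 ^ q) * (sharpSum 𝒦 c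
        + q * τ * ∑ A ∈ 𝒦, c A ^ 2))) := by
        refine mul_le_mul_of_nonneg_left ?_ (by positivity)
        refine (sum_same_class_le I pairKey keySupport
          (fun i => |c i.2.1 * c i.2.2.1|) (64 ^ q) fun x hx =>
            card_same_support_le _ (card_keySupport_le h𝒦 hq hx)).trans ?_
        refine mul_le_mul_of_nonneg_left ?_ (by positivity)
        refine (sum_same_key_le h𝒦 hq fun A hA B hB A' hA' B' hB' =>
          hprod A B A' B' (hne A hA) (hne B hB) (hne A' hA') (hne B' hB')).trans ?_
        refine mul_le_mul_of_nonneg_left (add_le_add le_rfl ?_) (by positivity)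
        convert sum_not_disjoint_le h𝒦 hq hinf
    _ = _ := by
        have hs : ∑ A ∈ 𝒦, c A ^ 2 = ∑ A ∈ U.powerset, c A ^ 2 := by
          rw [h𝒦def, coeffSupport, Finset.sum_filter_of_ne fun A _ h => ?_]
          intro h0
          rw [h0] at h
          simp at h
        have h512 : (512 : ℝ) ^ q = 64 ^ q * 8 ^ q := by rw [← mul_pow]; norm_num
        rw [hs, h512]
        push_cast
        ring

end IsStdIndep

end CombCLT

namespace CombCLT

variable {Ω : Type*} [MeasurableSpace Ω]

/-! ### The normal approximation bound for finite sums -/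

/-- The constant in the normal approximation bound. -/
noncomputable def cltConst (q : ℕ) : ℝ := 6 * (q ^ 2 * 512 ^ q) + 2 * steinLip * 16 ^ q

lemma cltConst_pos {q : ℕ} (hq : 1 ≤ q) : 0 < cltConst q := by
  have hL := steinLip_nonneg
  have : (0 : ℝ) < q := by exact_mod_cast hq
  rw [cltConst]
  positivity

lemma integral_abs_le_sqrt {P : Measure Ω} [IsProbabilityMeasure P] {Y : Ω → ℝ}
    (hY : Integrable Y P) (hY2 : Integrable (fun ω => Y ω ^ 2) P) :
    ∫ ω, |Y ω| ∂P ≤ √(∫ ω, Y ω ^ 2 ∂P) := by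
  have h := sq_integral_mul_le (P := P) (f := fun ω => |Y ω|) (g := fun _ => 1)
    (by simpa only [sq_abs] using hY2) (integrable_const _) (by simpa using hY.abs)
  simp only [sq_abs, mul_one, one_pow, integral_const, probReal_univ, one_smul] at h
  exact Real.le_sqrt_of_sq_le h

/-- Allowing total variance v ≤ 1 instead of v = 1 lets truncations of an infinite sum be used
without renormalizing; the price 6q(1 - v) comes from comparing ∑ D_j² with q rather than with its
mean q v, and disappears in the limit. -/
lemma IsStdIndep.normal_approx {P : Measure Ω} [IsProbabilityMeasure P] {X : ℕ → Ω → ℝ} {M : ℝ}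
    (hX : IsStdIndep P X M) {h : ℝ → ℝ} (hh : LipschitzWith 1 h) {U : Finset ℕ}
    {c : Finset ℕ → ℝ} {q : ℕ} (hq : 1 ≤ q) (hc : ∀ A ⊆ U, c A ≠ 0 → A.card = q)
    (hprod : ∀ A B A' B', c A ≠ 0 → c B ≠ 0 → c A' ≠ 0 → c B' ≠ 0 →
      A \ B = A' \ B' → B \ A = B' \ A' → |c A * c B| * |c A' * c B'| = c A ^ 2 * c B' ^ 2)
    {τ : ℝ} (hτ : 0 < τ) (hinf : ∀ j ∈ U, influence U c j ≤ τ)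
    (hv : ∑ A ∈ U.powerset, c A ^ 2 ≤ 1) {s : ℝ} (hs : sharpSum (coeffSupport U c) c ≤ s) :
    |∫ ω, h (mpoly X U c ω) ∂P - ∫ x, h x ∂gaussianReal 0 1|
      ≤ 6 * q * (1 - ∑ A ∈ U.powerset, c A ^ 2) + cltConst q * M ^ q * (√s + √τ) := by
  have hM := hX.one_le
  have hL := steinLip_nonneg
  have hq1 : (1 : ℝ) ≤ q := by exact_mod_cast hq
  set v := ∑ A ∈ U.powerset, c A ^ 2
  have hv0 : 0 ≤ v := Finset.sum_nonneg fun _ _ => sq_nonneg _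
  have hs0 : 0 ≤ sharpSum (coeffSupport U c) c := by
    classical
    exact Finset.sum_nonneg fun _ _ => by positivity
  have hs0' := hs0.trans hs
  set V : Ω → ℝ := fun ω => ∑ j ∈ U, mderiv X U c j ω ^ 2
  have iV : Integrable V P :=
    integrable_finsetSum _ fun j _ => hX.integrable_mderiv_pow U c j (by norm_num)
  obtain ⟨i2, b2⟩ := hX.integral_sum_mderiv_sq_sub_sq_le hc hprod hinf
  have i1 : Integrable (fun ω => V ω - q * v) P := iV.sub (integrable_const _)
  have hB : (1 : ℝ) ≤ q ^ 2 * 512 ^ q :=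
    one_le_mul_of_one_le_of_one_le (one_le_pow₀ hq1) (one_le_pow₀ (by norm_num))
  have hsd : √(∫ ω, (V ω - q * v) ^ 2 ∂P) ≤ M ^ q * (q ^ 2 * 512 ^ q * (√s + √τ)) := by
    refine Real.sqrt_le_iff.2 ⟨by positivity, b2.trans ?_⟩
    have hqB : (q : ℝ) ≤ q ^ 2 * 512 ^ q := by
      have : (1 : ℝ) ≤ q * 512 ^ q :=
        one_le_mul_of_one_le_of_one_le hq1 (one_le_pow₀ (by norm_num))
      nlinarith
    set B : ℝ := q ^ 2 * 512 ^ q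
    have hb : sharpSum (coeffSupport U c) c + q * τ * v ≤ B * (√s + √τ) ^ 2 := by
      have e1 := Real.sq_sqrt hs0'
      have e2 := Real.sq_sqrt hτ.le
      have h1 : q * τ * v ≤ B * τ := by
        calc q * τ * v ≤ q * τ * 1 := mul_le_mul_of_nonneg_left hv (by positivity)
          _ ≤ B * τ := by rw [mul_one]; exact mul_le_mul_of_nonneg_right hqB hτ.le
      have h2 : s ≤ B * s := le_mul_of_one_le_left hs0' hB
      have h3 : 0 ≤ B * (2 * √s * √τ) := by positivity
      calc _ ≤ B * s + B * τ := by linarith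
        _ ≤ B * (√s ^ 2 + √τ ^ 2) + B * (2 * √s * √τ) := by rw [e1, e2]; linarith
        _ = _ := by ring
    calc M ^ (2 * q) * (B * (sharpSum (coeffSupport U c) c + q * τ * v))
        ≤ M ^ (2 * q) * (B * (B * (√s + √τ) ^ 2)) := by gcongr
      _ = _ := by ring
  have hE : ∫ ω, |V ω - q| ∂P ≤ M ^ q * (q ^ 2 * 512 ^ q * (√s + √τ)) + q * (1 - v) := by
    calc ∫ ω, |V ω - q| ∂P ≤ ∫ ω, (|V ω - q * v| + q * (1 - v)) ∂P := by
          refine integral_mono (iV.sub (integrable_const _)).abs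
            (i1.abs.add (integrable_const _)) fun ω => ?_
          have e : V ω - q = (V ω - q * v) - q * (1 - v) := by ring
          simp only
          rw [e]
          refine (abs_sub _ _).trans (add_le_add le_rfl (le_of_eq (abs_of_nonneg ?_)))
          exact mul_nonneg (by linarith) (by linarith)
      _ = ∫ ω, |V ω - q * v| ∂P + q * (1 - v) := by
          rw [integral_add i1.abs (integrable_const _)]; simp
      _ ≤ _ := add_le_add ((integral_abs_le_sqrt i1 i2).trans hsd) le_rfl
  refine (hX.stein_bound hh hq hc hτ hinf).trans ?_
  have hlast : 2 * steinLip * M * (16 * M) ^ (q - 1) * √τ * v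
      ≤ 2 * steinLip * 16 ^ q * M ^ q * (√s + √τ) := by
    obtain ⟨p, rfl⟩ : ∃ p, q = p + 1 := ⟨q - 1, by omega⟩
    calc 2 * steinLip * M * (16 * M) ^ (p + 1 - 1) * √τ * v
        ≤ 2 * steinLip * M * (16 * M) ^ (p + 1 - 1) * √τ * 1 :=
          mul_le_mul_of_nonneg_left hv (by positivity)
      _ = 2 * steinLip * (1 * 16 ^ p) * M ^ (p + 1) * (0 + √τ) := by
          rw [Nat.add_sub_cancel]; ring
      _ ≤ 2 * steinLip * (16 * 16 ^ p) * M ^ (p + 1) * (√s + √τ) := by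
          gcongr
          · norm_num
          · positivity
      _ = _ := by ring
  rw [cltConst]
  linarith

/-! ### Tuples and index sets -/

/-- The set of entries of a tuple. -/
def entries {q : ℕ} (i : Fin q → ℕ) : Finset ℕ := Finset.univ.image i

lemma coe_entries {q : ℕ} (i : Fin q → ℕ) : (entries i : Set ℕ) = Set.range i := by
  simp [entries]

lemma entries_comp_perm {q : ℕ} (i : Fin q → ℕ) (σ : Equiv.Perm (Fin q)) :
    entries (i ∘ σ) = entries i := by
  rw [← Finset.coe_inj, coe_entries, coe_entries, σ.surjective.range_comp]

lemma prod_entries {q : ℕ} {i : Fin q → ℕ} (hi : Function.Injective i) (f : ℕ → ℝ) :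
    ∏ k ∈ entries i, f k = ∏ k, f (i k) :=
  Finset.prod_image fun _ _ _ _ h => hi h

lemma card_entries {q : ℕ} {i : Fin q → ℕ} (hi : Function.Injective i) : (entries i).card = q := by
  rw [entries, Finset.card_image_of_injective _ hi, Finset.card_univ, Fintype.card_fin]

lemma exists_perm_of_entries_eq {q : ℕ} {i j : Fin q → ℕ} (hj : Function.Injective j)
    (h : entries i = entries j) : ∃ σ : Equiv.Perm (Fin q), j = i ∘ σ := by
  have hm : ∀ k, ∃ l, i l = j k := fun k => by
    have : j k ∈ entries j := Finset.mem_image_of_mem j (Finset.mem_univ k)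
    rw [← h] at this
    obtain ⟨l, -, hl⟩ := Finset.mem_image.1 this
    exact ⟨l, hl⟩
  choose f hf using hm
  have hinj : Function.Injective f := fun a b hab => hj (by rw [← hf a, ← hf b, hab])
  exact ⟨Equiv.ofBijective f (Finite.injective_iff_bijective.1 hinj), funext fun k => (hf k).symm⟩

open Classical in
/-- The injective tuples in a finite set with the same entries as a given one are at most `q!`. -/
lemma card_filter_entries_le {q : ℕ} (F : Finset (Fin q → ℕ))
    (hF : ∀ i ∈ F, Function.Injective i) (A : Finset ℕ) :
    (F.filter fun i => entries i = A).card ≤ q.factorial := by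
  rcases (F.filter fun i => entries i = A).eq_empty_or_nonempty with h | ⟨i, hi⟩
  · rw [h]; exact Nat.zero_le _
  · obtain ⟨-, rfl⟩ := Finset.mem_filter.1 hi
    have hsub : (F.filter fun j => entries j = entries i)
        ⊆ Finset.univ.image fun σ : Equiv.Perm (Fin q) => i ∘ ⇑σ := fun j hj => by
      obtain ⟨hjF, hj⟩ := Finset.mem_filter.1 hj
      obtain ⟨σ, hσ⟩ := exists_perm_of_entries_eq (hF j hjF) hj.symm
      exact Finset.mem_image.2 ⟨σ, Finset.mem_univ _, hσ.symm⟩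
    refine (Finset.card_le_card hsub).trans (Finset.card_image_le.trans ?_)
    rw [Finset.card_univ, Fintype.card_perm, Fintype.card_fin]

/-- The sets of entries of the tuples in `K`. -/
def entrySets {q : ℕ} (K : Set (Fin q → ℕ)) : Set (Finset ℕ) := entries '' K

open Classical in
/-- The tuples in `K` with entries below `n`. -/
noncomputable def truncate {q : ℕ} (K : Set (Fin q → ℕ)) (n : ℕ) : Finset (Fin q → ℕ) :=
  (Fintype.piFinset fun _ => Finset.range n).filter (· ∈ K)

lemma mem_truncate {q : ℕ} {K : Set (Fin q → ℕ)} {n : ℕ} {i : Fin q → ℕ} :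
    i ∈ truncate K n ↔ i ∈ K ∧ entries i ⊆ Finset.range n := by
  simp only [truncate, Finset.mem_filter, Fintype.mem_piFinset, entries, Finset.image_subset_iff,
    Finset.mem_univ, true_implies]
  exact and_comm

-- Cutting off by the size of the entries keeps the index set symmetric, so every occurring set of
-- entries comes from exactly q! tuples.
open Classical in
lemma sum_truncate {q : ℕ} {K : Set (Fin q → ℕ)} (hK : IsSymmetricOffDiagonal K) (n : ℕ)
    (g : Finset ℕ → ℝ) :
    ∑ i ∈ truncate K n, g (entries i)
      = q.factorial * ∑ A ∈ (Finset.range n).powerset with A ∈ entrySets K, g A := by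
  have hmaps : ∀ i ∈ truncate K n,
      entries i ∈ (Finset.range n).powerset.filter (· ∈ entrySets K) := fun i hi => by
    obtain ⟨hiK, hin⟩ := mem_truncate.1 hi
    exact Finset.mem_filter.2 ⟨Finset.mem_powerset.2 hin, i, hiK, rfl⟩
  rw [← Finset.sum_fiberwise_of_maps_to hmaps, Finset.mul_sum]
  refine Finset.sum_congr rfl fun A hA => ?_
  obtain ⟨hAn, i, hiK, rfl⟩ := Finset.mem_filter.1 hA
  have hfib : ((truncate K n).filter fun j => entries j = entries i)
      = Finset.univ.image fun σ : Equiv.Perm (Fin q) => i ∘ ⇑σ := by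
    ext j
    simp only [Finset.mem_filter, Finset.mem_image, Finset.mem_univ, true_and, mem_truncate]
    constructor
    · rintro ⟨⟨hjK, -⟩, hj⟩
      obtain ⟨σ, hσ⟩ := exists_perm_of_entries_eq (hK.injective j hjK) hj.symm
      exact ⟨σ, hσ.symm⟩
    · rintro ⟨σ, rfl⟩
      rw [entries_comp_perm]
      exact ⟨⟨hK.symmetric i hiK σ, Finset.mem_powerset.1 hAn⟩, rfl⟩
  have hcard : ((truncate K n).filter fun j => entries j = entries i).card = q.factorial := by
    rw [hfib, Finset.card_image_of_injective, Finset.card_univ, Fintype.card_perm,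
      Fintype.card_fin]
    intro σ σ' h
    refine Equiv.ext fun k => hK.injective i hiK ?_
    exact congrFun h k
  rw [Finset.sum_congr rfl fun j hj => by rw [(Finset.mem_filter.1 hj).2], Finset.sum_const, hcard,
    nsmul_eq_mul]

/-! ### Weights -/

/-- The weight of a tuple. -/
def tupleWeight (b : ℕ → ℝ) {q : ℕ} (i : Fin q → ℕ) : ℝ := ∏ k, b (i k) ^ 2

lemma tupleWeight_nonneg (b : ℕ → ℝ) {q : ℕ} (i : Fin q → ℕ) : 0 ≤ tupleWeight b i :=
  Finset.prod_nonneg fun _ _ => sq_nonneg _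

lemma weightMeasure_singleton (b : ℕ → ℝ) (k : ℕ) :
    weightMeasure b {k} = ENNReal.ofReal (b k ^ 2) := by
  rw [weightMeasure, withDensity_apply _ (measurableSet_singleton k)]
  simp

lemma weightPow_singleton (b : ℕ → ℝ) {q : ℕ} (i : Fin q → ℕ) :
    weightPow b q {i} = ENNReal.ofReal (tupleWeight b i) := by
  rw [weightPow, ← Set.univ_pi_singleton, Measure.pi_pi, tupleWeight,
    ENNReal.ofReal_prod_of_nonneg fun _ _ => sq_nonneg _]
  simp only [weightMeasure_singleton]

lemma weightPow_finset (b : ℕ → ℝ) {q : ℕ} (F : Finset (Fin q → ℕ)) :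
    weightPow b q F = ENNReal.ofReal (∑ i ∈ F, tupleWeight b i) := by
  rw [← sum_measure_singleton, ENNReal.ofReal_sum_of_nonneg fun i _ => tupleWeight_nonneg b i]
  simp only [weightPow_singleton]

instance weightPow_sigmaFinite (b : ℕ → ℝ) (q : ℕ) : SigmaFinite (weightPow b q) := by
  unfold weightPow
  infer_instance

lemma weightPowPair_finset (b : ℕ → ℝ) {q : ℕ} (F : Finset ((Fin q → ℕ) × (Fin q → ℕ))) :
    weightPowPair b q F = ENNReal.ofReal (∑ p ∈ F, tupleWeight b p.1 * tupleWeight b p.2) := by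
  rw [← sum_measure_singleton, ENNReal.ofReal_sum_of_nonneg fun p _ =>
    mul_nonneg (tupleWeight_nonneg b p.1) (tupleWeight_nonneg b p.2)]
  refine Finset.sum_congr rfl fun p _ => ?_
  rw [weightPowPair, ← Set.singleton_prod_singleton, Measure.prod_prod, weightPow_singleton,
    weightPow_singleton, ENNReal.ofReal_mul (tupleWeight_nonneg b p.1)]

lemma sum_tupleWeight_le (b : ℕ → ℝ) {q : ℕ} {F : Finset (Fin q → ℕ)} {S : Set (Fin q → ℕ)}
    (h : ∀ i ∈ F, i ∈ S) (hS : weightPow b q S ≠ ∞) :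
    ∑ i ∈ F, tupleWeight b i ≤ (weightPow b q S).toReal := by
  refine (ENNReal.ofReal_le_iff_le_toReal hS).1 ?_
  rw [← weightPow_finset]
  exact measure_mono fun i hi => h i hi

lemma sum_tupleWeight_pair_le (b : ℕ → ℝ) {q : ℕ} {F : Finset ((Fin q → ℕ) × (Fin q → ℕ))}
    {S : Set ((Fin q → ℕ) × (Fin q → ℕ))} (h : ∀ p ∈ F, p ∈ S) (hS : weightPowPair b q S ≠ ∞) :
    ∑ p ∈ F, tupleWeight b p.1 * tupleWeight b p.2 ≤ (weightPowPair b q S).toReal := by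
  refine (ENNReal.ofReal_le_iff_le_toReal hS).1 ?_
  rw [← weightPowPair_finset]
  exact measure_mono fun i hi => h i hi

lemma star_subset {q : ℕ} (K : Set (Fin q → ℕ)) (j : ℕ) : star K j ⊆ K := fun _ h => h.1

lemma sharp_subset {q : ℕ} (K : Set (Fin q → ℕ)) : sharp K ⊆ K ×ˢ K := fun _ h => ⟨h.1, h.2.1⟩

lemma weightPowPair_sharp_ne_top {b : ℕ → ℝ} {q : ℕ} {K : Set (Fin q → ℕ)}
    (hK : weightPow b q K ≠ ∞) : weightPowPair b q (sharp K) ≠ ∞ := by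
  refine ne_top_of_le_ne_top ?_ (measure_mono (sharp_subset K))
  rw [weightPowPair, Measure.prod_prod]
  exact ENNReal.mul_ne_top hK hK

lemma tendsto_sum_truncate {b : ℕ → ℝ} {q : ℕ} {K : Set (Fin q → ℕ)} (hK : weightPow b q K ≠ ∞) :
    Tendsto (fun n => ∑ i ∈ truncate K n, tupleWeight b i) atTop (𝓝 (weightPow b q K).toReal) := by
  have hmono : Monotone fun n => (truncate K n : Set (Fin q → ℕ)) := fun m n hmn i hi => by
    obtain ⟨hiK, him⟩ := mem_truncate.1 hi
    exact mem_truncate.2 ⟨hiK, him.trans (Finset.range_subset_range.2 hmn)⟩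
  have hU : ⋃ n, (truncate K n : Set (Fin q → ℕ)) = K := by
    ext i
    simp only [Set.mem_iUnion, Finset.mem_coe, mem_truncate]
    refine ⟨fun ⟨_, h⟩ => h.1, fun h => ⟨(entries i).sup id + 1, h, fun k hk => ?_⟩⟩
    exact Finset.mem_range.2 (Nat.lt_succ_of_le (Finset.le_sup (f := id) hk))
  have h := tendsto_measure_iUnion_atTop (μ := weightPow b q) hmono
  rw [hU] at h
  have h2 := (ENNReal.tendsto_toReal hK).comp h
  refine h2.congr fun n => ?_
  simp only [Function.comp_apply]
  rw [weightPow_finset, ENNReal.toReal_ofReal (Finset.sum_nonneg fun i _ => tupleWeight_nonneg b i)]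

end CombCLT

namespace CombCLT

variable {Ω : Type*} [MeasurableSpace Ω]

/-! ### The coefficients of a homogeneous sum -/

open Classical in
/-- The coefficient `s ∏_{k ∈ A} b_k` if `A` is the set of entries of a tuple in `K`. -/
noncomputable def tupleCoeff (b : ℕ → ℝ) {q : ℕ} (K : Set (Fin q → ℕ)) (s : ℝ) (A : Finset ℕ) : ℝ :=
  if A ∈ entrySets K then s * ∏ k ∈ A, b k else 0

variable {b : ℕ → ℝ} {q : ℕ} {K : Set (Fin q → ℕ)} {s : ℝ}

lemma mem_entrySets_of_tupleCoeff_ne_zero {A : Finset ℕ} (h : tupleCoeff b K s A ≠ 0) :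
    A ∈ entrySets K := by
  by_contra hA
  exact h (if_neg hA)

lemma tupleCoeff_of_mem {A : Finset ℕ} (h : A ∈ entrySets K) :
    tupleCoeff b K s A = s * ∏ k ∈ A, b k := if_pos h

lemma card_of_tupleCoeff_ne_zero (hK : IsSymmetricOffDiagonal K) {A : Finset ℕ}
    (h : tupleCoeff b K s A ≠ 0) : A.card = q := by
  obtain ⟨i, hi, rfl⟩ := mem_entrySets_of_tupleCoeff_ne_zero h
  exact card_entries (hK.injective i hi)

/-- With multiplicity, A and B' together contain the same indices as A' and B: both consist of A ∩
B, A' ∩ B' and the two common differences. Hence c_A c_{B'} = c_{A'} c_B for product coefficients,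
and the product of all four is a square. -/
lemma tupleCoeff_exchange {A B A' B' : Finset ℕ} (hA : tupleCoeff b K s A ≠ 0)
    (hB : tupleCoeff b K s B ≠ 0) (hA' : tupleCoeff b K s A' ≠ 0) (hB' : tupleCoeff b K s B' ≠ 0)
    (h1 : A \ B = A' \ B') (h2 : B \ A = B' \ A') :
    |tupleCoeff b K s A * tupleCoeff b K s B| * |tupleCoeff b K s A' * tupleCoeff b K s B'|
      = tupleCoeff b K s A ^ 2 * tupleCoeff b K s B' ^ 2 := by
  have split : ∀ A B : Finset ℕ, ∏ k ∈ A, b k = (∏ k ∈ A ∩ B, b k) * ∏ k ∈ A \ B, b k :=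
    fun A B => (Finset.prod_inter_mul_prod_sdiff A B b).symm
  rw [tupleCoeff_of_mem (mem_entrySets_of_tupleCoeff_ne_zero hA),
    tupleCoeff_of_mem (mem_entrySets_of_tupleCoeff_ne_zero hB),
    tupleCoeff_of_mem (mem_entrySets_of_tupleCoeff_ne_zero hA'),
    tupleCoeff_of_mem (mem_entrySets_of_tupleCoeff_ne_zero hB'),
    split A B, split B A, split A' B', split B' A', h1, h2, Finset.inter_comm B A,
    Finset.inter_comm B' A', ← abs_mul]
  rw [abs_of_nonneg]
  · ring
  · refine le_of_le_of_eq (sq_nonneg (s * s * (∏ k ∈ A ∩ B, b k) * (∏ k ∈ A' ∩ B', b k)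
      * (∏ k ∈ A' \ B', b k) * ∏ k ∈ B' \ A', b k)) ?_
    ring

lemma prod_sq_entries {i : Fin q → ℕ} (hi : Function.Injective i) :
    (∏ k ∈ entries i, b k) ^ 2 = tupleWeight b i := by
  rw [← Finset.prod_pow, prod_entries hi, tupleWeight]

lemma mpoly_tupleCoeff (hK : IsSymmetricOffDiagonal K) (X : ℕ → Ω → ℝ) (n : ℕ) (ω : Ω) :
    mpoly X (Finset.range n) (tupleCoeff b K s) ω
      = s / q.factorial * ∑ i ∈ truncate K n, ∏ k, b (i k) * X (i k) ω := by
  classical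
  have e : ∑ i ∈ truncate K n, ∏ k, b (i k) * X (i k) ω
      = ∑ i ∈ truncate K n, ∏ k ∈ entries i, b k * X k ω :=
    Finset.sum_congr rfl fun i hi =>
      (prod_entries (hK.injective i (mem_truncate.1 hi).1) fun k => b k * X k ω).symm
  have hq : (q.factorial : ℝ) ≠ 0 := by exact_mod_cast q.factorial_ne_zero
  rw [e, sum_truncate hK n fun A => ∏ k ∈ A, b k * X k ω, ← mul_assoc, div_mul_cancel₀ _ hq, mpoly,
    Finset.mul_sum, Finset.sum_filter]
  refine Finset.sum_congr rfl fun A _ => ?_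
  rw [tupleCoeff]
  split_ifs
  · rw [Finset.prod_mul_distrib, mul_assoc]
  · rw [zero_mul]

lemma sum_tupleCoeff_sq_filter (hK : IsSymmetricOffDiagonal K) (n : ℕ) (p : Finset ℕ → Prop)
    [DecidablePred p] :
    ∑ A ∈ (Finset.range n).powerset with p A, tupleCoeff b K s A ^ 2
      = s ^ 2 / q.factorial * ∑ i ∈ truncate K n with p (entries i), tupleWeight b i := by
  classical
  have e : ∑ i ∈ truncate K n with p (entries i), tupleWeight b i
      = ∑ i ∈ truncate K n, if p (entries i) then (∏ k ∈ entries i, b k) ^ 2 else 0 := by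
    rw [Finset.sum_filter]
    refine Finset.sum_congr rfl fun i hi => ?_
    rw [prod_sq_entries (hK.injective i (mem_truncate.1 hi).1)]
  have hq : (q.factorial : ℝ) ≠ 0 := by exact_mod_cast q.factorial_ne_zero
  rw [e, sum_truncate hK n fun A => if p A then (∏ k ∈ A, b k) ^ 2 else 0, ← mul_assoc,
    div_mul_cancel₀ _ hq, Finset.mul_sum, Finset.sum_filter, Finset.sum_filter]
  refine Finset.sum_congr rfl fun A _ => ?_
  rw [tupleCoeff]
  split_ifs
  · ring
  · ring
  · ring
  · rfl

lemma sum_tupleCoeff_sq (hK : IsSymmetricOffDiagonal K) (n : ℕ) :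
    ∑ A ∈ (Finset.range n).powerset, tupleCoeff b K s A ^ 2
      = s ^ 2 / q.factorial * ∑ i ∈ truncate K n, tupleWeight b i := by
  simpa using sum_tupleCoeff_sq_filter (b := b) (s := s) hK n fun _ => True

lemma influence_tupleCoeff_le (hK : IsSymmetricOffDiagonal K) (hfin : weightPow b q K ≠ ∞)
    (n j : ℕ) :
    influence (Finset.range n) (tupleCoeff b K s) j
      ≤ s ^ 2 / q.factorial * (weightPow b q (star K j)).toReal := by
  rw [influence, sum_tupleCoeff_sq_filter hK n fun A => j ∈ A]
  refine mul_le_mul_of_nonneg_left (sum_tupleWeight_le b (fun i hi => ?_)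
    (ne_top_of_le_ne_top hfin (measure_mono (star_subset K j)))) (by positivity)
  obtain ⟨hi, hj⟩ := Finset.mem_filter.1 hi
  obtain ⟨k, -, hk⟩ := Finset.mem_image.1 hj
  exact ⟨(mem_truncate.1 hi).1, k, hk⟩

lemma mem_sharp_of_isSharpPair {U : Finset ℕ} {i j : Fin q → ℕ} (hi : i ∈ K) (hj : j ∈ K)
    (h : IsSharpPair (coeffSupport U (tupleCoeff b K s)) (entries i, entries j)) :
    (i, j) ∈ sharp K := by
  obtain ⟨hd, C, hC, D, hD, hu, hne1, hne2⟩ := h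
  obtain ⟨k, hk, rfl⟩ := mem_entrySets_of_tupleCoeff_ne_zero (Finset.mem_filter.1 hC).2
  obtain ⟨l, hl, rfl⟩ := mem_entrySets_of_tupleCoeff_ne_zero (Finset.mem_filter.1 hD).2
  simp only [← Finset.coe_inj, ← Finset.disjoint_coe, Finset.coe_union, coe_entries, ne_eq]
    at hd hu hne1 hne2
  exact ⟨hi, hj, hd, k, hk, l, hl, hu, hne1, hne2⟩

/-- Each pair of sets stands for (q!)² pairs of tuples, and witnesses for sharpness in the
truncation are witnesses in K. -/
lemma sharpSum_tupleCoeff_le (hK : IsSymmetricOffDiagonal K) (hfin : weightPow b q K ≠ ∞) (n : ℕ) :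
    sharpSum (coeffSupport (Finset.range n) (tupleCoeff b K s)) (tupleCoeff b K s)
      ≤ (s ^ 2 / q.factorial) ^ 2 * (weightPowPair b q (sharp K)).toReal := by
  classical
  set 𝒦 := coeffSupport (Finset.range n) (tupleCoeff b K s)
  set N := (Finset.range n).powerset
  set π : Finset ℕ → ℝ := fun A => ∏ k ∈ A, b k
  have hq : (q.factorial : ℝ) ≠ 0 := by exact_mod_cast q.factorial_ne_zero
  have hsub : 𝒦 ⊆ N.filter (· ∈ entrySets K) := fun A hA => by
    obtain ⟨h1, h2⟩ := Finset.mem_filter.1 hA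
    exact Finset.mem_filter.2 ⟨h1, mem_entrySets_of_tupleCoeff_ne_zero h2⟩
  have hnn : ∀ x : Finset ℕ × Finset ℕ, 0 ≤ (if IsSharpPair 𝒦 x then
      tupleCoeff b K s x.1 ^ 2 * tupleCoeff b K s x.2 ^ 2 else 0) := fun x => by
    split_ifs <;> positivity
  calc sharpSum 𝒦 (tupleCoeff b K s)
      ≤ ∑ x ∈ N.filter (· ∈ entrySets K) ×ˢ N.filter (· ∈ entrySets K),
        (if IsSharpPair 𝒦 x then
          tupleCoeff b K s x.1 ^ 2 * tupleCoeff b K s x.2 ^ 2 else 0) := by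
        rw [sharpSum, Finset.sum_filter]
        exact Finset.sum_le_sum_of_subset_of_nonneg (Finset.product_subset_product hsub hsub)
          fun x _ _ => hnn x
    _ = ∑ A ∈ N with A ∈ entrySets K, ∑ B ∈ N with B ∈ entrySets K,
        (s ^ 2) ^ 2 * (if IsSharpPair 𝒦 (A, B) then π A ^ 2 * π B ^ 2 else 0) := by
        rw [Finset.sum_product]
        refine Finset.sum_congr rfl fun A hA => Finset.sum_congr rfl fun B hB => ?_
        rw [tupleCoeff_of_mem (Finset.mem_filter.1 hA).2,
          tupleCoeff_of_mem (Finset.mem_filter.1 hB).2]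
        split_ifs <;> ring
    _ = (s ^ 2 / q.factorial) ^ 2 * ∑ i ∈ truncate K n, ∑ j ∈ truncate K n,
        (if IsSharpPair 𝒦 (entries i, entries j) then π (entries i) ^ 2 * π (entries j) ^ 2
          else 0) := by
        have e1 : ∀ A, ∑ j ∈ truncate K n,
            (if IsSharpPair 𝒦 (A, entries j) then π A ^ 2 * π (entries j) ^ 2 else 0)
            = q.factorial * ∑ B ∈ N with B ∈ entrySets K,
              (if IsSharpPair 𝒦 (A, B) then π A ^ 2 * π B ^ 2 else 0) := fun A =>
          sum_truncate hK n fun B => if IsSharpPair 𝒦 (A, B) then π A ^ 2 * π B ^ 2 else 0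
        simp only [e1]
        rw [sum_truncate hK n fun A => (q.factorial : ℝ) * ∑ B ∈ N with B ∈ entrySets K,
          (if IsSharpPair 𝒦 (A, B) then π A ^ 2 * π B ^ 2 else 0)]
        simp only [← Finset.mul_sum]
        field_simp
        rfl
    _ = (s ^ 2 / q.factorial) ^ 2 * ∑ p ∈ truncate K n ×ˢ truncate K n with
        IsSharpPair 𝒦 (entries p.1, entries p.2), tupleWeight b p.1 * tupleWeight b p.2 := by
        rw [Finset.sum_filter, Finset.sum_product]
        congr 1
        refine Finset.sum_congr rfl fun i hi => Finset.sum_congr rfl fun j hj => ?_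
        rw [prod_sq_entries (hK.injective i (mem_truncate.1 hi).1),
          prod_sq_entries (hK.injective j (mem_truncate.1 hj).1)]
    _ ≤ _ := by
        refine mul_le_mul_of_nonneg_left (sum_tupleWeight_pair_le b (fun p hp => ?_)
          (weightPowPair_sharp_ne_top hfin)) (by positivity)
        obtain ⟨hp, hs⟩ := Finset.mem_filter.1 hp
        obtain ⟨h1, h2⟩ := Finset.mem_product.1 hp
        exact mem_sharp_of_isSharpPair (mem_truncate.1 h1).1 (mem_truncate.1 h2).1 hs

/-! ### Existence of the homogeneous sum -/

/-- Independent square integrable random variables with mean `0` and variance `1`. -/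
structure IsStdL2Seq (P : Measure Ω) (X : ℕ → Ω → ℝ) : Prop extends IsIndepSeq P X where
  memLp : ∀ k, MemLp (X k) 2 P
  mean : ∀ k, ∫ ω, X k ω ∂P = 0
  var : ∀ k, ∫ ω, X k ω ^ 2 ∂P = 1

namespace IsStdL2Seq

variable {P : Measure Ω} [IsProbabilityMeasure P] {X : ℕ → Ω → ℝ}

lemma integral_prod_mul_prod (hX : IsStdL2Seq P X) (A B : Finset ℕ) :
    ∫ ω, (∏ k ∈ A, X k ω) * ∏ k ∈ B, X k ω ∂P = if A = B then 1 else 0 := by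
  have e : ∀ ω, (∏ k ∈ A, X k ω) * ∏ k ∈ B, X k ω
      = ∏ k ∈ A ∪ B, ((if k ∈ A then X k ω else 1) * (if k ∈ B then X k ω else 1)) := fun ω => by
    rw [Finset.prod_mul_distrib, Finset.prod_ite_mem, Finset.prod_ite_mem,
      Finset.inter_eq_right.2 Finset.subset_union_left,
      Finset.inter_eq_right.2 Finset.subset_union_right]
  set g : ℕ → ℝ → ℝ := fun k t => (if k ∈ A then t else 1) * (if k ∈ B then t else 1) with hg
  have mg : ∀ k, Measurable (g k) := fun k => by
    simp only [hg]
    split_ifs <;> fun_prop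
  have ig : ∀ k, Integrable (fun ω => g k (X k ω)) P := fun k => by
    have i1 := (hX.memLp k).integrable (by norm_num)
    have i2 := (hX.memLp k).integrable_sq
    simp only [hg]
    split_ifs
    · simpa only [← sq] using i2
    · simpa using i1
    · simpa using i1
    · simp
  have h := (hX.integrable_prod_comp (A ∪ B) mg ig).2
  simp only [e]
  rw [h]
  split_ifs with hAB
  · subst hAB
    refine Finset.prod_eq_one fun k hk => ?_
    simp only [Finset.union_self] at hk
    simp only [hg, hk, if_true, ← sq, hX.var]
  · have : ∃ k ∈ A ∪ B, ¬ (k ∈ A ↔ k ∈ B) := by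
      by_contra hcon
      push Not at hcon
      refine hAB (Finset.ext fun k => ?_)
      by_cases hk : k ∈ A ∪ B
      · exact hcon k hk
      · simp only [Finset.mem_union, not_or] at hk
        tauto
    obtain ⟨k, hk, hne⟩ := this
    refine Finset.prod_eq_zero hk ?_
    by_cases h1 : k ∈ A <;> by_cases h2 : k ∈ B <;>
      simp [hg, h1, h2, hX.mean] at hne ⊢

lemma memLp_prod (hX : IsStdL2Seq P X) {i : Fin q → ℕ} (hi : Function.Injective i) :
    MemLp (fun ω => ∏ k, b (i k) * X (i k) ω) 2 P := by
  have hm : Measurable fun ω => ∏ k, b (i k) * X (i k) ω :=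
    Finset.measurable_fun_prod _ fun k _ => (hX.meas (i k)).const_mul _
  rw [memLp_two_iff_integrable_sq hm.aestronglyMeasurable]
  have h := (hX.integrable_prod_comp (entries i) (g := fun k t => (b k * t) ^ 2)
    (fun k => (measurable_id.const_mul _).pow_const 2) fun k => by
      simp only [mul_pow]
      exact (hX.memLp k).integrable_sq.const_mul _).1
  refine h.congr (ae_of_all _ fun ω => ?_)
  simp only
  rw [prod_entries hi fun k => (b k * X k ω) ^ 2, Finset.prod_pow]

lemma integral_prod_mul_prod_tuple (hX : IsStdL2Seq P X) {i j : Fin q → ℕ}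
    (hi : Function.Injective i) (hj : Function.Injective j) :
    ∫ ω, (∏ k, b (i k) * X (i k) ω) * ∏ k, b (j k) * X (j k) ω ∂P
      = if entries i = entries j then tupleWeight b i else 0 := by
  have e : ∀ ω, (∏ k, b (i k) * X (i k) ω) * ∏ k, b (j k) * X (j k) ω
      = ((∏ k ∈ entries i, b k) * ∏ k ∈ entries j, b k)
        * ((∏ k ∈ entries i, X k ω) * ∏ k ∈ entries j, X k ω) := fun ω => by
    rw [← prod_entries hi fun k => b k * X k ω, ← prod_entries hj fun k => b k * X k ω,
      Finset.prod_mul_distrib, Finset.prod_mul_distrib]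
    ring
  simp only [e]
  rw [integral_const_mul, hX.integral_prod_mul_prod]
  split_ifs with h
  · rw [← h, mul_one, ← sq, prod_sq_entries hi]
  · rw [mul_zero]

/-- The terms of the homogeneous sum, as elements of `L²`. -/
noncomputable def term (hX : IsStdL2Seq P X) (b : ℕ → ℝ) (hK : IsSymmetricOffDiagonal K) (i : K) :
    Lp ℝ 2 P :=
  (hX.memLp_prod (b := b) (hK.injective i.1 i.2)).toLp

-- Terms with the same entries are equal and the others are orthogonal, so the squared norm is the
-- sum of the weights, each multiplied by the number of rearrangements present, at most q!.
open Classical in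
lemma norm_sum_term_sq_le (hX : IsStdL2Seq P X) (hK : IsSymmetricOffDiagonal K) (F : Finset K) :
    ‖∑ i ∈ F, hX.term b hK i‖ ^ 2 ≤ q.factorial * ∑ i ∈ F, tupleWeight b i.1 := by
  have hinner : ∀ i j : K, inner ℝ (hX.term b hK i) (hX.term b hK j)
      = if entries i.1 = entries j.1 then tupleWeight b i.1 else 0 := fun i j => by
    rw [← hX.integral_prod_mul_prod_tuple (b := b) (hK.injective i.1 i.2) (hK.injective j.1 j.2),
      L2.inner_def]
    refine integral_congr_ae ?_
    filter_upwards [(hX.memLp_prod (b := b) (hK.injective i.1 i.2)).coeFn_toLp,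
      (hX.memLp_prod (b := b) (hK.injective j.1 j.2)).coeFn_toLp] with ω h1 h2
    rw [term, term, h1, h2]
    simp [mul_comm]
  rw [← real_inner_self_eq_norm_sq, sum_inner, Finset.mul_sum]
  refine Finset.sum_le_sum fun i _ => ?_
  rw [inner_sum]
  simp only [hinner]
  rw [← Finset.sum_filter, Finset.sum_const, nsmul_eq_mul]
  refine mul_le_mul_of_nonneg_right ?_ (tupleWeight_nonneg b i.1)
  have hcard := card_filter_entries_le (F.map (Function.Embedding.subtype _))
    (fun j hj => by
      obtain ⟨j, -, rfl⟩ := Finset.mem_map.1 hj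
      exact hK.injective j.1 j.2) (entries i.1)
  rw [Finset.filter_map, Finset.card_map] at hcard
  refine le_trans ?_ (Nat.cast_le.2 hcard)
  refine Nat.cast_le.2 (Finset.card_le_card fun j hj => ?_)
  obtain ⟨hj, h⟩ := Finset.mem_filter.1 hj
  exact Finset.mem_filter.2 ⟨hj, h.symm⟩

lemma summable_term (hX : IsStdL2Seq P X) (hK : IsSymmetricOffDiagonal K)
    (hfin : weightPow b q K ≠ ∞) : Summable (hX.term b hK) := by
  have hw : Summable fun i : K => tupleWeight b i.1 := by
    refine summable_of_sum_le (fun i => tupleWeight_nonneg b i.1)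
      (c := (weightPow b q K).toReal) fun F => ?_
    have := sum_tupleWeight_le b (F := F.map (Function.Embedding.subtype _)) (S := K)
      (fun i hi => by
        obtain ⟨i, -, rfl⟩ := Finset.mem_map.1 hi
        exact i.2) hfin
    rwa [Finset.sum_map] at this
  rw [summable_iff_vanishing_norm] at hw ⊢
  intro ε hε
  have hq : (0 : ℝ) < q.factorial := by exact_mod_cast q.factorial_pos
  obtain ⟨F, hF⟩ := hw (ε ^ 2 / q.factorial) (by positivity)
  refine ⟨F, fun t ht => lt_of_pow_lt_pow_left₀ 2 hε.le ?_⟩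
  have h := hF t ht
  rw [Real.norm_eq_abs, abs_of_nonneg (Finset.sum_nonneg fun i _ => tupleWeight_nonneg b i.1),
    lt_div_iff₀ hq] at h
  have := hX.norm_sum_term_sq_le (b := b) hK t
  linarith

/-- Unconditional summability in the complete space L², from second moments alone; thus the sum
exists even when the fourth moment is infinite. -/
lemma exists_tendsto (hX : IsStdL2Seq P X) (hK : IsSymmetricOffDiagonal K)
    (hfin : weightPow b q K ≠ ∞) (t : ℝ) :
    ∃ S : Ω → ℝ, MemLp S 2 P ∧ Tendsto (fun F : Finset K => eLpNorm
      (fun ω => S ω - t * ∑ i ∈ F, ∏ k, b (i.1 k) * X (i.1 k) ω) 2 P) atTop (𝓝 0) := by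
  obtain ⟨S₀, hS₀⟩ := hX.summable_term (b := b) hK hfin
  have h1 : Tendsto (fun F : Finset K => t • ∑ i ∈ F, hX.term b hK i) atTop (𝓝 (t • S₀)) :=
    Filter.Tendsto.const_smul hS₀ t
  rw [Lp.tendsto_Lp_iff_tendsto_eLpNorm'] at h1
  refine ⟨⇑(t • S₀), Lp.memLp _, h1.congr fun F => ?_⟩
  rw [← eLpNorm_neg]
  refine eLpNorm_congr_ae ?_
  have hsum : ⇑(∑ i ∈ F, hX.term b hK i)
      =ᵐ[P] fun ω => ∑ i ∈ F, ∏ k, b (i.1 k) * X (i.1 k) ω := by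
    induction F using Finset.induction_on with
    | empty =>
      simp only [Finset.sum_empty]
      exact Lp.coeFn_zero ℝ 2 P
    | insert i F hi ih =>
      rw [Finset.sum_insert hi]
      filter_upwards [Lp.coeFn_add (hX.term b hK i) (∑ i ∈ F, hX.term b hK i), ih,
        (hX.memLp_prod (b := b) (hK.injective i.1 i.2)).coeFn_toLp] with ω h1 h2 h3
      rw [h1, Pi.add_apply, h2, Finset.sum_insert hi, term, h3]
  filter_upwards [hsum, Lp.coeFn_smul t (∑ i ∈ F, hX.term b hK i)] with ω h1 h2
  simp only [Pi.neg_apply, Pi.sub_apply, h2, Pi.smul_apply, h1, smul_eq_mul]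
  ring

end IsStdL2Seq

end CombCLT

namespace CombCLT

variable {Ω : Type*} [MeasurableSpace Ω]

/-! ### The normal approximation bound for infinite sums -/

lemma integral_abs_le_eLpNorm_two {P : Measure Ω} [IsProbabilityMeasure P] {f : Ω → ℝ}
    (hf : MemLp f 2 P) : ∫ ω, |f ω| ∂P ≤ (eLpNorm f 2 P).toReal := by
  have h1 : ∫ ω, |f ω| ∂P = (eLpNorm f 1 P).toReal := by
    rw [eLpNorm_one_eq_lintegral_enorm, ← integral_norm_eq_lintegral_enorm hf.1]
    rfl
  rw [h1]
  exact ENNReal.toReal_mono hf.2.ne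
    (eLpNorm_le_eLpNorm_of_exponent_le (by norm_num) hf.1)

lemma tendsto_truncate_subtype {q : ℕ} (K : Set (Fin q → ℕ)) [DecidablePred (· ∈ K)] :
    Tendsto (fun n => (truncate K n).subtype (· ∈ K)) atTop (atTop : Filter (Finset K)) := by
  refine tendsto_atTop_finset_of_monotone (fun m n hmn i hi => ?_) fun i => ?_
  · obtain ⟨hiK, him⟩ := mem_truncate.1 (Finset.mem_subtype.1 hi)
    exact Finset.mem_subtype.2
      (mem_truncate.2 ⟨hiK, him.trans (Finset.range_subset_range.2 hmn)⟩)
  · refine ⟨(entries i.1).sup id + 1, Finset.mem_subtype.2 (mem_truncate.2 ⟨i.2, fun k hk => ?_⟩)⟩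
    exact Finset.mem_range.2 (Nat.lt_succ_of_le (Finset.le_sup (f := id) hk))

/-- The truncations are cofinal among the finite partial sums, so they converge to S in L², and a
1-Lipschitz h sees only the L¹ distance. The bounds on influences and sharp pairs are uniform in n,
while the variances tend to 1. -/
lemma IsStdIndep.normal_approx_limit {P : Measure Ω} [IsProbabilityMeasure P] {X : ℕ → Ω → ℝ}
    {M : ℝ} (hX : IsStdIndep P X M) {h : ℝ → ℝ} (hh : LipschitzWith 1 h) {b : ℕ → ℝ} {q : ℕ}
    (hq : 1 ≤ q) {K : Set (Fin q → ℕ)} (hK : IsSymmetricOffDiagonal K)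
    (h0 : weightPow b q K ≠ 0) (hfin : weightPow b q K ≠ ∞) {τ : ℝ} (hτ : 0 < τ)
    (hinf : ∀ j, (weightPow b q (star K j)).toReal / (weightPow b q K).toReal ≤ τ)
    {S : Ω → ℝ} (hS : MemLp S 2 P)
    (hlim : Tendsto (fun F : Finset K => eLpNorm (fun ω => S ω -
      1 / √(q.factorial * (weightPow b q K).toReal) * ∑ i ∈ F, ∏ k, b (i.1 k) * X (i.1 k) ω) 2 P)
      atTop (𝓝 0)) :
    |∫ ω, h (S ω) ∂P - ∫ x, h x ∂gaussianReal 0 1| ≤ cltConst q * M ^ q *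
      (√(weightPowPair b q (sharp K)).toReal / (weightPow b q K).toReal + √τ) := by
  classical
  set μ := (weightPow b q K).toReal
  have hμ : 0 < μ := ENNReal.toReal_pos h0 hfin
  have hqf : (0 : ℝ) < q.factorial := by exact_mod_cast q.factorial_pos
  set t : ℝ := 1 / √(q.factorial * μ)
  -- Summing over sets instead of tuples merges q! equal terms, so the coefficient of a set is q!
  -- times the normalization t. Then s²/q! = 1/μ, which turns the weights of K, K*_j and K^# into
  -- relative weights.
  set s : ℝ := q.factorial * t
  have hs : s ^ 2 / q.factorial = 1 / μ := by
    simp only [s, t, mul_pow, div_pow, one_pow]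
    rw [Real.sq_sqrt (by positivity)]
    field_simp
  have hst : s / q.factorial = t := by
    simp only [s]
    field_simp
  set c := tupleCoeff b K s
  set F : ℕ → Ω → ℝ := fun n => mpoly X (Finset.range n) c
  have hc : ∀ n, ∀ A ⊆ Finset.range n, c A ≠ 0 → A.card = q :=
    fun n A _ hA => card_of_tupleCoeff_ne_zero hK hA
  set v : ℕ → ℝ := fun n => ∑ A ∈ (Finset.range n).powerset, c A ^ 2
  have hv_eq : ∀ n, v n = 1 / μ * ∑ i ∈ truncate K n, tupleWeight b i := fun n => by
    simp only [v, c]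
    rw [sum_tupleCoeff_sq hK, hs]
  have hv1 : ∀ n, v n ≤ 1 := fun n => by
    rw [hv_eq, one_div, inv_mul_le_iff₀ hμ, mul_one]
    exact sum_tupleWeight_le b (fun i hi => (mem_truncate.1 hi).1) hfin
  have hv_lim : Tendsto v atTop (𝓝 1) := by
    have := (tendsto_sum_truncate hfin).const_mul (1 / μ)
    rw [one_div, inv_mul_cancel₀ hμ.ne'] at this
    refine this.congr fun n => ?_
    rw [hv_eq, one_div]
  set D := (weightPowPair b q (sharp K)).toReal
  have hsqrt : √((1 / μ) ^ 2 * D) = √D / μ := by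
    rw [Real.sqrt_mul (by positivity), Real.sqrt_sq (by positivity)]
    ring
  have hbound : ∀ n, |∫ ω, h (F n ω) ∂P - ∫ x, h x ∂gaussianReal 0 1|
      ≤ 6 * q * (1 - v n) + cltConst q * M ^ q * (√D / μ + √τ) := fun n => by
    rw [← hsqrt]
    refine hX.normal_approx hh hq (hc n)
      (fun A B A' B' hA hB hA' hB' => tupleCoeff_exchange hA hB hA' hB') hτ (fun j _ => ?_)
      (hv1 n) ?_
    · refine (influence_tupleCoeff_le hK hfin n j).trans (le_trans (le_of_eq ?_) (hinf j))
      rw [hs]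
      ring
    · rw [← hs]
      exact sharpSum_tupleCoeff_le hK hfin n
  have hFmem : ∀ n, MemLp (F n) 2 P := fun n =>
    (memLp_two_iff_integrable_sq (hX.measurable_mpoly _ _).aestronglyMeasurable).2
      (hX.integrable_mpoly_pow _ _ (by norm_num))
  have hFlim : Tendsto (fun n => (eLpNorm (S - F n) 2 P).toReal) atTop (𝓝 0) := by
    have h1 := (ENNReal.tendsto_toReal ENNReal.zero_ne_top).comp
      (hlim.comp (tendsto_truncate_subtype K))
    refine h1.congr fun n => ?_
    simp only [Function.comp_apply]
    congr 2
    funext ω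
    simp only [Pi.sub_apply, F, c]
    rw [mpoly_tupleCoeff hK, hst,
      Finset.sum_subtype_of_mem (fun i : Fin q → ℕ => ∏ k, b (i k) * X (i k) ω)
        fun i hi => (mem_truncate.1 hi).1]
  have hSi : Integrable S P := hS.integrable (by norm_num)
  have hFi : ∀ n, Integrable (F n) P := fun n => (hFmem n).integrable (by norm_num)
  have hall : ∀ n, |∫ ω, h (S ω) ∂P - ∫ x, h x ∂gaussianReal 0 1|
      ≤ (eLpNorm (S - F n) 2 P).toReal
        + (6 * q * (1 - v n) + cltConst q * M ^ q * (√D / μ + √τ)) := fun n => by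
    have i1 := integrable_lipschitz_of_integrable_id hh hSi
    have i2 := integrable_lipschitz_of_integrable_id hh (hFi n)
    have h1 : |∫ ω, h (S ω) ∂P - ∫ ω, h (F n ω) ∂P| ≤ (eLpNorm (S - F n) 2 P).toReal := by
      rw [← integral_sub i1 i2]
      refine abs_integral_le_integral_abs.trans
        (le_trans ?_ (integral_abs_le_eLpNorm_two (hS.sub (hFmem n))))
      exact integral_mono (i1.sub i2).abs (hSi.sub (hFi n)).abs
        fun ω => abs_sub_le_of_lipschitz hh _ _
    exact (abs_sub_le _ (∫ ω, h (F n ω) ∂P) _).trans (add_le_add h1 (hbound n))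
  have hlim_rhs : Tendsto (fun n => (eLpNorm (S - F n) 2 P).toReal
      + (6 * q * (1 - v n) + cltConst q * M ^ q * (√D / μ + √τ))) atTop
      (𝓝 (0 + (6 * q * (1 - 1) + cltConst q * M ^ q * (√D / μ + √τ)))) :=
    hFlim.add (((hv_lim.const_sub 1).const_mul _).add_const _)
  have := ge_of_tendsto' hlim_rhs hall
  simpa using this

/-- Standardization of an i.i.d. sequence. -/
lemma exists_standardization {P : Measure Ω} [IsProbabilityMeasure P] {X : ℕ → Ω → ℝ}
    (hind : iIndepFun X P) (hid : ∀ k, IdentDistrib (X k) (X 1) P P) (h2 : MemLp (X 1) 2 P)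
    (hmean : ∫ ω, X 1 ω ∂P = 0) (hvar : ∫ ω, X 1 ω ^ 2 ∂P ≠ 0) :
    ∃ Y : ℕ → Ω → ℝ, IsStdL2Seq P Y ∧
      (∀ k, ∀ᵐ ω ∂P, X k ω = √(∫ ω, X 1 ω ^ 2 ∂P) * Y k ω) ∧
      (Integrable (fun ω => X 1 ω ^ 4) P →
        IsStdIndep P Y ((∫ ω, X 1 ω ^ 4 ∂P) / (∫ ω, X 1 ω ^ 2 ∂P) ^ 2)) := by
  set σ := √(∫ ω, X 1 ω ^ 2 ∂P)
  have hpos : 0 < ∫ ω, X 1 ω ^ 2 ∂P :=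
    lt_of_le_of_ne (integral_nonneg fun ω => sq_nonneg _) hvar.symm
  have hσ : 0 < σ := Real.sqrt_pos.2 hpos
  have hσ2 : σ ^ 2 = ∫ ω, X 1 ω ^ 2 ∂P := Real.sq_sqrt hpos.le
  have hm : ∀ k, AEMeasurable (X k) P := fun k => (hid k).aemeasurable_fst
  -- Identical distribution supplies only almost everywhere measurability, so measurable versions
  -- are used.
  set Z : ℕ → Ω → ℝ := fun k => (hm k).mk (X k)
  have hZm : ∀ k, Measurable (Z k) := fun k => (hm k).measurable_mk
  have hXZ : ∀ k, X k =ᵐ[P] Z k := fun k => (hm k).ae_eq_mk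
  have hZind : iIndepFun Z P := hind.congr hXZ
  have hZid : ∀ k, IdentDistrib (Z k) (X 1) P P := fun k =>
    (IdentDistrib.of_ae_eq (hm k) (hXZ k)).symm.trans (hid k)
  set Y : ℕ → Ω → ℝ := fun k ω => Z k ω / σ
  have hYid : ∀ k, IdentDistrib (Y k) (fun ω => X 1 ω / σ) P P := fun k =>
    (hZid k).comp (u := fun x => x / σ) (measurable_id.div_const σ)
  have hseq : IsIndepSeq P Y :=
    ⟨fun k => (hZm k).div_const σ, hZind.comp (fun _ x => x / σ) fun _ => measurable_id.div_const σ⟩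
  have hYmean : ∀ k, ∫ ω, Y k ω ∂P = 0 := fun k => by
    rw [(hYid k).integral_eq, integral_div, hmean, zero_div]
  have hpow : ∀ k n, ∫ ω, Y k ω ^ n ∂P = (∫ ω, X 1 ω ^ n ∂P) / σ ^ n := fun k n => by
    have := ((hYid k).comp (u := fun x => x ^ n) (measurable_id.pow_const n)).integral_eq
    simp only [Function.comp_def, div_pow] at this
    rw [this, integral_div]
  have hYvar : ∀ k, ∫ ω, Y k ω ^ 2 ∂P = 1 := fun k => by
    rw [hpow, hσ2, div_self hvar]
  refine ⟨Y, ⟨hseq, fun k => ?_, hYmean, hYvar⟩, fun k => ?_, fun h4 =>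
    ⟨hseq, fun k => ?_, hYmean, hYvar, fun k => ?_⟩⟩
  · refine (hYid k).symm.memLp_snd ?_
    simpa only [div_eq_mul_inv] using h2.mul_const σ⁻¹
  · filter_upwards [hXZ k] with ω hω
    rw [hω]
    simp only [Y]
    field_simp
  · have := ((hYid k).comp (u := fun x => x ^ 4) (measurable_id.pow_const 4)).symm.integrable_snd
    refine this ?_
    simp only [Function.comp_def, div_pow]
    exact h4.div_const _
  · rw [hpow, ← hσ2, ← pow_mul]

lemma iSup_star_div_le_one {b : ℕ → ℝ} {q : ℕ} {K : Set (Fin q → ℕ)} :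
    ⨆ j : ℕ, weightPow b q (star K j) / weightPow b q K ≤ 1 :=
  iSup_le fun j => ENNReal.div_le_of_le_mul (by
    rw [one_mul]; exact measure_mono (star_subset K j))

/-- Since q ≥ 1, every tuple has an entry, so the countably many stars cover K and cannot all be
null. This allows the supremum to serve as τ > 0 and keeps the bracket in the final bound positive.
-/
lemma iSup_star_div_ne_zero {b : ℕ → ℝ} {q : ℕ} (hq : 1 ≤ q) {K : Set (Fin q → ℕ)}
    (h0 : weightPow b q K ≠ 0) (hfin : weightPow b q K ≠ ∞) :
    ⨆ j : ℕ, weightPow b q (star K j) / weightPow b q K ≠ 0 := by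
  intro h
  apply h0
  have hz : ∀ j, weightPow b q (star K j) = 0 := fun j => by
    have := (iSup_eq_bot.1 h) j
    exact (ENNReal.div_eq_zero_iff.1 this).resolve_right hfin
  refine measure_mono_null (t := ⋃ j, star K j) (fun i hi => ?_) (measure_iUnion_null hz)
  exact Set.mem_iUnion.2 ⟨i ⟨0, hq⟩, hi, ⟨0, hq⟩, rfl⟩

end CombCLT

/-! ### The main theorem: reduction to standardized variables and translation to extended
nonnegative reals. -/

theorem theorem5p4 (q : ℕ) (hq : 1 ≤ q) :
    ∃ C : ℝ≥0, ∀ {Ω : Type*} [MeasurableSpace Ω] (P : Measure Ω) [IsProbabilityMeasure P]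
      (X : ℕ → Ω → ℝ) (b : ℕ → ℝ) (K : Set (Fin q → ℕ)),
      iIndepFun X P → (∀ k, IdentDistrib (X k) (X 1) P P) →
      MemLp (X 1) 2 P → ∫ ω, X 1 ω ∂P = 0 → ∫ ω, X 1 ω ^ 2 ∂P ≠ 0 →
      CombCLT.IsSymmetricOffDiagonal K →
      CombCLT.weightPow b q K ≠ 0 → CombCLT.weightPow b q K ≠ ∞ →
      (∃ S : Ω → ℝ, CombCLT.IsHomogeneousSum P X b K S) ∧
      ∀ S : Ω → ℝ, CombCLT.IsHomogeneousSum P X b K S →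
        CombCLT.wassersteinDist (P.map S) (gaussianReal 0 1) ≤
          C * ((∫⁻ ω, ‖X 1 ω‖ₑ ^ 4 ∂P) / (∫⁻ ω, ‖X 1 ω‖ₑ ^ 2 ∂P) ^ 2) ^ q *
            (CombCLT.weightPowPair b q (CombCLT.sharp K) ^ (1 / 2 : ℝ) / CombCLT.weightPow b q K +
              (⨆ j : ℕ, CombCLT.weightPow b q (CombCLT.star K j) /
                CombCLT.weightPow b q K) ^ (1 / 4 : ℝ)) := by
  refine ⟨(CombCLT.cltConst q).toNNReal, ?_⟩
  intro Ω _ P _ X b K hind hid h2 hmean hvar hK h0 hfin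
  obtain ⟨Y, hY, hXY, hY4⟩ := CombCLT.exists_standardization hind hid h2 hmean hvar
  have hpos : 0 < ∫ ω, X 1 ω ^ 2 ∂P :=
    lt_of_le_of_ne (integral_nonneg fun ω => sq_nonneg _) hvar.symm
  set W := CombCLT.weightPow b q K
  have hμ : 0 < W.toReal := ENNReal.toReal_pos h0 hfin
  -- Each product of q variables scales by σ^q with σ² = E[X₁²], which cancels against the moment
  -- factor in the normalization.
  have hterm : ∀ (F : Finset K) (S : Ω → ℝ),
      (fun ω => S ω - CombCLT.normFactor P X b K * ∑ i ∈ F, ∏ k, b (i.1 k) * X (i.1 k) ω)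
      =ᵐ[P] fun ω => S ω - 1 / √(q.factorial * W.toReal) *
        ∑ i ∈ F, ∏ k, b (i.1 k) * Y (i.1 k) ω := fun F S => by
    filter_upwards [ae_all_iff.2 hXY] with ω hω
    have e : ∀ i : K, ∏ k, b (i.1 k) * X (i.1 k) ω
        = √(∫ ω, X 1 ω ^ 2 ∂P) ^ q * ∏ k, b (i.1 k) * Y (i.1 k) ω := fun i => by
      have : ∀ k, b (i.1 k) * X (i.1 k) ω
          = √(∫ ω, X 1 ω ^ 2 ∂P) * (b (i.1 k) * Y (i.1 k) ω) := fun k => by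
        rw [hω]; ring
      simp only [this]
      rw [Finset.prod_mul_distrib, Finset.prod_const, Finset.card_univ, Fintype.card_fin]
    have hn : CombCLT.normFactor P X b K * √(∫ ω, X 1 ω ^ 2 ∂P) ^ q
        = 1 / √(q.factorial * W.toReal) := by
      have hsq : √((∫ ω, X 1 ω ^ 2 ∂P) ^ q) = √(∫ ω, X 1 ω ^ 2 ∂P) ^ q := by
        rw [Real.sqrt_eq_iff_mul_self_eq (by positivity) (by positivity), ← mul_pow,
          Real.mul_self_sqrt hpos.le]
      have hs0 : √(∫ ω, X 1 ω ^ 2 ∂P) ≠ 0 := (Real.sqrt_pos.2 hpos).ne'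
      have hnf : CombCLT.normFactor P X b K
          = 1 / √(q.factorial * W.toReal * (∫ ω, X 1 ω ^ 2 ∂P) ^ q) := rfl
      rw [hnf, Real.sqrt_mul (by positivity), hsq, one_div_mul_eq_div,
        div_mul_cancel_right₀ (pow_ne_zero q hs0), one_div]
    simp only [e]
    rw [← Finset.mul_sum, ← mul_assoc, hn]
  have hiff : ∀ S : Ω → ℝ, CombCLT.IsHomogeneousSum P X b K S ↔
      MemLp S 2 P ∧ Tendsto (fun F : Finset K => eLpNorm (fun ω => S ω -
        1 / √(q.factorial * W.toReal) * ∑ i ∈ F, ∏ k, b (i.1 k) * Y (i.1 k) ω) 2 P)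
        atTop (𝓝 0) := fun S => by
    rw [CombCLT.IsHomogeneousSum]
    simp only [eLpNorm_congr_ae (hterm _ S)]
  refine ⟨?_, fun S hS => ?_⟩
  · obtain ⟨S, hS⟩ := hY.exists_tendsto (b := b) hK hfin (1 / √(q.factorial * W.toReal))
    exact ⟨S, (hiff S).2 hS⟩
  obtain ⟨hSmem, hSlim⟩ := (hiff S).1 hS
  set T := ⨆ j : ℕ, CombCLT.weightPow b q (CombCLT.star K j) / W
  have hT0 : T ≠ 0 := CombCLT.iSup_star_div_ne_zero hq h0 hfin
  have hT1 : T ≤ 1 := CombCLT.iSup_star_div_le_one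
  have hTtop : T ≠ ∞ := ne_top_of_le_ne_top ENNReal.one_ne_top hT1
  have hC := CombCLT.cltConst_pos hq
  have hE2 : ∫⁻ ω, ‖X 1 ω‖ₑ ^ 2 ∂P = ENNReal.ofReal (∫ ω, X 1 ω ^ 2 ∂P) := by
    rw [ofReal_integral_eq_lintegral_ofReal h2.integrable_sq (ae_of_all _ fun ω => sq_nonneg _)]
    refine lintegral_congr fun ω => ?_
    rw [← sq_abs, ENNReal.ofReal_pow (abs_nonneg _), ← Real.enorm_eq_ofReal_abs]
  have hm4 : ∀ ω, ‖X 1 ω‖ₑ ^ 4 = ‖X 1 ω ^ 4‖ₑ := fun ω => (enorm_pow _ _).symm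
  -- With ∞ * 0 = 0 in `ℝ≥0∞`, an infinite fourth moment makes the bound trivial only because the
  -- constant and the bracket are nonzero and q ≥ 1.
  by_cases h4 : ∫⁻ ω, ‖X 1 ω‖ₑ ^ 4 ∂P = ∞
  · have htop : ((∫⁻ ω, ‖X 1 ω‖ₑ ^ 4 ∂P) / (∫⁻ ω, ‖X 1 ω‖ₑ ^ 2 ∂P) ^ 2) ^ q = ∞ := by
      rw [h4, hE2, ENNReal.top_div_of_ne_top (ENNReal.pow_ne_top ENNReal.ofReal_ne_top),
        ENNReal.top_pow (by omega)]
    have hb : CombCLT.weightPowPair b q (CombCLT.sharp K) ^ (1 / 2 : ℝ) / W + T ^ (1 / 4 : ℝ) ≠ 0 := by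
      intro h
      have := (add_eq_zero.1 h).2
      rw [ENNReal.rpow_eq_zero_iff] at this
      rcases this with h | h
      · exact hT0 h.1
      · exact hTtop h.1
    rw [htop, ENNReal.mul_top (by simpa using hC), ENNReal.top_mul hb]
    exact le_top
  have hi4 : Integrable (fun ω => X 1 ω ^ 4) P := by
    refine ⟨(h2.1.aemeasurable.pow_const 4).aestronglyMeasurable, ?_⟩
    rw [hasFiniteIntegral_iff_enorm]
    simp only [← hm4]
    exact lt_top_iff_ne_top.2 h4
  have hYs := hY4 hi4
  set M := (∫ ω, X 1 ω ^ 4 ∂P) / (∫ ω, X 1 ω ^ 2 ∂P) ^ 2 with hM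
  have hM0 : 0 ≤ M := zero_le_one.trans hYs.one_le
  have hE4 : ∫⁻ ω, ‖X 1 ω‖ₑ ^ 4 ∂P = ENNReal.ofReal (∫ ω, X 1 ω ^ 4 ∂P) := by
    rw [ofReal_integral_eq_lintegral_ofReal hi4 (ae_of_all _ fun ω => by positivity)]
    refine lintegral_congr fun ω => ?_
    rw [hm4, Real.enorm_eq_ofReal (by positivity)]
  have hratio : (∫⁻ ω, ‖X 1 ω‖ₑ ^ 4 ∂P) / (∫⁻ ω, ‖X 1 ω‖ₑ ^ 2 ∂P) ^ 2 = ENNReal.ofReal M := by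
    rw [hE4, hE2, hM, ENNReal.ofReal_div_of_pos (by positivity), ENNReal.ofReal_pow hpos.le]
  have hinf : ∀ j, (CombCLT.weightPow b q (CombCLT.star K j)).toReal / W.toReal ≤ T.toReal :=
    fun j => by
      rw [← ENNReal.toReal_div]
      exact ENNReal.toReal_mono hTtop
        (le_iSup (fun j => CombCLT.weightPow b q (CombCLT.star K j) / W) j)
  rw [CombCLT.wassersteinDist]
  refine iSup₂_le fun h hh => ?_
  rw [integral_map hSmem.1.aemeasurable hh.continuous.aestronglyMeasurable]
  have key := hYs.normal_approx_limit hh hq hK h0 hfin (ENNReal.toReal_pos hT0 hTtop) hinf hSmem hSlim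
  refine (ENNReal.ofReal_le_ofReal key).trans ?_
  have hsharp : ENNReal.ofReal (√(CombCLT.weightPowPair b q (CombCLT.sharp K)).toReal / W.toReal)
      = CombCLT.weightPowPair b q (CombCLT.sharp K) ^ (1 / 2 : ℝ) / W := by
    rw [ENNReal.ofReal_div_of_pos hμ, ENNReal.ofReal_toReal hfin, Real.sqrt_eq_rpow,
      ← ENNReal.ofReal_rpow_of_nonneg ENNReal.toReal_nonneg (by norm_num),
      ENNReal.ofReal_toReal (CombCLT.weightPowPair_sharp_ne_top hfin)]
  -- The exponent 1/2 obtained above is better than 1/4, because T ≤ 1.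
  have hsup : ENNReal.ofReal √T.toReal ≤ T ^ (1 / 4 : ℝ) := by
    rw [Real.sqrt_eq_rpow, ← ENNReal.ofReal_rpow_of_nonneg ENNReal.toReal_nonneg (by norm_num),
      ENNReal.ofReal_toReal hTtop]
    exact ENNReal.rpow_le_rpow_of_exponent_ge hT1 (by norm_num)
  rw [ENNReal.ofReal_mul (by positivity), ENNReal.ofReal_mul hC.le, ENNReal.ofReal_pow hM0,
    ENNReal.ofReal_add (by positivity) (by positivity), hratio, hsharp]
  exact mul_le_mul_right (add_le_add le_rfl hsup) _
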